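/- **Setting.** Let $D=[0,1]^2$ and, for an integer $l>1$, let $h=1/l$ and let $\mathcal T_h$ be the mesh of the cells $T_{i,j}=[ih,(i+1)h]\times[jh,(j+1)h]$, $0\le i,j<l$. Let $\Omega\subset D$ be a domain of class $\mathcal C^s$, $s\ge1$: there are $R>0$, $P>1$, $M>0$ such that for every $z_0\in\partial\Omega$ there are an orthonormal system $(e_1,e_2)$ of $\mathbb R^2$ and a function $\psi\in\mathcal C^s([-R,R])$ with $\|\psi\|_{\mathcal C^s}\le M$ and values in $[-PR,PR]$ such that, for $|z_1|\le R$ and $|z_2|\le PR$, one has $z_0+z_1e_1+z_2e_2\in\Omega$ if and only if $z_2\le\psi(z_1)$. Here, with $m=\lceil s\rceil-1$ and $\alpha=s-m\in(0,1]$, $\mathcal C^s$ is the space of $m$ times continuously differentiable functions whose $m$-th derivative is $\alpha$-Hölder, with norm $\max_{j\le m}\|\psi^{(j)}\|_{L^\infty}+\sup_{x\ne y}|\psi^{(m)}(x)-\psi^{(m)}(y)|/|x-y|^{\alpha}$. Put $u=\chi_\Omega$ (on $\mathbb R^2$) and let $a_{i,j}=a_{T_{i,j}}(u)$, $(i,j)\in\mathbb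 Z^2$, be its cell averages (they vanish for cells outside $D$). A cell $T\in\mathcal T_h$ is singular if $|T\cap\Omega|\ne0$ and $|T\cap\Omega^c|\ne0$; $\mathcal S_h$ is the set of singular cells. **AEROS of degree $2k$, $k\ge1$.** Let $T=T_{i_T,j_T}\in\mathcal S_h$. Let $H_T=2a_{i_T+1,j_T}+a_{i_T+1,j_T+1}+a_{i_T+1,j_T-1}-(2a_{i_T-1,j_T}+a_{i_T-1,j_T+1}+a_{i_T-1,j_T-1})$ and $V_T=2a_{i_T,j_T+1}+a_{i_T+1,j_T+1}+a_{i_T-1,j_T+1}-(2a_{i_T,j_T-1}+a_{i_T+1,j_T-1}+a_{i_T-1,j_T-1})$. One uses the form $y\le p(x)$ if $|V_T|\ge|H_T|$ and $V_T\le0$; $y\ge p(x)$ if $|V_T|\ge|H_T|$ and $V_T>0$; $x\le p(y)$ if $|V_T|<|H_T|$ and $H_T\le0$; $x\ge p(y)$ if $|V_T|<|H_T|$ and $H_T>0$. In the first case one takes the stencil $S=S_T$ of the cells $(i,j)$ with $i_T-k^-\le i\le i_T+k^+$ and $j_T-l^-\le j\le j_T+l^+$, where either $k^\pm=k$ and $l^\pm=k+2$,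 or $k^-,k^+\ge0$ are any integers with $k^-+k^+=2k$ and $l^-$ (resp. $l^+$) is the least $l>0$ such that $a_{i,j_T-l-1}=1$ (resp. $a_{i,j_T+l+1}=0$) for all $i_T-k^-\le i\le i_T+k^+$ (if there is no such $l$, the value may be chosen arbitrarily). Let $p_T$ be the unique polynomial of degree at most $2k$ with $$\frac1h\int_{ih}^{(i+1)h}p_T(x)\,dx=h\sum_{j=j_T-l^-}^{j_T+l^+}a_{i,j}+(j_T-l^-)h,\qquad i_T-k^-\le i\le i_T+k^+,$$ and let $R_T(a_S(u))=\chi_{\{y\le p_T(x)\}}$. The other three cases are reduced to the first one by exchanging $x$ and $y$ and/or changing the sign of one variable. The global reconstruction is $\tilde u=\sum_{T\in\mathcal T_h}\tilde u_T\chi_T$ with $\tilde u_T=R_T(a_S(u))$ for $T\in\mathcal S_h$ and $\tilde u_T=a_T(u)$ otherwise. **Theorem (AEROS convergence).** Let $\Omega\subset D$ be a $\mathcal C^s$ domain for some $s\ge1$, let $k\ge1$, and put $r=\min\{s,2k+1\}$. There is a constant $C$, depending only on $\Omega$, $s$ and $k$, such that for every $h=1/l$ with an integer $l>1$, and for every admissible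 choice of the stencils, AEROS with polynomials of degree $2k$ satisfies $$\|u-R_T(a_S(u))\|_{L^1(T)}\le C\,h^{r+1}\quad\text{for every }T\in\mathcal S_h,\qquad\text{and}\qquad\|u-\tilde u\|_{L^1(D)}\le C\,h^{r}.$$ -/

import Mathlib

open MeasureTheory Set

noncomputable section

namespace Aeros

/-! ### Domains of class `C^s` -/

/-- `ψ ∈ C^s([-R,R])` with `‖ψ‖_{C^s} ≤ M`. Write `s = m + α` with `m = ⌈s⌉ - 1` an integer and
`0 < α ≤ 1`: the function is `m` times continuously differentiable on `[-R,R]` and its `m`-th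
derivative is `α`-Hölder (so, for integer `s`, the derivative of order `s - 1` is Lipschitz). Here
`A` bounds the derivatives of order `≤ m`, `B` bounds the Hölder quotient, and `A + B ≤ M`. -/
def HolderNormLE (s R M : ℝ) (ψ : ℝ → ℝ) : Prop :=
  ContDiffOn ℝ ((⌈s⌉₊ - 1 : ℕ) : WithTop ℕ∞) ψ (Icc (-R) R) ∧
  ∃ A B : ℝ, A + B ≤ M ∧
    (∀ j ≤ ⌈s⌉₊ - 1, ∀ x ∈ Icc (-R) R, |iteratedDerivWithin j ψ (Icc (-R) R) x| ≤ A) ∧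
    (∀ x ∈ Icc (-R) R, ∀ y ∈ Icc (-R) R,
      |iteratedDerivWithin (⌈s⌉₊ - 1) ψ (Icc (-R) R) x
        - iteratedDerivWithin (⌈s⌉₊ - 1) ψ (Icc (-R) R) y|
        ≤ B * |x - y| ^ (s - ((⌈s⌉₊ - 1 : ℕ) : ℝ)))

/-- `(e₁, e₂)` is an orthonormal system of the Euclidean plane. -/
def IsOrthonormalPair (e₁ e₂ : ℝ × ℝ) : Prop :=
  e₁.1 ^ 2 + e₁.2 ^ 2 = 1 ∧ e₂.1 ^ 2 + e₂.2 ^ 2 = 1 ∧ e₁.1 * e₂.1 + e₁.2 * e₂.2 = 0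

/-- `Ω` is a planar domain of class `C^s`: around each boundary point, in a rectangle of fixed size
and in suitable orthonormal coordinates, it is the subgraph of a function with a uniformly bounded
`C^s` norm. -/
def IsCsDomain (s : ℝ) (Ω : Set (ℝ × ℝ)) : Prop :=
  ∃ R P M : ℝ, 0 < R ∧ 1 < P ∧ 0 < M ∧ ∀ z₀ ∈ frontier Ω,
    ∃ (e₁ e₂ : ℝ × ℝ) (ψ : ℝ → ℝ), IsOrthonormalPair e₁ e₂ ∧ HolderNormLE s R M ψ ∧
      (∀ t ∈ Icc (-R) R, ψ t ∈ Icc (-(P * R)) (P * R)) ∧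
      ∀ z₁ z₂ : ℝ, |z₁| ≤ R → |z₂| ≤ P * R →
        (z₀ + z₁ • e₁ + z₂ • e₂ ∈ Ω ↔ z₂ ≤ ψ z₁)

/-! ### Mesh, cell averages, singular cells -/

/-- The unit square `D = [0,1]²`. -/
def unitSquare : Set (ℝ × ℝ) := Icc 0 1 ×ˢ Icc 0 1

/-- The closed cell of side `h` with lower left corner `(ih, jh)`, where `T = (i, j)`. -/
def cell (h : ℝ) (T : ℤ × ℤ) : Set (ℝ × ℝ) :=
  Icc (T.1 * h) ((T.1 + 1) * h) ×ˢ Icc (T.2 * h) ((T.2 + 1) * h)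

/-- The indices of the cells that partition the unit square when `h = 1/l`. -/
def mesh (l : ℕ) : Finset (ℤ × ℤ) := Finset.Ico 0 (l : ℤ) ×ˢ Finset.Ico 0 (l : ℤ)

/-- The characteristic function of a set. -/
def chi (Ω : Set (ℝ × ℝ)) : ℝ × ℝ → ℝ := Ω.indicator 1

/-- The cell averages `a_T(u)`. They are indexed by all of `ℤ²`; if `u` vanishes outside the unit
square, those of the cells outside the mesh are zero. -/
def cellAverages (h : ℝ) (u : ℝ × ℝ → ℝ) (T : ℤ × ℤ) : ℝ := ⨍ z in cell h T, u z

/-- The cell `T` is singular: it meets both `Ω` and its complement in positive area. -/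
def IsSingular (h : ℝ) (Ω : Set (ℝ × ℝ)) (T : ℤ × ℤ) : Prop :=
  volume (cell h T ∩ Ω) ≠ 0 ∧ volume (cell h T ∩ Ωᶜ) ≠ 0

/-! ### Orientation test -/

/-- Horizontal component of the numerical gradient (Sobel filter). -/
def sobelH (a : ℤ × ℤ → ℝ) (T : ℤ × ℤ) : ℝ :=
  2 * a (T.1 + 1, T.2) + a (T.1 + 1, T.2 + 1) + a (T.1 + 1, T.2 - 1)
    - (2 * a (T.1 - 1, T.2) + a (T.1 - 1, T.2 + 1) + a (T.1 - 1, T.2 - 1))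

/-- Vertical component of the numerical gradient (Sobel filter). -/
def sobelV (a : ℤ × ℤ → ℝ) (T : ℤ × ℤ) : ℝ :=
  2 * a (T.1, T.2 + 1) + a (T.1 + 1, T.2 + 1) + a (T.1 - 1, T.2 + 1)
    - (2 * a (T.1, T.2 - 1) + a (T.1 + 1, T.2 - 1) + a (T.1 - 1, T.2 - 1))

/-- The four forms `y ≤ p(x)`, `y ≥ p(x)`, `x ≤ p(y)`, `x ≥ p(y)`. -/
inductive Orientation
  | subY
  | epiY
  | subX
  | epiX

open Classical in
/-- The orientation selected by comparing the two components of the numerical gradient. -/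
def orientation (a : ℤ × ℤ → ℝ) (T : ℤ × ℤ) : Orientation :=
  if |sobelH a T| ≤ |sobelV a T| then
    if sobelV a T ≤ 0 then Orientation.subY else Orientation.epiY
  else
    if sobelH a T ≤ 0 then Orientation.subX else Orientation.epiX

namespace Orientation

/-- The exchange of `x` and `y` and/or change of sign of one variable that brings each form to the
standard form `y ≤ p(x)`. -/
def toStdPoint : Orientation → ℝ × ℝ → ℝ × ℝ
  | subY, z => z
  | epiY, z => (z.1, -z.2)
  | subX, z => (z.2, z.1)
  | epiX, z => (z.2, -z.1)

/-- The same change of variables, on cell indices. -/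
def toStdCell : Orientation → ℤ × ℤ → ℤ × ℤ
  | subY, T => T
  | epiY, T => (T.1, -1 - T.2)
  | subX, T => (T.2, T.1)
  | epiX, T => (T.2, -1 - T.1)

/-- The inverse change of variables, on cell indices. -/
def fromStdCell : Orientation → ℤ × ℤ → ℤ × ℤ
  | subY, T => T
  | epiY, T => (T.1, -1 - T.2)
  | subX, T => (T.2, T.1)
  | epiX, T => (-1 - T.2, T.1)

end Orientation

/-! ### Oriented stencils and the recovery, in the standard form `y ≤ p(x)` -/

/-- The shape of a stencil around `T = (i_T, j_T)`: the cells `(i, j)` with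
`i_T - km ≤ i ≤ i_T + kp` and `j_T - lm ≤ j ≤ j_T + lp`. -/
structure Stencil where
  km : ℕ
  kp : ℕ
  lm : ℕ
  lp : ℕ

/-- The shifts `l > 0` below which one finds a row of cells with average `1`. -/
def lowerShifts (a : ℤ × ℤ → ℝ) (T : ℤ × ℤ) (km kp : ℕ) : Set ℕ :=
  {l | 0 < l ∧ ∀ i ∈ Icc (T.1 - km) (T.1 + kp), a (i, T.2 - l - 1) = 1}

/-- The shifts `l > 0` above which one finds a row of cells with average `0`. -/
def upperShifts (a : ℤ × ℤ → ℝ) (T : ℤ × ℤ) (km kp : ℕ) : Set ℕ :=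
  {l | 0 < l ∧ ∀ i ∈ Icc (T.1 - km) (T.1 + kp), a (i, T.2 + l + 1) = 0}

/-- The fixed stencil, centered at `T`, of size `(2k+1) × (2(k+2)+1)`. -/
def IsFixedStencil (k : ℕ) (S : Stencil) : Prop :=
  S.km = k ∧ S.kp = k ∧ S.lm = k + 2 ∧ S.lp = k + 2

/-- An adaptive stencil of width `2k+1` containing `T`, horizontally centered or not, whose vertical
extents are the least shifts. Should there be no such shift, the extent is left arbitrary. -/
def IsAdaptiveStencil (k : ℕ) (a : ℤ × ℤ → ℝ) (T : ℤ × ℤ) (S : Stencil) : Prop :=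
  S.km + S.kp = 2 * k ∧
  ((lowerShifts a T S.km S.kp).Nonempty → IsLeast (lowerShifts a T S.km S.kp) S.lm) ∧
  ((upperShifts a T S.km S.kp).Nonempty → IsLeast (upperShifts a T S.km S.kp) S.lp)

/-- The column average `a_i`, computed from the data on the stencil. -/
def columnAverage (h : ℝ) (a : ℤ × ℤ → ℝ) (T : ℤ × ℤ) (S : Stencil) (i : ℤ) : ℝ :=
  h * ∑ j ∈ Finset.Icc (T.2 - S.lm) (T.2 + S.lp), a (i, j)

/-- `p` has degree at most `2k` and its averages on the intervals `[ih, (i+1)h]` are the column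
averages, shifted by the base elevation of the stencil. -/
def InterpolatesAverages (k : ℕ) (h : ℝ) (a : ℤ × ℤ → ℝ) (T : ℤ × ℤ) (S : Stencil)
    (p : Polynomial ℝ) : Prop :=
  p.natDegree ≤ 2 * k ∧ ∀ i ∈ Icc (T.1 - S.km) (T.1 + S.kp),
    (1 / h) * ∫ x in (i * h)..((i + 1) * h), p.eval x
      = columnAverage h a T S i + (T.2 - S.lm) * h

/-- The interpolant of averages `p_T` (it exists and is unique when `h > 0` and the stencil has
width `2k+1`). -/
def interpolant (k : ℕ) (h : ℝ) (a : ℤ × ℤ → ℝ) (T : ℤ × ℤ) (S : Stencil) : Polynomial ℝ :=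
  Classical.epsilon (InterpolatesAverages k h a T S)

/-! ### The method -/

/-- `S` is a stencil that the method may use on `T`, given the cell averages `a`; it is described in
the coordinates in which the selected orientation takes the standard form. -/
def IsAerosStencil (k : ℕ) (a : ℤ × ℤ → ℝ) (T : ℤ × ℤ) (S : Stencil) : Prop :=
  let o := orientation a T
  IsFixedStencil k S ∨ IsAdaptiveStencil k (a ∘ o.fromStdCell) (o.toStdCell T) S

/-- The local recovery `R_T(a_S)` on a singular cell `T`, from cell averages `a` and the stencil
`S`: the characteristic function of `{y ≤ p_T(x)}`, up to the change of variables that belongs to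
the selected orientation. -/
def recovery (k : ℕ) (h : ℝ) (a : ℤ × ℤ → ℝ) (T : ℤ × ℤ) (S : Stencil) : ℝ × ℝ → ℝ :=
  let o := orientation a T
  let p := interpolant k h (a ∘ o.fromStdCell) (o.toStdCell T) S
  chi {z | (o.toStdPoint z).2 ≤ p.eval (o.toStdPoint z).1}

open Classical in
/-- The reconstruction on one cell: the local recovery if `0 < a_T < 1`, the constant `a_T`
otherwise. -/
def cellReconstruction (k : ℕ) (h : ℝ) (a : ℤ × ℤ → ℝ) (S : ℤ × ℤ → Stencil) (T : ℤ × ℤ) :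
    ℝ × ℝ → ℝ :=
  if 0 < a T ∧ a T < 1 then recovery k h a T (S T) else fun _ => a T

/-- The global reconstruction `∑_T ũ_T χ_T` on the mesh of size `h = 1/l`. -/
def reconstruction (k l : ℕ) (a : ℤ × ℤ → ℝ) (S : ℤ × ℤ → Stencil) (z : ℝ × ℝ) : ℝ :=
  ∑ T ∈ mesh l, cellReconstruction k (1 / l) a S T z * chi (cell (1 / l) T) z

end Aeros

end

/-! For `s = 1` the local bound is just the area `h²` of the cell, and the same trivial bound
settles meshes that are not fine. Let `s > 1`, so that `r > 1`, and let `h` be small. A singular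
cell contains a boundary point. In the chart there, Taylor expansion with a Hölder remainder makes
the boundary a polynomial graph of degree at most `2k`, up to `O(h^r)`, but in a rotated frame.

The method needs a graph over a coordinate axis. Instead of inverting a `C^s` function, one solves
the implicit polynomial equation by Picard iteration among polynomials: each step gains one power of
`x`, and truncation at degree `2k` costs only a term of the order of the final defect
(`exists_polynomial_solution`). In units of `h`, the domain is then within `η = O(h^(r-1))` of the
subgraph of a polynomial `p` of degree at most `2k` (`exists_nearGraph`), provided that the normal
is not close to the graph's own axis.

The gradient test guarantees this. At unit scale the domain is almost a half plane
(`exists_nearHalfPlane`; this uses `r > 1`). If the normal leans clearly to the horizontal,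
comparing areas of cells with those of their mirror images in the diagonals shows that the
horizontal difference wins (`sobelH_lt_sobelV`, `abs_sobelV_lt`). So the selected form sees a
boundary of slope at most `1 + δ`, with `δ` so small that even the fixed stencil has only full cells
just below it and only empty cells just above it (`stencil_spec`).

With such rows, the column sums are the averages of `p` up to `O(η)`: nothing is cut off at the ends
of a column. A polynomial of degree at most `2k` is controlled by `2k + 1` consecutive averages
(`exists_stability_const`), so the interpolant is `O(η)`-close to `p` and the error set lies in a
strip of thickness `O(η)` (`exists_recovery_const`). Undoing the zoom multiplies areas by `h²` and
gives `h^(r+1)`.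

For the global bound, the boundary is covered by finitely many Lipschitz graphs, each meeting
`O(1/h)` cells (`IsChart.card_cells_le`). On cells of average `0` or `1` the reconstruction is exact
almost everywhere. -/

noncomputable section

namespace Aeros

open Polynomial

/-! ### The `ℓ¹` norm of the coefficients of a polynomial -/

/-- The sum of the absolute values of the coefficients. -/
def coeffNorm (p : ℝ[X]) : ℝ := ∑ i ∈ p.support, |p.coeff i|

lemma coeffNorm_eq_sum {p : ℝ[X]} {s : Finset ℕ} (h : p.support ⊆ s) :
    coeffNorm p = ∑ i ∈ s, |p.coeff i| :=
  Finset.sum_subset h fun i _ hi => by simp [notMem_support_iff.1 hi]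

lemma coeffNorm_nonneg (p : ℝ[X]) : 0 ≤ coeffNorm p :=
  Finset.sum_nonneg fun _ _ => abs_nonneg _

lemma coeffNorm_add_le (p q : ℝ[X]) : coeffNorm (p + q) ≤ coeffNorm p + coeffNorm q := by
  rw [coeffNorm_eq_sum (Polynomial.support_add (p := p) (q := q)),
    coeffNorm_eq_sum (Finset.subset_union_left (s₁ := p.support) (s₂ := q.support)),
    coeffNorm_eq_sum (Finset.subset_union_right (s₁ := p.support) (s₂ := q.support)),
    ← Finset.sum_add_distrib]
  exact Finset.sum_le_sum fun i _ => by rw [coeff_add]; exact abs_add_le _ _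

@[simp] lemma coeffNorm_zero : coeffNorm 0 = 0 := by simp [coeffNorm]

lemma coeffNorm_sum_le {ι : Type*} (s : Finset ι) (f : ι → ℝ[X]) :
    coeffNorm (∑ i ∈ s, f i) ≤ ∑ i ∈ s, coeffNorm (f i) := by
  classical
  induction s using Finset.induction_on with
  | empty => simp
  | insert a s ha ih =>
    rw [Finset.sum_insert ha, Finset.sum_insert ha]
    exact (coeffNorm_add_le _ _).trans (by linarith)

lemma coeffNorm_monomial (n : ℕ) (a : ℝ) : coeffNorm (monomial n a) = |a| := by
  rw [coeffNorm_eq_sum (support_monomial_subset (n := n) (a := a))]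
  simp

lemma coeffNorm_C (a : ℝ) : coeffNorm (C a) = |a| := by
  simpa using coeffNorm_monomial 0 a

lemma coeffNorm_X : coeffNorm X = 1 := by
  have := coeffNorm_monomial 1 1
  rwa [monomial_one_one_eq_X, abs_one] at this

/-- Submultiplicativity is the reason for choosing this norm: the norm of a Picard iterate is
bounded explicitly, hence uniformly in the boundary point. -/
lemma coeffNorm_mul_le (p q : ℝ[X]) : coeffNorm (p * q) ≤ coeffNorm p * coeffNorm q := by
  have h1 : p * q = ∑ i ∈ p.support, ∑ j ∈ q.support, monomial (i + j) (p.coeff i * q.coeff j) := by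
    conv_lhs => rw [p.as_sum_support, q.as_sum_support, Finset.sum_mul_sum]
    simp [monomial_mul_monomial]
  rw [h1]
  refine (coeffNorm_sum_le _ _).trans ?_
  rw [coeffNorm, coeffNorm, Finset.sum_mul_sum]
  refine Finset.sum_le_sum fun i _ => (coeffNorm_sum_le _ _).trans ?_
  exact Finset.sum_le_sum fun j _ => by rw [coeffNorm_monomial, abs_mul]

lemma coeffNorm_pow_le (p : ℝ[X]) (n : ℕ) : coeffNorm (p ^ n) ≤ coeffNorm p ^ n := by
  induction n with
  | zero => simpa using (coeffNorm_C 1).le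
  | succ n ih =>
    rw [pow_succ, pow_succ]
    exact (coeffNorm_mul_le _ _).trans (mul_le_mul_of_nonneg_right ih (coeffNorm_nonneg p))

/-- The part of degree at most `n` of a polynomial. -/
def lowPart (n : ℕ) (p : ℝ[X]) : ℝ[X] := ∑ i ∈ Finset.range (n + 1), monomial i (p.coeff i)

lemma natDegree_lowPart_le (n : ℕ) (p : ℝ[X]) : (lowPart n p).natDegree ≤ n := by
  refine natDegree_sum_le_of_forall_le _ _ fun i hi => (natDegree_monomial_le _).trans ?_
  have := Finset.mem_range.1 hi
  omega

lemma abs_eval_sub_lowPart_le (n : ℕ) (p : ℝ[X]) {x : ℝ} (hx : |x| ≤ 1) :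
    |p.eval x - (lowPart n p).eval x| ≤ coeffNorm p * |x| ^ (n + 1) := by
  set s := p.support ∪ Finset.range (n + 1) with hs
  have h1 : p.eval x = ∑ i ∈ s, p.coeff i * x ^ i := by
    rw [eval_eq_sum, Polynomial.sum]
    exact Finset.sum_subset Finset.subset_union_left fun i _ hi => by
      simp [notMem_support_iff.1 hi]
  have h2 : (lowPart n p).eval x = ∑ i ∈ Finset.range (n + 1), p.coeff i * x ^ i := by
    simp [lowPart, eval_finsetSum]
  have h3 := Finset.sum_sdiff (f := fun i => p.coeff i * x ^ i)
    (Finset.subset_union_right (s₁ := p.support) (s₂ := Finset.range (n + 1)))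
  rw [h1, h2, ← h3, add_sub_cancel_right,
    coeffNorm_eq_sum (Finset.subset_union_left (s₁ := p.support) (s₂ := Finset.range (n + 1))),
    Finset.sum_mul]
  refine (Finset.abs_sum_le_sum_abs _ _).trans ?_
  refine (Finset.sum_le_sum fun i hi => ?_).trans
    (Finset.sum_le_sum_of_subset_of_nonneg Finset.sdiff_subset fun i _ _ => by positivity)
  rw [abs_mul, abs_pow]
  refine mul_le_mul_of_nonneg_left ?_ (abs_nonneg _)
  refine pow_le_pow_of_le_one (abs_nonneg _) hx ?_
  simp only [Finset.mem_sdiff, Finset.mem_range] at hi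
  omega

/-! ### Polynomial solutions of an implicit equation -/

/-- `∑_{2 ≤ j ≤ n} c_j t^j`. -/
def highSum (n : ℕ) (c : ℕ → ℝ) (t : ℝ) : ℝ := ∑ j ∈ Finset.Ico 2 (n + 1), c j * t ^ j

/-- All exponents are at least `2`, so the Lipschitz constant on `[-m, m]` carries a factor `m`: the
nonlinear part is a contraction near the origin. -/
lemma abs_highSum_sub_le (n : ℕ) {M B : ℝ} (hB : 1 ≤ B) (c : ℕ → ℝ)
    (hc : ∀ j, |c j| ≤ M) {a b m : ℝ} (ha : |a| ≤ m) (hb : |b| ≤ m) (hm : m ≤ B) :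
    |highSum n c a - highSum n c b| ≤ (n + 1) ^ 2 * M * B ^ n * m * |a - b| := by
  have hM : 0 ≤ M := (abs_nonneg _).trans (hc 0)
  have hm0 : 0 ≤ m := (abs_nonneg _).trans ha
  rw [highSum, highSum, ← Finset.sum_sub_distrib]
  refine (Finset.abs_sum_le_sum_abs _ _).trans ?_
  have key : ∀ j ∈ Finset.Ico 2 (n + 1), |c j * a ^ j - c j * b ^ j|
      ≤ (n + 1) * M * B ^ n * m * |a - b| := by
    intro j hj
    have hj := Finset.mem_Ico.1 hj
    rw [← mul_sub, abs_mul]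
    have h1 := abs_pow_sub_pow_le a b j
    have h2 : max |a| |b| ^ (j - 1) ≤ B ^ n * m := by
      obtain ⟨i, rfl⟩ : ∃ i, j = i + 2 := ⟨j - 2, by omega⟩
      have h3 : max |a| |b| ≤ m := max_le ha hb
      have h0 : 0 ≤ max |a| |b| := (abs_nonneg a).trans (le_max_left _ _)
      rw [show i + 2 - 1 = i + 1 by omega, pow_succ]
      refine mul_le_mul ?_ h3 h0 (by positivity)
      exact (pow_le_pow_left₀ h0 (h3.trans hm) i).trans (pow_le_pow_right₀ hB (by omega))
    have h4 : (j : ℝ) ≤ n + 1 := by exact_mod_cast hj.2.le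
    calc |c j| * |a ^ j - b ^ j| ≤ M * (|a - b| * j * max |a| |b| ^ (j - 1)) :=
          mul_le_mul (hc j) h1 (abs_nonneg _) hM
      _ ≤ M * (|a - b| * (n + 1) * (B ^ n * m)) := by gcongr
      _ = _ := by ring
  refine (Finset.sum_le_sum key).trans ?_
  rw [Finset.sum_const, nsmul_eq_mul]
  have : ((Finset.Ico 2 (n + 1)).card : ℝ) ≤ n + 1 := by
    rw [Nat.card_Ico]
    exact_mod_cast Nat.sub_le _ _
  have h5 : 0 ≤ (n + 1) * M * B ^ n * m * |a - b| := by positivity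
  calc _ ≤ ((n : ℝ) + 1) * ((n + 1) * M * B ^ n * m * |a - b|) := by gcongr
    _ = _ := by ring

/-- Data of an implicit equation `α x + β y = ∑_{2 ≤ j ≤ n} c_j (a x + b y)^j` with coefficients
bounded by `M` and `β ≥ κ`. -/
structure ImplicitData (M κ : ℝ) where
  c : ℕ → ℝ
  a : ℝ
  b : ℝ
  α : ℝ
  β : ℝ
  abs_c_le : ∀ j, |c j| ≤ M
  abs_a_le : |a| ≤ 1
  abs_b_le : |b| ≤ 1
  abs_α_le : |α| ≤ M
  le_β : κ ≤ β

/-- The defect of the implicit equation. -/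
def ImplicitData.defect {M κ : ℝ} (D : ImplicitData M κ) (n : ℕ) (x y : ℝ) : ℝ :=
  D.α * x + D.β * y - highSum n D.c (D.a * x + D.b * y)

lemma ImplicitData.abs_lin_le {M κ : ℝ} (D : ImplicitData M κ) {x y t N : ℝ} (hx : |x| ≤ t)
    (hy : |y| ≤ N * t) : |D.a * x + D.b * y| ≤ (1 + N) * t := by
  have h1 : |D.a * x| ≤ 1 * t := by
    rw [abs_mul]; exact mul_le_mul D.abs_a_le hx (abs_nonneg _) zero_le_one
  have h2 : |D.b * y| ≤ 1 * (N * t) := by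
    rw [abs_mul]; exact mul_le_mul D.abs_b_le hy (abs_nonneg _) zero_le_one
  calc _ ≤ |D.a * x| + |D.b * y| := abs_add_le _ _
    _ ≤ _ := by linarith

lemma ImplicitData.abs_highSum_sub_le {M κ : ℝ} (D : ImplicitData M κ) (n : ℕ) {x y y' t N : ℝ}
    (hN : 0 ≤ N) (ht : t ≤ 1) (hx : |x| ≤ t) (hy : |y| ≤ N * t) (hy' : |y'| ≤ N * t) :
    |highSum n D.c (D.a * x + D.b * y) - highSum n D.c (D.a * x + D.b * y')|
      ≤ (n + 1) ^ 2 * M * (1 + N) ^ n * ((1 + N) * t) * |y - y'| := by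
  have hM : 0 ≤ M := (abs_nonneg _).trans (D.abs_c_le 0)
  have ht0 : 0 ≤ t := (abs_nonneg _).trans hx
  have h := Aeros.abs_highSum_sub_le n (B := 1 + N) (by linarith) D.c D.abs_c_le
    (D.abs_lin_le hx hy) (D.abs_lin_le hx hy') (by nlinarith)
  have h2 : |D.a * x + D.b * y - (D.a * x + D.b * y')| ≤ |y - y'| := by
    rw [show D.a * x + D.b * y - (D.a * x + D.b * y') = D.b * (y - y') by ring, abs_mul]
    exact mul_le_of_le_one_left (abs_nonneg _) D.abs_b_le
  refine h.trans (mul_le_mul_of_nonneg_left h2 (by positivity))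

/-- Picard iteration `y ↦ β⁻¹ (∑ c_j (a x + b y)^j - α x)`. The linear part is solved exactly, so
the new defect is only the variation of the nonlinear part, which is `O(|x|)` times the previous
correction. Hence one power of `x` is gained at each step, with constants that depend on `n`, `M`,
`κ` and `i` alone. -/
lemma exists_approx_solution (n : ℕ) {M κ : ℝ} (hM : 0 ≤ M) (hκ : 0 < κ) (i : ℕ) :
    ∃ N : ℝ, 0 ≤ N ∧ ∀ D : ImplicitData M κ, ∃ p : ℝ[X], coeffNorm p ≤ N ∧
      ∀ x : ℝ, |x| ≤ 1 → |p.eval x| ≤ N * |x| ∧ |D.defect n x (p.eval x)| ≤ N * |x| ^ (i + 1) := by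
  induction i with
  | zero =>
    -- The iteration starts from `y = 0`, whose defect `α x - ∑ c_j (a x)^j` is `O(|x|)`.
    refine ⟨M + (n + 1) ^ 2 * M, by positivity, fun D => ⟨0, by simp; positivity, fun x hx => ?_⟩⟩
    have h := Aeros.abs_highSum_sub_le n le_rfl D.c D.abs_c_le (a := D.a * x) (b := 0) (m := 1)
      (by rw [abs_mul]; exact mul_le_one₀ D.abs_a_le (abs_nonneg _) hx) (by simp) le_rfl
    have h0 : highSum n D.c 0 = 0 := Finset.sum_eq_zero fun j hj => by
      have := (Finset.mem_Ico.1 hj).1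
      rw [zero_pow (by omega), mul_zero]
    rw [h0] at h
    refine ⟨by simp; positivity, ?_⟩
    simp only [ImplicitData.defect, eval_zero, mul_zero, add_zero, zero_add, pow_one]
    simp only [sub_zero, one_pow, mul_one] at h
    have h1 : |D.α * x| ≤ M * |x| := by
      rw [abs_mul]; exact mul_le_mul_of_nonneg_right D.abs_α_le (abs_nonneg _)
    have h2 : |D.a * x| ≤ |x| := by
      rw [abs_mul]; exact mul_le_of_le_one_left (abs_nonneg _) D.abs_a_le
    have h3 : (n + 1 : ℝ) ^ 2 * M * |D.a * x| ≤ (n + 1) ^ 2 * M * |x| := by gcongr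
    have h4 := abs_sub (D.α * x) (highSum n D.c (D.a * x))
    linarith
  | succ i ih =>
    obtain ⟨N, hN, h⟩ := ih
    set N₁ := N + N / κ with hN₁
    have hN₁0 : 0 ≤ N₁ := by positivity
    set N₂ := κ⁻¹ * ((∑ j ∈ Finset.Ico 2 (n + 1), M * (1 + N) ^ j) + M) with hN₂
    have hN₂0 : 0 ≤ N₂ := by positivity
    set N₃ := (n + 1) ^ 2 * M * (1 + N₁) ^ n * (1 + N₁) * (N / κ) with hN₃
    have hN₃0 : 0 ≤ N₃ := by positivity
    refine ⟨N₁ + N₂ + N₃, by positivity, fun D => ?_⟩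
    obtain ⟨p, hp, hpx⟩ := h D
    have hβ : 0 < D.β := hκ.trans_le D.le_β
    have hβκ : D.β⁻¹ ≤ κ⁻¹ := inv_anti₀ hκ D.le_β
    let p' : ℝ[X] := C D.β⁻¹ *
      ((∑ j ∈ Finset.Ico 2 (n + 1), C (D.c j) * (C D.a * X + C D.b * p) ^ j) + C (-D.α) * X)
    have hev : ∀ x, p'.eval x
        = D.β⁻¹ * (highSum n D.c (D.a * x + D.b * p.eval x) - D.α * x) := by
      intro x
      simp [p', highSum, eval_finsetSum, sub_eq_add_neg]
    -- The correction made by one step is the old defect divided by `-β`.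
    have hdiff : ∀ x, p'.eval x - p.eval x = - (D.β⁻¹ * D.defect n x (p.eval x)) := by
      intro x
      rw [hev, ImplicitData.defect]
      field_simp
      ring
    have hlin : coeffNorm (C D.a * X + C D.b * p) ≤ 1 + N := by
      refine (coeffNorm_add_le _ _).trans (add_le_add ?_ ?_)
      · refine (coeffNorm_mul_le _ _).trans ?_
        rw [coeffNorm_C, coeffNorm_X, mul_one]; exact D.abs_a_le
      · refine (coeffNorm_mul_le _ _).trans ?_
        rw [coeffNorm_C]
        exact (mul_le_mul D.abs_b_le hp (coeffNorm_nonneg _) zero_le_one).trans (by linarith)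
    have hnorm : coeffNorm p' ≤ N₂ := by
      refine (coeffNorm_mul_le _ _).trans ?_
      rw [coeffNorm_C, abs_of_pos (inv_pos.2 hβ)]
      refine mul_le_mul hβκ ?_ (coeffNorm_nonneg _) (by positivity)
      refine (coeffNorm_add_le _ _).trans (add_le_add ?_ ?_)
      · refine (coeffNorm_sum_le _ _).trans (Finset.sum_le_sum fun j _ => ?_)
        refine (coeffNorm_mul_le _ _).trans ?_
        rw [coeffNorm_C]
        refine mul_le_mul (D.abs_c_le j) ?_ (coeffNorm_nonneg _) hM
        exact (coeffNorm_pow_le _ _).trans (pow_le_pow_left₀ (coeffNorm_nonneg _) hlin j)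
      · refine (coeffNorm_mul_le _ _).trans ?_
        rw [coeffNorm_C, coeffNorm_X, mul_one, abs_neg]; exact D.abs_α_le
    refine ⟨p', by linarith, fun x hx => ?_⟩
    obtain ⟨hx1, hx2⟩ := hpx x hx
    have hd : |p'.eval x - p.eval x| ≤ N / κ * |x| ^ (i + 1) := by
      rw [hdiff, abs_neg, abs_mul, abs_of_pos (inv_pos.2 hβ), div_eq_inv_mul, mul_assoc]
      exact mul_le_mul hβκ hx2 (abs_nonneg _) (by positivity)
    have hpow : |x| ^ (i + 1) ≤ |x| := by
      simpa using pow_le_pow_of_le_one (abs_nonneg x) hx (show 1 ≤ i + 1 by omega)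
    have hd1 : |p'.eval x - p.eval x| ≤ N / κ * |x| :=
      hd.trans (mul_le_mul_of_nonneg_left hpow (by positivity))
    have hp1 : |p.eval x| ≤ N₁ * |x| := hx1.trans (by gcongr; simp [hN₁]; positivity)
    have hp'1 : |p'.eval x| ≤ N₁ * |x| := by
      have := abs_add_le (p'.eval x - p.eval x) (p.eval x)
      rw [sub_add_cancel] at this
      rw [hN₁, add_mul]; linarith
    refine ⟨hp'1.trans (by gcongr; linarith), ?_⟩
    -- The correction cancels the old defect, up to the change in the nonlinear term.
    have hdef : D.defect n x (p'.eval x)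
        = -(highSum n D.c (D.a * x + D.b * p'.eval x)
            - highSum n D.c (D.a * x + D.b * p.eval x)) := by
      have h1 : D.β * (p'.eval x - p.eval x) = - D.defect n x (p.eval x) := by
        rw [hdiff]; field_simp
      simp only [ImplicitData.defect] at h1 ⊢
      linarith
    rw [hdef, abs_neg]
    refine (D.abs_highSum_sub_le n hN₁0 hx le_rfl hp'1 hp1).trans ?_
    calc (n + 1) ^ 2 * M * (1 + N₁) ^ n * ((1 + N₁) * |x|) * |eval x p' - eval x p|
        ≤ (n + 1) ^ 2 * M * (1 + N₁) ^ n * ((1 + N₁) * |x|) * (N / κ * |x| ^ (i + 1)) := by gcongr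
      _ = N₃ * |x| ^ (i + 1 + 1) := by rw [hN₃]; ring
      _ ≤ _ := by gcongr; linarith

/-- An implicit equation has an approximate solution that is a polynomial of degree at most `n`,
with a defect of order `n + 1`, uniformly in the data. -/
lemma exists_polynomial_solution (n : ℕ) {M κ : ℝ} (hM : 0 ≤ M) (hκ : 0 < κ) :
    ∃ N : ℝ, 0 ≤ N ∧ ∀ D : ImplicitData M κ, D.β ≤ M → ∃ p : ℝ[X], p.natDegree ≤ n ∧
      ∀ x : ℝ, |x| ≤ 1 → |p.eval x| ≤ N * |x| ∧ |D.defect n x (p.eval x)| ≤ N * |x| ^ (n + 1) := by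
  obtain ⟨N, hN, h⟩ := exists_approx_solution n hM hκ n
  set N₁ := N + N with hN₁
  have hN₁0 : 0 ≤ N₁ := by positivity
  set N₂ := N + M * N + (n + 1) ^ 2 * M * (1 + N₁) ^ n * (1 + N₁) * N with hN₂
  have hN₂0 : 0 ≤ N₂ := by positivity
  refine ⟨N₁ + N₂, by positivity, fun D hD => ?_⟩
  obtain ⟨p, hp, hpx⟩ := h D
  -- The discarded monomials have degree greater than `n` and contribute `O(|x|^(n+1))`, the order
  -- of the defect already reached. The upper bound on `β` serves to control their effect.
  refine ⟨lowPart n p, natDegree_lowPart_le _ _, fun x hx => ?_⟩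
  obtain ⟨hx1, hx2⟩ := hpx x hx
  set y := p.eval x
  set y' := (lowPart n p).eval x
  have hd : |y - y'| ≤ N * |x| ^ (n + 1) :=
    (abs_eval_sub_lowPart_le n p hx).trans (by gcongr)
  have hpow : |x| ^ (n + 1) ≤ |x| := by
    simpa using pow_le_pow_of_le_one (abs_nonneg x) hx (show 1 ≤ n + 1 by omega)
  have hd1 : |y - y'| ≤ N * |x| := hd.trans (mul_le_mul_of_nonneg_left hpow hN)
  have hy : |y| ≤ N₁ * |x| := hx1.trans (by gcongr; linarith)
  have hy' : |y'| ≤ N₁ * |x| := by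
    have := abs_sub y (y - y')
    rw [sub_sub_cancel] at this
    rw [hN₁, add_mul]; linarith
  refine ⟨hy'.trans (by gcongr; linarith), ?_⟩
  have h1 := D.abs_highSum_sub_le n hN₁0 hx le_rfl hy hy'
  have h2 : (n + 1) ^ 2 * M * (1 + N₁) ^ n * ((1 + N₁) * |x|) * |y - y'|
      ≤ (n + 1) ^ 2 * M * (1 + N₁) ^ n * ((1 + N₁) * 1) * (N * |x| ^ (n + 1)) := by gcongr
  have h3 : |D.β * (y - y')| ≤ M * (N * |x| ^ (n + 1)) := by
    rw [abs_mul, abs_of_pos (hκ.trans_le D.le_β)]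
    exact mul_le_mul hD hd (abs_nonneg _) hM
  have h4 : D.defect n x y' = D.defect n x y - D.β * (y - y')
      + (highSum n D.c (D.a * x + D.b * y) - highSum n D.c (D.a * x + D.b * y')) := by
    simp only [ImplicitData.defect]; ring
  have h5 : |D.defect n x y'| ≤ N₂ * |x| ^ (n + 1) := by
    rw [h4]
    refine (abs_add_le _ _).trans ((add_le_add_left (abs_sub _ _) _).trans ?_)
    rw [hN₂]
    nlinarith
  exact h5.trans (by gcongr; linarith)

/-! ### Polynomials with prescribed averages -/

lemma exists_antiderivative (p : ℝ[X]) :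
    ∃ q : ℝ[X], derivative q = p ∧ q.natDegree ≤ p.natDegree + 1 := by
  refine ⟨∑ i ∈ Finset.range (p.natDegree + 1), monomial (i + 1) (p.coeff i / (i + 1)), ?_, ?_⟩
  · conv_rhs => rw [p.as_sum_range]
    rw [derivative_sum]
    refine Finset.sum_congr rfl fun i _ => ?_
    rw [derivative_monomial]
    congr 1
    push_cast
    field_simp
  · refine natDegree_sum_le_of_forall_le _ _ fun i hi => (natDegree_monomial_le _).trans ?_
    have := Finset.mem_range.1 hi
    omega

lemma integral_derivative (q : ℝ[X]) (a b : ℝ) :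
    ∫ x in a..b, (derivative q).eval x = q.eval b - q.eval a :=
  intervalIntegral.integral_eq_sub_of_hasDerivAt (fun x _ => q.hasDerivAt x)
    ((derivative q).continuous.intervalIntegrable _ _)

/-- The nodes `-m, -m + 1, …`. -/
def node (m : ℕ) (i : ℕ) : ℝ := (i : ℝ) - m

lemma node_injOn (m : ℕ) (s : Set ℕ) : InjOn (node m) s := fun i _ j _ h => by
  simpa [node] using h

/-- The averages of a polynomial of degree at most `n` on `n + 1` consecutive unit intervals, among
which is `[0, 1]`, control its size on `[0, 1]`. -/
lemma exists_stability_const (n : ℕ) : ∃ C : ℝ, 0 ≤ C ∧ ∀ m ≤ n, ∀ d : ℝ[X], d.natDegree ≤ n →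
    ∀ η : ℝ, (∀ i ∈ Finset.range (n + 1),
      |∫ x in (node m i)..(node m (i + 1)), d.eval x| ≤ η) →
    ∀ x ∈ Icc (0 : ℝ) 1, |d.eval x| ≤ C * η := by
  have hb : ∀ m i : ℕ, ∃ B : ℝ, 0 ≤ B ∧ ∀ x ∈ Icc (0 : ℝ) 1,
      |(derivative (Lagrange.basis (Finset.range (n + 2)) (node m) i)).eval x| ≤ B := by
    intro m i
    obtain ⟨B, hB⟩ := isCompact_Icc.exists_bound_of_continuousOn (s := Icc (0 : ℝ) 1)
      (derivative (Lagrange.basis (Finset.range (n + 2)) (node m) i)).continuous.continuousOn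
    exact ⟨B, (norm_nonneg _).trans (hB 0 (by simp)), hB⟩
  choose B hB0 hB using hb
  -- Summing over `m` makes the constant independent of the position of `[0, 1]` among the
  -- intervals, hence of the choice of an uncentered stencil.
  refine ⟨(n + 1) * ∑ m ∈ Finset.range (n + 1), ∑ i ∈ Finset.range (n + 2), B m i, ?_, ?_⟩
  · exact mul_nonneg (by positivity)
      (Finset.sum_nonneg fun m _ => Finset.sum_nonneg fun i _ => hB0 m i)
  intro m hm d hd η hη x hx
  have hη0 : 0 ≤ η := (abs_nonneg _).trans (hη 0 (by simp))
  obtain ⟨q₀, hq₀, hq₀d⟩ := exists_antiderivative d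
  -- The antiderivative that vanishes at the first node has degree at most `n + 1`, and its values
  -- at the `n + 2` nodes are partial sums of the averages. It is therefore its own Lagrange
  -- interpolant, and `d` is recovered by differentiation.
  set q : ℝ[X] := q₀ - C (q₀.eval (node m 0)) with hq
  have hqd : derivative q = d := by simp [hq, hq₀]
  have hq0 : q.eval (node m 0) = 0 := by simp [hq]
  have hqdeg : q.degree < (Finset.range (n + 2)).card := by
    rw [Finset.card_range]
    refine (degree_le_natDegree).trans_lt ?_
    have : q.natDegree ≤ n + 1 := (natDegree_sub_C (p := q₀)).le.trans (by omega)
    exact_mod_cast Nat.lt_of_le_of_lt this (by omega)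
  have hval : ∀ i ≤ n + 1, |q.eval (node m i)| ≤ i * η := by
    intro i
    induction i with
    | zero => intro _; rw [hq0]; simp
    | succ i ih =>
      intro hi
      have h1 := hη i (Finset.mem_range.2 (by omega))
      rw [← hqd, integral_derivative] at h1
      have h2 := ih (by omega)
      have h3 := abs_add_le (q.eval (node m (i + 1)) - q.eval (node m i)) (q.eval (node m i))
      rw [sub_add_cancel] at h3
      push_cast
      linarith
  have hd' : d.eval x = ∑ i ∈ Finset.range (n + 2), q.eval (node m i)
      * (derivative (Lagrange.basis (Finset.range (n + 2)) (node m) i)).eval x := by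
    conv_lhs => rw [← hqd, Lagrange.eq_interpolate (node_injOn m _) hqdeg,
      Lagrange.interpolate_apply]
    simp [eval_finsetSum]
  rw [hd']
  refine (Finset.abs_sum_le_sum_abs _ _).trans ?_
  have h4 : ∀ i ∈ Finset.range (n + 2), |q.eval (node m i)
      * (derivative (Lagrange.basis (Finset.range (n + 2)) (node m) i)).eval x|
      ≤ (n + 1) * η * B m i := by
    intro i hi
    rw [abs_mul]
    have hi' : i ≤ n + 1 := by have := Finset.mem_range.1 hi; omega
    refine mul_le_mul ((hval i hi').trans ?_) (hB m i x hx) (abs_nonneg _) (by positivity)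
    gcongr
    exact_mod_cast hi'
  refine (Finset.sum_le_sum h4).trans ?_
  rw [← Finset.mul_sum]
  have h5 : ∑ i ∈ Finset.range (n + 2), B m i
      ≤ ∑ m ∈ Finset.range (n + 1), ∑ i ∈ Finset.range (n + 2), B m i :=
    Finset.single_le_sum (f := fun m => ∑ i ∈ Finset.range (n + 2), B m i)
      (fun m _ => Finset.sum_nonneg fun i _ => hB0 m i) (Finset.mem_range.2 (by omega))
  calc (n + 1) * η * ∑ i ∈ Finset.range (n + 2), B m i
      ≤ (n + 1) * η * ∑ m ∈ Finset.range (n + 1), ∑ i ∈ Finset.range (n + 2), B m i := by gcongr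
    _ = _ := by ring

/-- Interpolate the partial sums of the averages at the `n + 2` nodes and differentiate. -/
lemma exists_polynomial_of_averages (n m : ℕ) (v : ℕ → ℝ) :
    ∃ p : ℝ[X], p.natDegree ≤ n ∧ ∀ i ∈ Finset.range (n + 1),
      ∫ x in (node m i)..(node m (i + 1)), p.eval x = v i := by
  set q := Lagrange.interpolate (Finset.range (n + 2)) (node m)
    (fun i => ∑ j ∈ Finset.range i, v j) with hq
  refine ⟨derivative q, ?_, fun i hi => ?_⟩
  · refine (natDegree_derivative_le q).trans ?_
    have := natDegree_le_of_degree_le (Lagrange.degree_interpolate_le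
      (fun i => ∑ j ∈ Finset.range i, v j) (node_injOn m (Finset.range (n + 2) : Set ℕ)))
    rw [Finset.card_range, ← hq] at this
    omega
  · have hi' := Finset.mem_range.1 hi
    rw [integral_derivative, hq,
      Lagrange.eval_interpolate_at_node _ (node_injOn m _) (Finset.mem_range.2 (by omega)),
      Lagrange.eval_interpolate_at_node _ (node_injOn m _) (Finset.mem_range.2 (by omega)),
      Finset.sum_range_succ, add_sub_cancel_left]

/-- The unit-scale form of a polynomial used on the cell of index `T` of the mesh of size `h`. -/
def rescale (h : ℝ) (T : ℤ × ℤ) (p : ℝ[X]) : ℝ[X] :=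
  C h⁻¹ * p.comp (C h * (X + C (T.1 : ℝ))) - C (T.2 : ℝ)

lemma rescale_eval (h : ℝ) (T : ℤ × ℤ) (p : ℝ[X]) (x : ℝ) :
    (rescale h T p).eval x = h⁻¹ * p.eval (h * (x + T.1)) - T.2 := by
  simp [rescale]

lemma natDegree_rescale_le (h : ℝ) (T : ℤ × ℤ) (p : ℝ[X]) :
    (rescale h T p).natDegree ≤ p.natDegree := by
  have h1 : (C h * (X + C (T.1 : ℝ))).natDegree ≤ 1 :=
    (natDegree_C_mul_le _ _).trans (natDegree_X_add_C _).le
  rw [rescale, natDegree_sub_C]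
  refine (natDegree_C_mul_le _ _).trans (natDegree_comp_le.trans ?_)
  exact (Nat.mul_le_mul_left _ h1).trans (by omega)

lemma integral_rescale {h : ℝ} (hh : 0 < h) (T : ℤ × ℤ) (p : ℝ[X]) (i : ℤ) :
    ∫ x in (i : ℝ)..(i + 1), (rescale h T p).eval x
      = h⁻¹ * ((1 / h) * ∫ x in ((T.1 + i : ℤ) * h)..(((T.1 + i : ℤ) + 1) * h), p.eval x)
        - T.2 := by
  have h1 : ∀ x : ℝ, (rescale h T p).eval x = h⁻¹ * p.eval (h * x + h * T.1) - T.2 := by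
    intro x; rw [rescale_eval, mul_add]
  simp only [h1]
  rw [intervalIntegral.integral_sub, intervalIntegral.integral_const_mul,
    intervalIntegral.integral_comp_mul_add (fun x => p.eval x) hh.ne']
  · simp only [intervalIntegral.integral_const, smul_eq_mul, one_div]
    push_cast
    rw [show h * (i : ℝ) + h * T.1 = (T.1 + i) * h by ring,
      show h * ((i : ℝ) + 1) + h * T.1 = (T.1 + i + 1) * h by ring]
    ring
  · exact Continuous.intervalIntegrable (by fun_prop) _ _
  · exact Continuous.intervalIntegrable (by fun_prop) _ _

lemma interpolant_spec (k : ℕ) {h : ℝ} (hh : 0 < h) (a : ℤ × ℤ → ℝ) (T : ℤ × ℤ) (S : Stencil)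
    (hS : S.km + S.kp = 2 * k) :
    InterpolatesAverages k h a T S (interpolant k h a T S) := by
  -- Existence is enough: any polynomial with these averages satisfies the error estimate, by
  -- stability. The solution is built at unit scale and scaled back.
  apply Classical.epsilon_spec (p := InterpolatesAverages k h a T S)
  obtain ⟨p, hp, hpv⟩ := exists_polynomial_of_averages (2 * k) S.km
    (fun i => h⁻¹ * (columnAverage h a T S (T.1 - S.km + i) + (T.2 - S.lm) * h) - T.2)
  set q : ℝ[X] := C h * (p.comp (C h⁻¹ * X - C (T.1 : ℝ)) + C (T.2 : ℝ)) with hq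
  have hqp : rescale h T q = p := by
    refine Polynomial.funext fun x => ?_
    rw [rescale_eval]
    simp [hq]
    field_simp
    simp
  refine ⟨q, ?_, fun i hi => ?_⟩
  · refine (natDegree_C_mul_le _ _).trans ?_
    rw [natDegree_add_C]
    refine natDegree_comp_le.trans ?_
    have : (C h⁻¹ * X - C (T.1 : ℝ)).natDegree ≤ 1 := by
      rw [natDegree_sub_C]
      exact (natDegree_C_mul_le _ _).trans natDegree_X.le
    exact (Nat.mul_le_mul_left _ this).trans (by omega)
  · obtain ⟨j, hj⟩ : ∃ j : ℕ, i = T.1 - S.km + j := ⟨(i - T.1 + S.km).toNat, by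
      have := hi.1; omega⟩
    have hj' : j ∈ Finset.range (2 * k + 1) := by
      have := hi.2; rw [Finset.mem_range]; omega
    have h1 := hpv j hj'
    have h2 := integral_rescale hh T q ((j : ℤ) - S.km)
    rw [hqp] at h2
    simp only [node] at h1
    push_cast at h1 h2
    rw [show (j : ℝ) + 1 - S.km = j - S.km + 1 by ring, h2] at h1
    rw [hj]
    push_cast
    rw [show (T.1 : ℝ) + (j - S.km) = T.1 - S.km + j by ring] at h1
    field_simp at h1 ⊢
    linarith

/-! ### Taylor expansion with a Hölder remainder -/

/-- Induction on `m`: the derivative of the remainder is the remainder of the derivative, and the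
mean value inequality on the segment from `0` to `x` supplies the extra factor `|x|`. -/
lemma abs_sub_taylor_le {R : ℝ} (hR : 0 < R) (m : ℕ) {α B : ℝ} (hα : 0 < α) (hB : 0 ≤ B) :
    ∀ f : ℝ → ℝ, ContDiffOn ℝ (m : WithTop ℕ∞) f (Icc (-R) R) →
      (∀ x ∈ Icc (-R) R, |iteratedDerivWithin m f (Icc (-R) R) x
        - iteratedDerivWithin m f (Icc (-R) R) 0| ≤ B * |x| ^ α) →
      ∀ x ∈ Icc (-R) R, |f x - ∑ j ∈ Finset.range (m + 1),
        iteratedDerivWithin j f (Icc (-R) R) 0 / j.factorial * x ^ j| ≤ B * |x| ^ (m + α) := by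
  have h0 : (0 : ℝ) ∈ Icc (-R) R := ⟨by linarith, hR.le⟩
  have hu : UniqueDiffOn ℝ (Icc (-R) R) := uniqueDiffOn_Icc (by linarith)
  induction m with
  | zero =>
    intro f _ h x hx
    simpa using h x hx
  | succ m ih =>
    intro f hf h x hx
    set I := Icc (-R) R with hI
    have hf1 : DifferentiableOn ℝ f I := hf.differentiableOn (by simp)
    have hf' : ContDiffOn ℝ (m : WithTop ℕ∞) (derivWithin f I) I :=
      hf.derivWithin hu (by push_cast; exact le_rfl)
    have ih' := ih (derivWithin f I) hf' (by simpa only [iteratedDerivWithin_succ'] using h)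
    simp only [← iteratedDerivWithin_succ'] at ih'
    set g : ℝ → ℝ := fun x => f x - ∑ j ∈ Finset.range (m + 1 + 1),
        iteratedDerivWithin j f I 0 / j.factorial * x ^ j with hg
    have hg0 : g 0 = 0 := by
      simp only [hg]
      rw [Finset.sum_eq_single 0]
      · simp
      · intro j _ hj; simp [hj]
      · simp
    have hseg : uIcc 0 x ⊆ I := by
      rw [hI]; exact Set.uIcc_subset_Icc h0 hx
    have hder : ∀ y ∈ uIcc 0 x, HasDerivWithinAt g (derivWithin f I y - ∑ j ∈ Finset.range (m + 1),
        iteratedDerivWithin (j + 1) f I 0 / j.factorial * y ^ j) (uIcc 0 x) y := by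
      intro y hy
      refine HasDerivWithinAt.sub ((hf1 y (hseg hy)).hasDerivWithinAt.mono hseg) ?_
      have h1 : HasDerivAt (fun x : ℝ => ∑ j ∈ Finset.range (m + 1 + 1),
          iteratedDerivWithin j f I 0 / j.factorial * x ^ j)
          (∑ j ∈ Finset.range (m + 1 + 1),
            iteratedDerivWithin j f I 0 / j.factorial * (j * y ^ (j - 1))) y :=
        HasDerivAt.fun_sum fun j _ => (hasDerivAt_pow j y).const_mul _
      rw [Finset.sum_range_succ'] at h1
      simp only [CharP.cast_eq_zero, zero_mul, mul_zero, add_zero, Nat.add_sub_cancel] at h1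
      convert h1.hasDerivWithinAt using 1
      refine Finset.sum_congr rfl fun j _ => ?_
      rw [Nat.factorial_succ]
      push_cast
      have : (j.factorial : ℝ) ≠ 0 := by positivity
      field_simp
    have hbd : ∀ y ∈ uIcc 0 x, ‖derivWithin f I y - ∑ j ∈ Finset.range (m + 1),
        iteratedDerivWithin (j + 1) f I 0 / j.factorial * y ^ j‖ ≤ B * |x| ^ (m + α) := by
      intro y hy
      refine (ih' y (hseg hy)).trans ?_
      have : |y| ≤ |x| := by
        have := abs_sub_left_of_mem_uIcc hy
        simpa using this
      gcongr
    have := (convex_uIcc 0 x).norm_image_sub_le_of_norm_hasDerivWithin_le hder hbd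
      left_mem_uIcc right_mem_uIcc
    rw [hg0, sub_zero, sub_zero, Real.norm_eq_abs, Real.norm_eq_abs] at this
    refine this.trans (le_of_eq ?_)
    push_cast
    rw [show (m : ℝ) + 1 + α = m + α + 1 by ring, Real.rpow_add_one' (abs_nonneg _) (by positivity)]
    ring

/-- Both `A` and `B` are nonnegative, so each is at most `A + B ≤ M`. For `B` this uses the pair
`R`, `0` of distinct points. -/
lemma HolderNormLE.exists_bounds {s R M : ℝ} (hR : 0 < R) {ψ : ℝ → ℝ} (h : HolderNormLE s R M ψ) :
    (∀ j ≤ ⌈s⌉₊ - 1, ∀ x ∈ Icc (-R) R, |iteratedDerivWithin j ψ (Icc (-R) R) x| ≤ M) ∧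
    (∀ x ∈ Icc (-R) R, ∀ y ∈ Icc (-R) R,
      |iteratedDerivWithin (⌈s⌉₊ - 1) ψ (Icc (-R) R) x
        - iteratedDerivWithin (⌈s⌉₊ - 1) ψ (Icc (-R) R) y|
        ≤ M * |x - y| ^ (s - ((⌈s⌉₊ - 1 : ℕ) : ℝ))) := by
  obtain ⟨-, A, B, hAB, hA, hB⟩ := h
  have h0 : (0 : ℝ) ∈ Icc (-R) R := ⟨by linarith, hR.le⟩
  have hR' : R ∈ Icc (-R) R := ⟨by linarith, le_rfl⟩
  have hA0 : 0 ≤ A := (abs_nonneg _).trans (hA 0 (by omega) 0 h0)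
  have hB0 : 0 ≤ B := by
    have := (abs_nonneg _).trans (hB R hR' 0 h0)
    have h1 : 0 < |R - 0| ^ (s - ((⌈s⌉₊ - 1 : ℕ) : ℝ)) := by
      apply Real.rpow_pos_of_pos; rw [sub_zero, abs_of_pos hR]; exact hR
    exact nonneg_of_mul_nonneg_left this h1
  refine ⟨fun j hj x hx => (hA j hj x hx).trans (by linarith), fun x hx y hy =>
    (hB x hx y hy).trans ?_⟩
  gcongr
  linarith

lemma HolderNormLE.abs_iteratedDeriv_sub_le {s R M : ℝ} {ψ : ℝ → ℝ}
    (h : HolderNormLE s R M ψ) (hR : 0 < R) {n : ℕ} (hn : n < ⌈s⌉₊ - 1) :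
    ∀ x ∈ Icc (-R) R, ∀ y ∈ Icc (-R) R, |iteratedDerivWithin n ψ (Icc (-R) R) x
        - iteratedDerivWithin n ψ (Icc (-R) R) y| ≤ M * |x - y| := by
  intro x hx y hy
  have hu : UniqueDiffOn ℝ (Icc (-R) R) := uniqueDiffOn_Icc (by linarith)
  have hd : DifferentiableOn ℝ (iteratedDerivWithin n ψ (Icc (-R) R)) (Icc (-R) R) :=
    h.1.differentiableOn_iteratedDerivWithin (by exact_mod_cast hn) hu
  refine (convex_Icc (-R) R).norm_image_sub_le_of_norm_derivWithin_le hd (fun z hz => ?_) hy hx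
  rw [← iteratedDerivWithin_succ]
  exact (h.exists_bounds hR).1 (n + 1) (by omega) z hz

lemma HolderNormLE.abs_sub_le {s R M : ℝ} {ψ : ℝ → ℝ} (h : HolderNormLE s R M ψ) (hR : 0 < R)
    (hs : 1 ≤ s) : ∀ x ∈ Icc (-R) R, ∀ y ∈ Icc (-R) R, |ψ x - ψ y| ≤ M * |x - y| := by
  intro x hx y hy
  rcases hs.eq_or_lt with rfl | hs
  · simpa using (h.exists_bounds hR).2 x hx y hy
  · have : 1 < ⌈s⌉₊ := Nat.lt_ceil.2 (by exact_mod_cast hs)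
    simpa using h.abs_iteratedDeriv_sub_le hR (n := 0) (by omega) x hx y hy

/-- If `s ≤ n + 1`, the Taylor polynomial of degree `⌈s⌉ - 1 ≤ n`, padded with zero coefficients,
has a Hölder remainder of order `s`. If `s > n + 1`, the derivative of order `n` is Lipschitz and
the remainder has order `n + 1`. This is the source of the saturation `r = min s (2k + 1)`. -/
lemma HolderNormLE.exists_taylor {s R M : ℝ} {ψ : ℝ → ℝ} (h : HolderNormLE s R M ψ) (hR : 0 < R)
    (hs : 1 ≤ s) (n : ℕ) : ∃ c : ℕ → ℝ, (∀ j, |c j| ≤ M) ∧ c 0 = ψ 0 ∧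
      ∀ t ∈ Icc (-R) R, |ψ t - ∑ j ∈ Finset.range (n + 1), c j * t ^ j|
        ≤ M * |t| ^ (min s (n + 1)) := by
  have h0 : (0 : ℝ) ∈ Icc (-R) R := ⟨by linarith, hR.le⟩
  obtain ⟨hA, hB⟩ := h.exists_bounds hR
  have hM : 0 ≤ M := (abs_nonneg _).trans (hA 0 (by omega) 0 h0)
  have hc1 : 1 ≤ ⌈s⌉₊ := Nat.one_le_ceil_iff.2 (by linarith)
  have hcoef : ∀ j ≤ ⌈s⌉₊ - 1, |iteratedDerivWithin j ψ (Icc (-R) R) 0 / j.factorial| ≤ M := by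
    intro j hj
    rw [abs_div]
    refine (div_le_self (abs_nonneg _) ?_).trans (hA j hj 0 h0)
    rw [Nat.abs_cast]
    exact_mod_cast Nat.factorial_pos j
  rcases le_or_gt s (n + 1) with hsn | hsn
  · have hmn : ⌈s⌉₊ ≤ n + 1 := Nat.ceil_le.2 (by exact_mod_cast hsn)
    have hms : ((⌈s⌉₊ - 1 : ℕ) : ℝ) < s := by
      have := Nat.ceil_lt_add_one (show 0 ≤ s by linarith)
      push_cast [hc1]; linarith
    refine ⟨fun j => if j ≤ ⌈s⌉₊ - 1 then
      iteratedDerivWithin j ψ (Icc (-R) R) 0 / j.factorial else 0, fun j => ?_, by simp, ?_⟩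
    · dsimp only
      split_ifs with hj
      · exact hcoef j hj
      · simpa using hM
    · intro t ht
      have h1 := abs_sub_taylor_le hR (⌈s⌉₊ - 1) (sub_pos.2 hms) hM ψ h.1
        (fun x hx => by simpa using hB x hx 0 h0) t ht
      rw [min_eq_left hsn]
      rw [add_sub_cancel] at h1
      convert h1 using 3
      symm
      refine Finset.sum_subset_zero_on_sdiff (Finset.range_mono (by omega)) ?_ ?_
      · intro j hj
        simp only [Finset.mem_sdiff, Finset.mem_range] at hj
        dsimp only
        rw [if_neg (by omega), zero_mul]
      · intro j hj
        simp only [Finset.mem_range] at hj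
        dsimp only
        rw [if_pos (by omega)]
  · have hmn : n < ⌈s⌉₊ - 1 := by
      have : n + 1 < ⌈s⌉₊ := Nat.lt_ceil.2 (by exact_mod_cast hsn)
      omega
    refine ⟨fun j => if j ≤ n then
      iteratedDerivWithin j ψ (Icc (-R) R) 0 / j.factorial else 0, fun j => ?_, by simp, ?_⟩
    · dsimp only
      split_ifs with hj
      · exact hcoef j (by omega)
      · simpa using hM
    · intro t ht
      have h1 := abs_sub_taylor_le hR n one_pos hM ψ
        (h.1.of_le (by exact_mod_cast hmn.le))
        (fun x hx => by simpa using h.abs_iteratedDeriv_sub_le hR hmn x hx 0 h0) t ht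
      rw [min_eq_right hsn.le]
      convert h1 using 3
      refine Finset.sum_congr rfl fun j hj => ?_
      dsimp only
      rw [if_pos (by have := Finset.mem_range.1 hj; omega)]

/-! ### Charts at boundary points -/

/-- The Euclidean inner product of the plane. -/
def dot (v e : ℝ × ℝ) : ℝ := v.1 * e.1 + v.2 * e.2

/-- With determinant `Δ = ±1`, the second vector is `Δ` times the first one rotated by a right
angle. -/
lemma IsOrthonormalPair.cols {e₁ e₂ : ℝ × ℝ} (h : IsOrthonormalPair e₁ e₂) :
    e₁.1 ^ 2 + e₂.1 ^ 2 = 1 ∧ e₁.2 ^ 2 + e₂.2 ^ 2 = 1 ∧ e₁.1 * e₁.2 + e₂.1 * e₂.2 = 0 := by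
  obtain ⟨h1, h2, h3⟩ := h
  set a := e₁.1
  set b := e₁.2
  set c := e₂.1
  set d := e₂.2
  have hΔ : (a * d - b * c) ^ 2 = 1 := by
    linear_combination (c ^ 2 + d ^ 2) * h1 + h2 - (a * c + b * d) * h3
  have hc : c = -b * (a * d - b * c) := by linear_combination (-c) * h1 + a * h3
  have hd : d = a * (a * d - b * c) := by linear_combination (-d) * h1 + b * h3
  set Δ := a * d - b * c
  refine ⟨?_, ?_, ?_⟩
  · rw [hc]; linear_combination h1 + b ^ 2 * hΔ
  · rw [hd]; linear_combination h1 + a ^ 2 * hΔ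
  · rw [hc, hd]; linear_combination (-a * b) * hΔ

lemma IsOrthonormalPair.abs_coord_le {e₁ e₂ : ℝ × ℝ} (h : IsOrthonormalPair e₁ e₂) :
    |e₁.1| ≤ 1 ∧ |e₁.2| ≤ 1 ∧ |e₂.1| ≤ 1 ∧ |e₂.2| ≤ 1 := by
  obtain ⟨h1, h2, -⟩ := h
  simp only [← sq_le_one_iff_abs_le_one]
  refine ⟨?_, ?_, ?_, ?_⟩ <;>
    linarith [sq_nonneg e₁.1, sq_nonneg e₁.2, sq_nonneg e₂.1, sq_nonneg e₂.2]

lemma IsOrthonormalPair.expand {e₁ e₂ : ℝ × ℝ} (h : IsOrthonormalPair e₁ e₂) (v : ℝ × ℝ) :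
    dot v e₁ • e₁ + dot v e₂ • e₂ = v := by
  obtain ⟨h1, h2, h3⟩ := h.cols
  ext
  · simp only [dot, Prod.fst_add, Prod.smul_fst, smul_eq_mul]
    linear_combination v.1 * h1 + v.2 * h3
  · simp only [dot, Prod.snd_add, Prod.smul_snd, smul_eq_mul]
    linear_combination v.2 * h2 + v.1 * h3

lemma abs_dot_le {v e : ℝ × ℝ} {τ : ℝ} (h1 : |v.1| ≤ τ) (h2 : |v.2| ≤ τ) (he1 : |e.1| ≤ 1)
    (he2 : |e.2| ≤ 1) : |dot v e| ≤ 2 * τ := by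
  have hτ : 0 ≤ τ := (abs_nonneg _).trans h1
  have := abs_add_le (v.1 * e.1) (v.2 * e.2)
  rw [abs_mul, abs_mul] at this
  have h3 := mul_le_mul h1 he1 (abs_nonneg _) hτ
  have h4 := mul_le_mul h2 he2 (abs_nonneg _) hτ
  rw [dot]
  linarith

/-- In the orthonormal frame `(e₁, e₂)` centered at `z₀`, the set `Ω` is the subgraph of `ψ`. -/
structure IsChart (s R P M : ℝ) (Ω : Set (ℝ × ℝ)) (z₀ e₁ e₂ : ℝ × ℝ) (ψ : ℝ → ℝ) : Prop where
  orthonormal : IsOrthonormalPair e₁ e₂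
  holder : HolderNormLE s R M ψ
  mem_iff : ∀ z₁ z₂ : ℝ, |z₁| ≤ R → |z₂| ≤ P * R → (z₀ + z₁ • e₁ + z₂ • e₂ ∈ Ω ↔ z₂ ≤ ψ z₁)

lemma IsChart.mem_iff' {s R P M : ℝ} {Ω : Set (ℝ × ℝ)} {z₀ e₁ e₂ : ℝ × ℝ} {ψ : ℝ → ℝ}
    (h : IsChart s R P M Ω z₀ e₁ e₂ ψ) {z : ℝ × ℝ} (h1 : |dot (z - z₀) e₁| ≤ R)
    (h2 : |dot (z - z₀) e₂| ≤ P * R) : z ∈ Ω ↔ dot (z - z₀) e₂ ≤ ψ (dot (z - z₀) e₁) := by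
  rw [← h.mem_iff _ _ h1 h2, add_assoc, h.orthonormal.expand, add_sub_cancel]

/-- A strict inequality on either side persists nearby, which makes the point interior to `Ω` or to
its complement. -/
lemma IsChart.eq_of_mem_frontier {s R P M : ℝ} {Ω : Set (ℝ × ℝ)} {z₀ e₁ e₂ : ℝ × ℝ} {ψ : ℝ → ℝ}
    (h : IsChart s R P M Ω z₀ e₁ e₂ ψ) {z : ℝ × ℝ} (hz : z ∈ frontier Ω)
    (h1 : |dot (z - z₀) e₁| < R) (h2 : |dot (z - z₀) e₂| < P * R) :
    dot (z - z₀) e₂ = ψ (dot (z - z₀) e₁) := by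
  have hc : ∀ e : ℝ × ℝ, Continuous fun z => dot (z - z₀) e := fun e => by
    unfold dot; fun_prop
  have hψ : ContinuousAt ψ (dot (z - z₀) e₁) :=
    h.holder.1.continuousOn.continuousAt (Icc_mem_nhds (abs_lt.1 h1).1 (abs_lt.1 h1).2)
  have hψ' : ContinuousAt (fun z => ψ (dot (z - z₀) e₁)) z :=
    ContinuousAt.comp (f := fun z => dot (z - z₀) e₁) hψ (hc e₁).continuousAt
  have ev1 : ∀ᶠ w in nhds z, |dot (w - z₀) e₁| < R :=
    ((hc e₁).abs.continuousAt).eventually_lt continuousAt_const h1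
  have ev2 : ∀ᶠ w in nhds z, |dot (w - z₀) e₂| < P * R :=
    ((hc e₂).abs.continuousAt).eventually_lt continuousAt_const h2
  rcases lt_trichotomy (dot (z - z₀) e₂) (ψ (dot (z - z₀) e₁)) with hlt | heq | hgt
  · exfalso
    refine hz.2 (mem_interior_iff_mem_nhds.2 ?_)
    filter_upwards [ev1, ev2, (hc e₂).continuousAt.eventually_lt hψ' hlt] with w hw1 hw2 hw3
    exact (h.mem_iff' hw1.le hw2.le).2 hw3.le
  · exact heq
  · exfalso
    have : Ωᶜ ∈ nhds z := by
      filter_upwards [ev1, ev2, hψ'.eventually_lt (hc e₂).continuousAt hgt] with w hw1 hw2 hw3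
      exact fun hw => hw3.not_ge ((h.mem_iff' hw1.le hw2.le).1 hw)
    rw [frontier_eq_closure_inter_closure] at hz
    obtain ⟨w, hw1, hw2⟩ := mem_closure_iff_nhds.1 hz.1 _ this
    exact hw1 hw2

lemma IsCsDomain.exists_chart {s : ℝ} {Ω : Set (ℝ × ℝ)} (h : IsCsDomain s Ω) :
    ∃ R P M : ℝ, 0 < R ∧ 1 < P ∧ 0 < M ∧ ∀ z₀ ∈ frontier Ω, ∃ e₁ e₂ ψ,
      IsChart s R P M Ω z₀ e₁ e₂ ψ := by
  obtain ⟨R, P, M, hR, hP, hM, h⟩ := h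
  refine ⟨R, P, M, hR, hP, hM, fun z₀ hz₀ => ?_⟩
  obtain ⟨e₁, e₂, ψ, h1, h2, -, h3⟩ := h z₀ hz₀
  exact ⟨e₁, e₂, ψ, h1, h2, h3⟩

lemma IsChart.apply_zero {s R P M : ℝ} {Ω : Set (ℝ × ℝ)} {z₀ e₁ e₂ : ℝ × ℝ} {ψ : ℝ → ℝ}
    (h : IsChart s R P M Ω z₀ e₁ e₂ ψ) (hz : z₀ ∈ frontier Ω) (hR : 0 < R) (hP : 1 < P) :
    ψ 0 = 0 := by
  have hd : ∀ e, dot (z₀ - z₀) e = 0 := fun e => by simp [dot]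
  have := h.eq_of_mem_frontier hz (by rw [hd, abs_zero]; exact hR)
    (by rw [hd, abs_zero]; positivity)
  rw [hd, hd] at this
  exact this.symm

/-- The inequality `z₂ ≤ ψ z₁` is not strict and `ψ 0 = 0`, so each boundary point belongs to `Ω`.
Measurability of `Ω` comes from here. -/
lemma IsCsDomain.isClosed {s : ℝ} {Ω : Set (ℝ × ℝ)} (h : IsCsDomain s Ω) : IsClosed Ω := by
  obtain ⟨R, P, M, hR, hP, hM, h⟩ := h.exists_chart
  rw [← frontier_subset_iff_isClosed]
  intro z hz
  obtain ⟨e₁, e₂, ψ, hc⟩ := h z hz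
  have h0 := hc.apply_zero hz hR hP
  have := (hc.mem_iff 0 0 (by simpa using hR.le) (by rw [abs_zero]; positivity)).2 h0.ge
  simpa using this

/-- Near `z₀`, the boundary of `Ω` is the graph of `∑ c_j t^j` in the frame `(e₁, e₂)`, up to an
error of order `r`. -/
def PolyApprox (n : ℕ) (A r ρ : ℝ) (Ω : Set (ℝ × ℝ)) (z₀ e₁ e₂ : ℝ × ℝ) (c : ℕ → ℝ) : Prop :=
  ∀ τ ≤ ρ, ∀ v : ℝ × ℝ, |v.1| ≤ τ → |v.2| ≤ τ →
    (z₀ + v ∈ Ω → dot v e₂ ≤ ∑ j ∈ Finset.range (n + 1), c j * dot v e₁ ^ j + A * τ ^ r) ∧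
    (z₀ + v ∉ Ω → ∑ j ∈ Finset.range (n + 1), c j * dot v e₁ ^ j - A * τ ^ r ≤ dot v e₂)

lemma IsCsDomain.exists_polyApprox {s : ℝ} {Ω : Set (ℝ × ℝ)} (h : IsCsDomain s Ω) (hs : 1 ≤ s)
    (n : ℕ) : ∃ M A ρ : ℝ, 0 < M ∧ 0 ≤ A ∧ 0 < ρ ∧ ∀ z₀ ∈ frontier Ω, ∃ e₁ e₂ c,
      IsOrthonormalPair e₁ e₂ ∧ (∀ j, |c j| ≤ M) ∧ c 0 = 0 ∧
      PolyApprox n A (min s (n + 1)) ρ Ω z₀ e₁ e₂ c := by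
  obtain ⟨R, P, M, hR, hP, hM, h⟩ := h.exists_chart
  -- A vector with both components at most `τ` has frame coordinates at most `2τ`; hence the radius
  -- `R / 2` and the power of `2`.
  refine ⟨M, M * 2 ^ min s (n + 1 : ℝ), R / 2, hM, by positivity, by positivity, fun z₀ hz₀ => ?_⟩
  obtain ⟨e₁, e₂, ψ, hc⟩ := h z₀ hz₀
  obtain ⟨c, hcM, hc0, hT⟩ := hc.holder.exists_taylor hR hs n
  refine ⟨e₁, e₂, c, hc.orthonormal, hcM, hc0.trans (hc.apply_zero hz₀ hR hP), ?_⟩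
  intro τ hτ v hv1 hv2
  obtain ⟨ha, hb, hc', hd⟩ := hc.orthonormal.abs_coord_le
  have h1 := abs_dot_le hv1 hv2 ha hb
  have h2 := abs_dot_le hv1 hv2 hc' hd
  have hτ0 : 0 ≤ τ := (abs_nonneg _).trans hv1
  have h1R : |dot v e₁| ≤ R := h1.trans (by linarith)
  have h3 := hT _ (abs_le.1 h1R)
  have h4 : M * |dot v e₁| ^ min s (n + 1 : ℝ)
      ≤ M * 2 ^ min s (n + 1 : ℝ) * τ ^ min s (n + 1 : ℝ) := by
    rw [mul_assoc, ← Real.mul_rpow zero_le_two hτ0]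
    have : 0 ≤ min s (n + 1 : ℝ) := le_min (by linarith) (by positivity)
    gcongr
  have h5 := hc.mem_iff' (z := z₀ + v) (by simpa using h1R)
    (by simp only [add_sub_cancel_left]; exact h2.trans (by nlinarith))
  rw [add_sub_cancel_left] at h5
  have h6 := abs_le.1 (h3.trans h4)
  refine ⟨fun hz => ?_, fun hz => ?_⟩
  · have := h5.1 hz; linarith
  · rw [h5, not_le] at hz; linarith

/-! ### The boundary at the scale of the mesh -/

/-- `Ω`, in the coordinates where the cell `T` of the mesh of size `h` is the unit square. -/
def zoom (h : ℝ) (T : ℤ × ℤ) (Ω : Set (ℝ × ℝ)) : Set (ℝ × ℝ) :=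
  {w | (h * (w.1 + T.1), h * (w.2 + T.2)) ∈ Ω}

/-- In the square `[-K, K]²`, the set `Ω` is a half plane of normal `n` through `w₀`, up to `ε`. -/
def NearHalfPlane (K ε : ℝ) (Ω : Set (ℝ × ℝ)) (w₀ n : ℝ × ℝ) : Prop :=
  ∀ w : ℝ × ℝ, |w.1| ≤ K → |w.2| ≤ K →
    (w ∈ Ω → dot (w - w₀) n ≤ ε) ∧ (w ∉ Ω → -ε ≤ dot (w - w₀) n)

/-- In the square `[-K, K]²`, the set `Ω` is the subgraph of `p`, up to `η`. -/
def NearGraph (K η : ℝ) (Ω : Set (ℝ × ℝ)) (p : ℝ[X]) : Prop :=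
  ∀ w : ℝ × ℝ, |w.1| ≤ K → |w.2| ≤ K →
    (w ∈ Ω → w.2 ≤ p.eval w.1 + η) ∧ (w ∉ Ω → p.eval w.1 - η ≤ w.2)

/-- Expansion of order `n` of the boundary of `Ω` at `z₀`, with uniform bounds. -/
structure BoundaryExpansion (n : ℕ) (M A r ρ : ℝ) (Ω : Set (ℝ × ℝ)) (z₀ e₁ e₂ : ℝ × ℝ)
    (c : ℕ → ℝ) : Prop where
  orthonormal : IsOrthonormalPair e₁ e₂
  abs_coeff_le : ∀ j, |c j| ≤ M
  coeff_zero : c 0 = 0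
  approx : PolyApprox n A r ρ Ω z₀ e₁ e₂ c

/-- The approximate normal given by an expansion. -/
def normal (e₁ e₂ : ℝ × ℝ) (c : ℕ → ℝ) : ℝ × ℝ := e₂ - c 1 • e₁

lemma one_le_normal {e₁ e₂ : ℝ × ℝ} (h : IsOrthonormalPair e₁ e₂) (c : ℕ → ℝ) :
    1 ≤ (normal e₁ e₂ c).1 ^ 2 + (normal e₁ e₂ c).2 ^ 2 := by
  obtain ⟨h1, h2, h3⟩ := h
  simp only [normal, Prod.fst_sub, Prod.snd_sub, Prod.smul_fst, Prod.smul_snd, smul_eq_mul]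
  have : (e₂.1 - c 1 * e₁.1) ^ 2 + (e₂.2 - c 1 * e₁.2) ^ 2 = 1 + c 1 ^ 2 := by
    linear_combination h2 + c 1 ^ 2 * h1 - 2 * c 1 * h3
  rw [this]
  nlinarith [sq_nonneg (c 1)]

lemma dot_normal (v e₁ e₂ : ℝ × ℝ) (c : ℕ → ℝ) :
    dot v (normal e₁ e₂ c) = dot v e₂ - c 1 * dot v e₁ := by
  simp only [normal, dot, Prod.fst_sub, Prod.snd_sub, Prod.smul_fst, Prod.smul_snd, smul_eq_mul]
  ring

lemma sum_eq_highSum {n : ℕ} (hn : 1 ≤ n) {c : ℕ → ℝ} (hc : c 0 = 0) (t : ℝ) :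
    ∑ j ∈ Finset.range (n + 1), c j * t ^ j = c 1 * t + highSum n c t := by
  rw [highSum, Finset.range_eq_Ico, ← Finset.sum_Ico_consecutive _ (Nat.zero_le 2) (by omega)]
  simp [Finset.sum_range_succ, hc]

/-- The expansion, in the coordinates where the cell `T` is the unit square. -/
lemma BoundaryExpansion.zoom {n : ℕ} (hn : 1 ≤ n) {M A r ρ : ℝ} {Ω : Set (ℝ × ℝ)}
    {z₀ e₁ e₂ : ℝ × ℝ} {c : ℕ → ℝ} (H : BoundaryExpansion n M A r ρ Ω z₀ e₁ e₂ c) {h K : ℝ}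
    (hh : 0 < h) (hρ : h * (K + 1) ≤ ρ) {T : ℤ × ℤ}
    {w₀ : ℝ × ℝ} (hw₀ : w₀ ∈ cell 1 0) (hz₀ : z₀ = (h * (w₀.1 + T.1), h * (w₀.2 + T.2)))
    {w : ℝ × ℝ} (hw1 : |w.1| ≤ K) (hw2 : |w.2| ≤ K) :
    |(h • (w - w₀)).1| ≤ h * (K + 1) ∧ |(h • (w - w₀)).2| ≤ h * (K + 1) ∧
    (w ∈ Aeros.zoom h T Ω → dot (h • (w - w₀)) (normal e₁ e₂ c)
      - highSum n c (dot (h • (w - w₀)) e₁) ≤ A * (h * (K + 1)) ^ r) ∧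
    (w ∉ Aeros.zoom h T Ω → - (A * (h * (K + 1)) ^ r) ≤ dot (h • (w - w₀)) (normal e₁ e₂ c)
      - highSum n c (dot (h • (w - w₀)) e₁)) := by
  simp only [cell, Prod.fst_zero, Prod.snd_zero, Int.cast_zero, zero_add, mul_one,
    mem_prod, mem_Icc] at hw₀
  obtain ⟨⟨h1, h2⟩, h3, h4⟩ := hw₀
  have hw1' := abs_le.1 hw1
  have hw2' := abs_le.1 hw2
  have hb : ∀ x y : ℝ, |x| ≤ K → 0 ≤ y → y ≤ 1 → |h * (x - y)| ≤ h * (K + 1) := by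
    intro x y hx hy hy'
    rw [abs_mul, abs_of_pos hh]
    refine mul_le_mul_of_nonneg_left ?_ hh.le
    have := abs_le.1 hx
    rw [abs_le]; constructor <;> linarith
  have hv1 : |(h • (w - w₀)).1| ≤ h * (K + 1) := hb _ _ hw1 h1 h2
  have hv2 : |(h • (w - w₀)).2| ≤ h * (K + 1) := hb _ _ hw2 h3 h4
  have hmem : w ∈ Aeros.zoom h T Ω ↔ z₀ + h • (w - w₀) ∈ Ω := by
    rw [Aeros.zoom, mem_ofPred_eq, hz₀]
    have : ((h * (w₀.1 + T.1), h * (w₀.2 + T.2)) : ℝ × ℝ) + h • (w - w₀)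
        = (h * (w.1 + T.1), h * (w.2 + T.2)) := by
      ext <;> simp <;> ring
    rw [this]
  have := H.approx _ hρ _ hv1 hv2
  rw [sum_eq_highSum hn H.coeff_zero] at this
  rw [dot_normal, hmem]
  refine ⟨hv1, hv2, fun hm => ?_, fun hm => ?_⟩
  · have := this.1 hm; linarith
  · have := this.2 hm; linarith

lemma dot_smul (a : ℝ) (v e : ℝ × ℝ) : dot (a • v) e = a * dot v e := by
  simp only [dot, Prod.smul_fst, Prod.smul_snd, smul_eq_mul]; ring

lemma exists_mul_rpow_le {B β ε : ℝ} (hβ : 0 < β) (hε : 0 < ε) :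
    ∃ h₀ : ℝ, 0 < h₀ ∧ ∀ h : ℝ, 0 < h → h ≤ h₀ → B * h ^ β ≤ ε := by
  have h1 : ContinuousAt (fun h : ℝ => B * h ^ β) 0 :=
    (Real.continuousAt_rpow_const 0 β (Or.inr hβ.le)).const_mul B
  have h2 : ∀ᶠ h in nhds (0 : ℝ), B * h ^ β < ε :=
    h1.eventually_lt continuousAt_const (by simpa [Real.zero_rpow hβ.ne'] using hε)
  obtain ⟨δ, hδ, h3⟩ := Metric.eventually_nhds_iff.1 h2
  refine ⟨δ / 2, by positivity, fun h hh hle => (h3 ?_).le⟩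
  rw [Real.dist_eq, sub_zero, abs_of_pos hh]
  linarith

/-- The deviation from the tangent line is `O(τ²)` from the higher Taylor terms and `O(τ^r)` from
the remainder, with `τ = h (K + 1)`. Zooming divides by `h` and leaves `O(h^(min r 2 - 1))`, which
tends to `0` because `r > 1`. -/
lemma exists_nearHalfPlane {n : ℕ} (hn : 1 ≤ n) {M A r ρ K ε : ℝ} (hM : 0 ≤ M) (hA : 0 ≤ A)
    (hr : 1 < r) (hρ : 0 < ρ) (hK : 0 ≤ K) (hε : 0 < ε) :
    ∃ h₀ : ℝ, 0 < h₀ ∧ ∀ (Ω : Set (ℝ × ℝ)) (z₀ e₁ e₂ : ℝ × ℝ) (c : ℕ → ℝ),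
      BoundaryExpansion n M A r ρ Ω z₀ e₁ e₂ c → ∀ h : ℝ, 0 < h → h ≤ h₀ →
      ∀ (T : ℤ × ℤ), ∀ w₀ ∈ cell 1 0, z₀ = (h * (w₀.1 + T.1), h * (w₀.2 + T.2)) →
        NearHalfPlane K ε (zoom h T Ω) w₀ (normal e₁ e₂ c) := by
  set L : ℝ := (n + 1) ^ 2 * M * 2 ^ n * 2 * 2 with hL
  set q : ℝ := min r 2 with hq
  have hq1 : 1 < q := lt_min hr one_lt_two
  obtain ⟨h₁, hh₁, hB⟩ := exists_mul_rpow_le (B := (L + A) * (K + 1) ^ q) (sub_pos.2 hq1) hε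
  refine ⟨min h₁ (min 1 ρ / (K + 1)), by positivity, ?_⟩
  intro Ω z₀ e₁ e₂ c H h hh hle T w₀ hw₀ hz₀ w hw1 hw2
  have hle1 := hle.trans (min_le_left _ _)
  have hle2 : h * (K + 1) ≤ min 1 ρ := by
    have := hle.trans (min_le_right _ _)
    rwa [le_div_iff₀ (by positivity)] at this
  have hτρ := hle2.trans (min_le_right _ _)
  have hτ1 := hle2.trans (min_le_left _ _)
  obtain ⟨hv1, hv2, hin, hout⟩ := H.zoom hn hh hτρ hw₀ hz₀ hw1 hw2
  set τ := h * (K + 1) with hτ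
  have hτ0 : 0 < τ := by positivity
  set v := h • (w - w₀)
  obtain ⟨ha, hb, -, -⟩ := H.orthonormal.abs_coord_le
  have hd := abs_dot_le hv1 hv2 ha hb
  have hs := abs_highSum_sub_le n (B := 2) one_le_two c H.abs_coeff_le (a := dot v e₁) (b := 0)
    (m := 2 * τ) hd (by simpa using hτ0.le) (by linarith)
  have h0 : highSum n c 0 = 0 := Finset.sum_eq_zero fun j hj => by
    have := (Finset.mem_Ico.1 hj).1
    rw [zero_pow (by omega), mul_zero]
  rw [h0, sub_zero, sub_zero] at hs
  have hs' : |highSum n c (dot v e₁)| ≤ L * τ ^ 2 := by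
    refine hs.trans ?_
    calc (n + 1) ^ 2 * M * 2 ^ n * (2 * τ) * |dot v e₁|
        ≤ (n + 1) ^ 2 * M * 2 ^ n * (2 * τ) * (2 * τ) := by gcongr
      _ = _ := by rw [hL]; ring
  have h2q : τ ^ 2 ≤ τ ^ q := by
    rw [← Real.rpow_two]
    exact Real.rpow_le_rpow_of_exponent_ge hτ0 hτ1 (min_le_right _ _)
  have hrq : τ ^ r ≤ τ ^ q := Real.rpow_le_rpow_of_exponent_ge hτ0 hτ1 (min_le_left _ _)
  have hL0 : 0 ≤ L := by positivity
  have hfin : L * τ ^ 2 + A * τ ^ r ≤ h * ε := by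
    calc L * τ ^ 2 + A * τ ^ r ≤ L * τ ^ q + A * τ ^ q := by gcongr
      _ = h * ((L + A) * (K + 1) ^ q * h ^ (q - 1)) := by
        rw [hτ, Real.mul_rpow hh.le (by positivity), Real.rpow_sub_one hh.ne']
        field_simp
      _ ≤ h * ε := mul_le_mul_of_nonneg_left (hB h hh hle1) hh.le
  have hs2 := abs_le.1 hs'
  have hvn : dot v (normal e₁ e₂ c) = h * dot (w - w₀) (normal e₁ e₂ c) := dot_smul _ _ _
  rw [hvn] at hin hout
  refine ⟨fun hm => ?_, fun hm => ?_⟩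
  · have := hin hm
    exact le_of_mul_le_mul_left (by linarith) hh
  · have := hout hm
    refine le_of_mul_le_mul_left (a := h) (by linarith) hh

/-- Two values of `y` with small defects are close to each other. -/
lemma ImplicitData.sub_le_of_defect {M κ : ℝ} (D : ImplicitData M κ) (hκ : 0 < κ) (n : ℕ)
    {x y y' τ N E E' : ℝ} (hN : 0 ≤ N) (hτ1 : τ ≤ 1)
    (hτ : (n + 1) ^ 2 * M * (1 + N) ^ n * ((1 + N) * τ) ≤ κ / 2) (hx : |x| ≤ τ)
    (hy : |y| ≤ N * τ) (hy' : |y'| ≤ N * τ) (hE : D.defect n x y ≤ E)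
    (hE' : -E' ≤ D.defect n x y') (h0 : 0 ≤ E + E') : y - y' ≤ 2 / κ * (E + E') := by
  rcases le_or_gt y y' with hle | hgt
  · have : 0 ≤ 2 / κ * (E + E') := by positivity
    linarith
  have hlip := (D.abs_highSum_sub_le n hN hτ1 hx hy hy').trans
    (mul_le_mul_of_nonneg_right hτ (abs_nonneg _))
  rw [abs_of_pos (sub_pos.2 hgt)] at hlip
  have hdiff : D.defect n x y - D.defect n x y' = D.β * (y - y')
      - (highSum n D.c (D.a * x + D.b * y) - highSum n D.c (D.a * x + D.b * y')) := by
    simp only [ImplicitData.defect]; ring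
  have h1 := (abs_le.1 hlip).2
  have h2 := mul_le_mul_of_nonneg_right D.le_β (sub_pos.2 hgt).le
  rw [div_mul_eq_mul_div, le_div_iff₀ hκ]
  linarith

/-- At a point of the box the sign of the defect, up to `A τ^r`, decides membership in `Ω`, and the
polynomial solution has defect at most `N τ^r`. For small `τ` the defect increases in `y` at rate at
least `κ / 2`, so small defects mean nearby heights. Dividing by `h` turns `τ^r` into `h^(r-1)`. -/
lemma exists_nearGraph {n : ℕ} (hn : 1 ≤ n) {M A r ρ K κ : ℝ} (hM : 0 ≤ M) (hA : 0 ≤ A)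
    (hrn : r ≤ n + 1) (hρ : 0 < ρ) (hK : 0 ≤ K) (hκ : 0 < κ) :
    ∃ h₀ B : ℝ, 0 < h₀ ∧ 0 ≤ B ∧ ∀ (Ω : Set (ℝ × ℝ)) (z₀ e₁ e₂ : ℝ × ℝ) (c : ℕ → ℝ),
      BoundaryExpansion n M A r ρ Ω z₀ e₁ e₂ c → κ ≤ (normal e₁ e₂ c).2 →
      ∀ h : ℝ, 0 < h → h ≤ h₀ →
      ∀ (T : ℤ × ℤ), ∀ w₀ ∈ cell 1 0, z₀ = (h * (w₀.1 + T.1), h * (w₀.2 + T.2)) →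
        ∃ p : ℝ[X], p.natDegree ≤ n ∧ NearGraph K (B * h ^ (r - 1)) (zoom h T Ω) p := by
  obtain ⟨N, hN, hsol⟩ := exists_polynomial_solution n (M := 1 + M) (κ := κ) (by positivity) hκ
  set L : ℝ := (n + 1) ^ 2 * (1 + M) * (1 + (1 + N)) ^ n * (1 + (1 + N)) with hL
  have hL0 : 0 < L := by positivity
  -- The bound `κ / (2 L)` keeps the Lipschitz constant of the nonlinear part below `κ / 2`.
  refine ⟨min (min 1 ρ) (κ / (2 * L)) / (K + 1), 2 / κ * (A + N) * (K + 1) ^ r, by positivity,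
    by positivity, ?_⟩
  intro Ω z₀ e₁ e₂ c H hβ h hh hle T w₀ hw₀ hz₀
  have hle2 : h * (K + 1) ≤ min (min 1 ρ) (κ / (2 * L)) := by
    rwa [le_div_iff₀ (by positivity)] at hle
  have hτρ := hle2.trans ((min_le_left _ _).trans (min_le_right _ _))
  have hτ1 := hle2.trans ((min_le_left _ _).trans (min_le_left _ _))
  have hτL := hle2.trans (min_le_right _ _)
  obtain ⟨ha, hb, hc, hd⟩ := H.orthonormal.abs_coord_le
  have hnb : ∀ x y : ℝ, |x| ≤ 1 → |y| ≤ 1 → |y - c 1 * x| ≤ 1 + M := by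
    intro x y hx hy
    have h1 := abs_sub y (c 1 * x)
    rw [abs_mul] at h1
    have := mul_le_mul (H.abs_coeff_le 1) hx (abs_nonneg _) hM
    linarith
  -- The linear part `α x + β y` is the product with the normal, and `a x + b y` is the tangential
  -- coordinate. The constant `1 + M` bounds the components of the unnormalized normal as well.
  obtain ⟨D, hDc, hDa, hDb, hDα, hDβ⟩ : ∃ D : ImplicitData (1 + M) κ, D.c = c ∧ D.a = e₁.1 ∧
      D.b = e₁.2 ∧ D.α = (normal e₁ e₂ c).1 ∧ D.β = (normal e₁ e₂ c).2 := ⟨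
    { c := c, a := e₁.1, b := e₁.2, α := (normal e₁ e₂ c).1, β := (normal e₁ e₂ c).2
      abs_c_le := fun j => (H.abs_coeff_le j).trans (by linarith)
      abs_a_le := ha
      abs_b_le := hb
      abs_α_le := hnb _ _ ha hc
      le_β := hβ }, rfl, rfl, rfl, rfl, rfl⟩
  obtain ⟨p, hpd, hp⟩ := hsol D (hDβ.le.trans <| (le_abs_self _).trans (hnb _ _ hb hd))
  -- The implicit solution is centered at the boundary point and at the original scale; here it is
  -- translated to `w₀` and zoomed.
  refine ⟨C h⁻¹ * p.comp (C h * (X - C w₀.1)) + C w₀.2, ?_, ?_⟩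
  · rw [natDegree_add_C]
    refine (natDegree_C_mul_le _ _).trans (natDegree_comp_le.trans ?_)
    have : (C h * (X - C w₀.1)).natDegree ≤ 1 :=
      (natDegree_C_mul_le _ _).trans (natDegree_X_sub_C _).le
    exact (Nat.mul_le_mul_left _ this).trans (by omega)
  intro w hw1 hw2
  obtain ⟨hv1, hv2, hin, hout⟩ := H.zoom hn hh hτρ hw₀ hz₀ hw1 hw2
  have hBh : 2 / κ * (A + N) * (K + 1) ^ r * h ^ (r - 1)
      = h⁻¹ * (2 / κ * (A + N) * (h * (K + 1)) ^ r) := by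
    rw [Real.mul_rpow hh.le (by positivity), Real.rpow_sub_one hh.ne']
    field_simp
  rw [hBh]
  set τ := h * (K + 1) with hτ
  have hτ0 : 0 < τ := by positivity
  set x := (h • (w - w₀)).1 with hx
  set y := (h • (w - w₀)).2 with hy
  have hxe : x = h * (w.1 - w₀.1) := rfl
  have hye : y = h * (w.2 - w₀.2) := rfl
  have hdef : dot (h • (w - w₀)) (normal e₁ e₂ c) - highSum n c (dot (h • (w - w₀)) e₁)
      = D.defect n x y := by
    rw [ImplicitData.defect, hDc, hDa, hDb, hDα, hDβ, dot, dot, ← hx, ← hy]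
    rw [show x * e₁.1 + y * e₁.2 = e₁.1 * x + e₁.2 * y by ring]
    ring
  rw [hdef] at hin hout
  have hev : (C h⁻¹ * p.comp (C h * (X - C w₀.1)) + C w₀.2).eval w.1
      = h⁻¹ * p.eval x + w₀.2 := by
    simp [hxe]
  rw [hev]
  obtain ⟨hpx, hpdef⟩ := hp x (hv1.trans hτ1)
  set y' := p.eval x
  have hy'τ : |y'| ≤ (1 + N) * τ := by
    have := mul_le_mul_of_nonneg_left hv1 hN
    linarith
  have hyτ : |y| ≤ (1 + N) * τ := by
    have := mul_nonneg hN hτ0.le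
    linarith
  have hpdef' : |D.defect n x y'| ≤ N * τ ^ r := by
    refine hpdef.trans (mul_le_mul_of_nonneg_left ?_ hN)
    calc |x| ^ (n + 1) ≤ τ ^ (n + 1) := by gcongr
      _ = τ ^ ((n : ℝ) + 1) := by rw [← Real.rpow_natCast]; push_cast; rfl
      _ ≤ τ ^ r := Real.rpow_le_rpow_of_exponent_ge hτ0 hτ1 hrn
  have hτκ : (n + 1) ^ 2 * (1 + M) * (1 + (1 + N)) ^ n * ((1 + (1 + N)) * τ) ≤ κ / 2 := by
    rw [le_div_iff₀ (by positivity), hL] at hτL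
    linarith
  have h1 := abs_le.1 hpdef'
  have hτr : 0 ≤ τ ^ r := by positivity
  have hN1 : 0 ≤ 1 + N := by linarith
  have hEpos : 0 ≤ A * τ ^ r + N * τ ^ r := by positivity
  have key1 : w ∈ zoom h T Ω → y - y' ≤ 2 / κ * (A * τ ^ r + N * τ ^ r) := fun hm =>
    D.sub_le_of_defect hκ n hN1 hτ1 hτκ hv1 hyτ hy'τ (hin hm) h1.1 hEpos
  have key2 : w ∉ zoom h T Ω → y' - y ≤ 2 / κ * (N * τ ^ r + A * τ ^ r) := fun hm =>
    D.sub_le_of_defect hκ n hN1 hτ1 hτκ hv1 hy'τ hyτ h1.2 (hout hm) (by linarith)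
  have hw2e : w.2 = h⁻¹ * y + w₀.2 := by
    rw [hye, inv_mul_cancel_left₀ hh.ne']; ring
  have hi : 0 < h⁻¹ := inv_pos.2 hh
  rw [hw2e]
  refine ⟨fun hm => ?_, fun hm => ?_⟩
  · have := mul_le_mul_of_nonneg_left (key1 hm) hi.le
    linarith
  · have := mul_le_mul_of_nonneg_left (key2 hm) hi.le
    linarith

/-! ### Areas in the unit mesh -/

lemma mem_cell_one {T : ℤ × ℤ} {z : ℝ × ℝ} :
    z ∈ cell 1 T ↔ ((T.1 : ℝ) ≤ z.1 ∧ z.1 ≤ T.1 + 1) ∧ (T.2 : ℝ) ≤ z.2 ∧ z.2 ≤ T.2 + 1 := by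
  simp only [cell, mem_prod, mem_Icc, mul_one]

lemma isCompact_cell (h : ℝ) (T : ℤ × ℤ) : IsCompact (cell h T) := isCompact_Icc.prod isCompact_Icc

lemma measurableSet_cell (h : ℝ) (T : ℤ × ℤ) : MeasurableSet (cell h T) :=
  (isCompact_cell h T).isClosed.measurableSet

lemma volume_cell {h : ℝ} (hh : 0 ≤ h) (T : ℤ × ℤ) :
    volume (cell h T) = ENNReal.ofReal (h ^ 2) := by
  rw [cell, Measure.volume_eq_prod, Measure.prod_prod, Real.volume_Icc, Real.volume_Icc,
    ← ENNReal.ofReal_mul (by nlinarith)]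
  congr 1
  ring

lemma volume_cell_inter_ne_top (h : ℝ) (T : ℤ × ℤ) (E : Set (ℝ × ℝ)) :
    volume (cell h T ∩ E) ≠ ⊤ :=
  measure_ne_top_of_subset inter_subset_left (isCompact_cell h T).measure_lt_top.ne

lemma volume_strip_le {g : ℝ → ℝ} (hg : Continuous g) (a b η : ℝ) (hη : 0 ≤ η) :
    volume {z : ℝ × ℝ | z.1 ∈ Icc a b ∧ |z.2 - g z.1| ≤ η} ≤ ENNReal.ofReal (2 * η * (b - a)) := by
  have hm : MeasurableSet {z : ℝ × ℝ | z.1 ∈ Icc a b ∧ |z.2 - g z.1| ≤ η} := by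
    refine IsClosed.measurableSet (IsClosed.inter ?_ ?_)
    · exact isClosed_Icc.preimage continuous_fst
    · exact isClosed_le (continuous_snd.sub (hg.comp continuous_fst)).abs continuous_const
  rw [Measure.volume_eq_prod, Measure.prod_apply hm]
  calc _ ≤ ∫⁻ x, (Icc a b).indicator (fun _ => ENNReal.ofReal (2 * η)) x := by
        refine lintegral_mono fun x => ?_
        by_cases hx : x ∈ Icc a b
        · rw [indicator_of_mem hx]
          refine (measure_mono (t := Icc (g x - η) (g x + η)) fun y hy => ?_).trans ?_
          · have := abs_le.1 hy.2
            simp only at this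
            constructor <;> linarith
          · rw [Real.volume_Icc]
            exact ENNReal.ofReal_le_ofReal (by linarith)
        · rw [indicator_of_notMem hx]
          have : Prod.mk x ⁻¹' {z : ℝ × ℝ | z.1 ∈ Icc a b ∧ |z.2 - g z.1| ≤ η} = ∅ := by
            ext y; simp only [mem_preimage, mem_ofPred_eq, mem_empty_iff_false, iff_false]
            exact fun h => hx h.1
          rw [this, measure_empty]
    _ = _ := by
        rw [lintegral_indicator measurableSet_Icc, setLIntegral_const, Real.volume_Icc,
          ← ENNReal.ofReal_mul (by positivity)]

/-- `t` clamped to `[0, L]`. -/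
def clamp (L t : ℝ) : ℝ := max 0 (min L t)

/-- Each cell of a column sees its own slice of the height `t`; stacked, the slices give the height
cut off at the ends of the column. -/
lemma sum_clamp_one (t : ℝ) (L : ℕ) :
    ∑ i ∈ Finset.range L, clamp 1 (t - i) = clamp L t := by
  induction L with
  | zero => simp [clamp]
  | succ L ih =>
    rw [Finset.sum_range_succ, ih]
    have hL : (0 : ℝ) ≤ L := L.cast_nonneg
    push_cast
    simp only [clamp]
    rcases le_total t L with h | h
    · rw [min_eq_right h, min_eq_right (by linarith : t - L ≤ 1),
        max_eq_left (by linarith : t - L ≤ 0), add_zero, min_eq_right (by linarith)]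
    · rw [min_eq_left h, max_eq_right hL]
      rcases le_total t (L + 1) with h' | h'
      · rw [min_eq_right (by linarith : t - L ≤ 1), max_eq_right (by linarith : 0 ≤ t - L),
          min_eq_right h', max_eq_right (by linarith)]; ring
      · rw [min_eq_left (by linarith : 1 ≤ t - L), max_eq_right (zero_le_one),
          min_eq_left h', max_eq_right (by linarith)]

lemma abs_clamp_sub_le {L t η : ℝ} (hL : 0 ≤ L) (hη : 0 ≤ η) (h1 : -η ≤ t) (h2 : t ≤ L + η) :
    |clamp L t - t| ≤ η := by
  rw [clamp, abs_le]
  rcases le_total L t with h | h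
  · rw [min_eq_left h, max_eq_right hL]; constructor <;> linarith
  · rw [min_eq_right h]
    rcases le_total 0 t with h' | h'
    · rw [max_eq_right h']; constructor <;> linarith
    · rw [max_eq_left h']; constructor <;> linarith

lemma continuous_clamp (L : ℝ) : Continuous (clamp L) := by unfold clamp; fun_prop

/-- The subgraph of a function. -/
def subgraph (g : ℝ → ℝ) : Set (ℝ × ℝ) := {z | z.2 ≤ g z.1}

lemma isClosed_subgraph {g : ℝ → ℝ} (hg : Continuous g) : IsClosed (subgraph g) :=
  isClosed_le continuous_snd (hg.comp continuous_fst)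

lemma volume_real_cell_inter_subgraph {g : ℝ → ℝ} (hg : Continuous g) (T : ℤ × ℤ) :
    volume.real (cell 1 T ∩ subgraph g) = ∫ x in (T.1 : ℝ)..(T.1 + 1), clamp 1 (g x - T.2) := by
  have hm : MeasurableSet (cell 1 T ∩ subgraph g) :=
    (measurableSet_cell 1 T).inter (isClosed_subgraph hg).measurableSet
  have hc : Continuous fun x => clamp 1 (g x - T.2) := (continuous_clamp 1).comp (by fun_prop)
  rw [intervalIntegral.integral_of_le (by linarith), ← integral_Icc_eq_integral_Ioc,
    integral_eq_lintegral_of_nonneg_ae (f := fun x => clamp 1 (g x - T.2))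
      (ae_of_all _ fun x => le_max_left _ _) hc.aestronglyMeasurable,
    Measure.real, Measure.volume_eq_prod, Measure.prod_apply hm,
    ← lintegral_indicator measurableSet_Icc]
  congr 1
  refine lintegral_congr fun x => ?_
  by_cases hx : x ∈ Icc (T.1 : ℝ) (T.1 + 1)
  · rw [indicator_of_mem hx]
    have : Prod.mk x ⁻¹' (cell 1 T ∩ subgraph g) = Icc (T.2 : ℝ) (min (T.2 + 1) (g x)) := by
      ext y
      simp only [mem_preimage, mem_inter_iff, mem_cell_one, subgraph, mem_ofPred_eq, mem_Icc,
        le_min_iff]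
      exact ⟨fun h => ⟨h.1.2.1, h.1.2.2, h.2⟩, fun h => ⟨⟨hx, h.1, h.2.1⟩, h.2.2⟩⟩
    rw [this, Real.volume_Icc, clamp]
    have h2 : min (T.2 + 1 : ℝ) (g x) - T.2 = min 1 (g x - T.2) := by
      rw [← min_sub_sub_right, add_sub_cancel_left]
    rw [h2]
    rcases le_total 0 (min 1 (g x - T.2)) with h | h
    · rw [max_eq_right h]
    · rw [max_eq_left h, ENNReal.ofReal_of_nonpos h, ENNReal.ofReal_zero]
  · rw [indicator_of_notMem hx]
    have : Prod.mk x ⁻¹' (cell 1 T ∩ subgraph g) = ∅ := by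
      ext y
      simp only [mem_preimage, mem_inter_iff, mem_cell_one, mem_empty_iff_false, iff_false]
      exact fun h => hx h.1.1
    rw [this, measure_empty]

/-- The cell `T` of the unit mesh lies in `[-K, K]²`. -/
def InBox (K : ℝ) (T : ℤ × ℤ) : Prop := ∀ z ∈ cell 1 T, |z.1| ≤ K ∧ |z.2| ≤ K

lemma inBox_of_abs_le {K : ℝ} {T : ℤ × ℤ} (h1 : |(T.1 : ℝ)| + 1 ≤ K) (h2 : |(T.2 : ℝ)| + 1 ≤ K) :
    InBox K T := by
  intro z hz
  rw [mem_cell_one] at hz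
  obtain ⟨⟨ha, hb⟩, hc, hd⟩ := hz
  have h3 := neg_abs_le (T.1 : ℝ)
  have h4 := le_abs_self (T.1 : ℝ)
  have h5 := neg_abs_le (T.2 : ℝ)
  have h6 := le_abs_self (T.2 : ℝ)
  constructor <;> rw [abs_le] <;> constructor <;> linarith

/-- Within the cell the two sets differ only inside a strip of half-width `η` around the graph. -/
lemma NearGraph.abs_volume_sub_le {K η : ℝ} {Ω : Set (ℝ × ℝ)} {p : ℝ[X]}
    (h : NearGraph K η Ω p) (hη : 0 ≤ η) {T : ℤ × ℤ} (hT : InBox K T) :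
    |volume.real (cell 1 T ∩ Ω) - volume.real (cell 1 T ∩ subgraph p.eval)| ≤ 2 * η := by
  set E : Set (ℝ × ℝ) := {z | z.1 ∈ Icc (T.1 : ℝ) (T.1 + 1) ∧ |z.2 - p.eval z.1| ≤ η} with hE
  have hEle : volume E ≤ ENNReal.ofReal (2 * η) := by
    refine (volume_strip_le p.continuous _ _ _ hη).trans (le_of_eq ?_)
    congr 1; ring
  have hEtop : volume E ≠ ⊤ := (hEle.trans_lt ENNReal.ofReal_lt_top).ne
  have hEr : volume.real E ≤ 2 * η := ENNReal.toReal_le_of_le_ofReal (by positivity) hEle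
  have key : ∀ A B : Set (ℝ × ℝ), (cell 1 T ∩ A ⊆ (cell 1 T ∩ B) ∪ E) →
      volume.real (cell 1 T ∩ A) ≤ volume.real (cell 1 T ∩ B) + 2 * η := by
    intro A B hAB
    refine (measureReal_mono hAB ?_).trans ((measureReal_union_le _ _).trans (by gcongr))
    exact measure_union_ne_top (volume_cell_inter_ne_top _ _ _) hEtop
  have h1 := key Ω (subgraph p.eval) fun z hz => by
    by_cases hz' : z ∈ subgraph p.eval
    · exact Or.inl ⟨hz.1, hz'⟩
    · refine Or.inr ⟨(mem_cell_one.1 hz.1).1, ?_⟩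
      have h2 := (h z (hT z hz.1).1 (hT z hz.1).2).1 hz.2
      simp only [subgraph, mem_ofPred_eq, not_le] at hz'
      rw [abs_le]; constructor <;> linarith
  have h2 := key (subgraph p.eval) Ω fun z hz => by
    by_cases hz' : z ∈ Ω
    · exact Or.inl ⟨hz.1, hz'⟩
    · refine Or.inr ⟨(mem_cell_one.1 hz.1).1, ?_⟩
      have h2 := (h z (hT z hz.1).1 (hT z hz.1).2).2 hz'
      have h3 : z.2 ≤ p.eval z.1 := hz.2
      rw [abs_le]; constructor <;> linarith
  rw [abs_le]; constructor <;> linarith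

lemma isOpen_cellInterior (T : ℤ × ℤ) {s : Set (ℝ × ℝ)} (hs : IsOpen s) :
    IsOpen ((Ioo (T.1 : ℝ) (T.1 + 1) ×ˢ Ioo (T.2 : ℝ) (T.2 + 1)) ∩ s) :=
  (isOpen_Ioo.prod isOpen_Ioo).inter hs

lemma cellInterior_subset (T : ℤ × ℤ) :
    Ioo (T.1 : ℝ) (T.1 + 1) ×ˢ Ioo (T.2 : ℝ) (T.2 + 1) ⊆ cell 1 T := fun _ hz =>
  mem_cell_one.2 ⟨⟨hz.1.1.le, hz.1.2.le⟩, hz.2.1.le, hz.2.2.le⟩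

/-- Otherwise the points of the open cell below `p - η` would form a nonempty open subset of `Ω`,
which has positive area. -/
lemma NearGraph.le_of_volume_eq_zero {K η : ℝ} {Ω : Set (ℝ × ℝ)} {p : ℝ[X]}
    (h : NearGraph K η Ω p) {T : ℤ × ℤ} (hT : InBox K T) (h0 : volume (cell 1 T ∩ Ω) = 0)
    {x : ℝ} (hx : x ∈ Ioo (T.1 : ℝ) (T.1 + 1)) : p.eval x ≤ T.2 + η := by
  by_contra! hlt
  obtain ⟨y, hy1, hy2⟩ := exists_between (show (T.2 : ℝ) < min ((T.2 : ℝ) + 1) (p.eval x - η) from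
    lt_min (by linarith) (by linarith))
  rw [lt_min_iff] at hy2
  have hopen := isOpen_cellInterior T (s := {z : ℝ × ℝ | z.2 < p.eval z.1 - η})
    (isOpen_lt continuous_snd ((p.continuous.comp continuous_fst).sub continuous_const))
  have hpos := hopen.measure_pos volume ⟨(x, y), ⟨hx, hy1, hy2.1⟩, hy2.2⟩
  refine hpos.ne' (measure_mono_null (fun z hz => ?_) h0)
  have hzc := cellInterior_subset T hz.1
  refine ⟨hzc, ?_⟩
  by_contra hz'
  have h1 := (h z (hT z hzc).1 (hT z hzc).2).2 hz'
  have h2 : z.2 < p.eval z.1 - η := hz.2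
  linarith

lemma NearGraph.ge_of_volume_eq_zero {K η : ℝ} {Ω : Set (ℝ × ℝ)} {p : ℝ[X]}
    (h : NearGraph K η Ω p) {T : ℤ × ℤ} (hT : InBox K T) (h0 : volume (cell 1 T ∩ Ωᶜ) = 0)
    {x : ℝ} (hx : x ∈ Ioo (T.1 : ℝ) (T.1 + 1)) : T.2 + 1 - η ≤ p.eval x := by
  by_contra! hlt
  obtain ⟨y, hy1, hy2⟩ := exists_between (show max (T.2 : ℝ) (p.eval x + η) < T.2 + 1 from
    max_lt (by linarith) (by linarith))
  rw [max_lt_iff] at hy1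
  have hopen := isOpen_cellInterior T (s := {z : ℝ × ℝ | p.eval z.1 + η < z.2})
    (isOpen_lt ((p.continuous.comp continuous_fst).add continuous_const) continuous_snd)
  have hpos := hopen.measure_pos volume ⟨(x, y), ⟨hx, hy1.1, hy2⟩, hy1.2⟩
  refine hpos.ne' (measure_mono_null (fun z hz => ?_) h0)
  have hzc := cellInterior_subset T hz.1
  refine ⟨hzc, fun hz' => ?_⟩
  have h1 := (h z (hT z hzc).1 (hT z hzc).2).1 hz'
  have h2 : p.eval z.1 + η < z.2 := hz.2
  linarith

/-- The sum of the areas of `Ω` in the column `i` of a stencil gives the average of the polynomial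
whose subgraph is close to `Ω`. -/
lemma NearGraph.abs_column_sub_le {K η : ℝ} {Ω : Set (ℝ × ℝ)} {p : ℝ[X]}
    (h : NearGraph K η Ω p) (hη : 0 ≤ η) {lm lp : ℕ} {i : ℤ}
    (hbox : ∀ j : ℤ, -(lm : ℤ) - 1 ≤ j → j ≤ lp + 1 → InBox K (i, j))
    (hup : volume (cell 1 (i, (lp : ℤ) + 1) ∩ Ω) = 0)
    (hlow : volume (cell 1 (i, -(lm : ℤ) - 1) ∩ Ωᶜ) = 0) :
    |(∑ j ∈ Finset.range (lm + lp + 1), volume.real (cell 1 (i, -(lm : ℤ) + j) ∩ Ω)) - lm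
      - ∫ x in (i : ℝ)..(i + 1), p.eval x| ≤ (2 * (lm + lp + 1) + 1) * η := by
  have h1 : |∑ j ∈ Finset.range (lm + lp + 1), volume.real (cell 1 (i, -(lm : ℤ) + j) ∩ Ω)
      - ∑ j ∈ Finset.range (lm + lp + 1),
        volume.real (cell 1 (i, -(lm : ℤ) + j) ∩ subgraph p.eval)|
      ≤ (lm + lp + 1) * (2 * η) := by
    rw [← Finset.sum_sub_distrib]
    refine (Finset.abs_sum_le_sum_abs _ _).trans ?_
    refine (Finset.sum_le_card_nsmul _ _ (2 * η) fun j hj => ?_).trans (le_of_eq ?_)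
    · have := Finset.mem_range.1 hj
      exact h.abs_volume_sub_le hη (hbox _ (by omega) (by omega))
    · rw [Finset.card_range, nsmul_eq_mul]; push_cast; ring
  -- By Fubini and stacking, the column measures the height of `p` above the base `-lm`, cut off at
  -- the ends of the column.
  have h2 : ∑ j ∈ Finset.range (lm + lp + 1),
      volume.real (cell 1 (i, -(lm : ℤ) + j) ∩ subgraph p.eval)
      = ∫ x in (i : ℝ)..(i + 1), clamp ((lm + lp + 1 : ℕ) : ℝ) (p.eval x + lm) := by
    simp only [volume_real_cell_inter_subgraph p.continuous]
    rw [← intervalIntegral.integral_finsetSum]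
    · refine intervalIntegral.integral_congr fun x _ => ?_
      rw [← sum_clamp_one]
      refine Finset.sum_congr rfl fun j _ => ?_
      push_cast
      congr 1; ring
    · intro j _
      exact ((continuous_clamp 1).comp (by fun_prop)).intervalIntegrable _ _
  have hc : Continuous fun x => clamp ((lm + lp + 1 : ℕ) : ℝ) (p.eval x + lm) :=
    (continuous_clamp _).comp (by fun_prop)
  have h3 : |(∫ x in (i : ℝ)..(i + 1), clamp ((lm + lp + 1 : ℕ) : ℝ) (p.eval x + lm)) - lm
      - ∫ x in (i : ℝ)..(i + 1), p.eval x| ≤ η := by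
    have h4 : (∫ x in (i : ℝ)..(i + 1), clamp ((lm + lp + 1 : ℕ) : ℝ) (p.eval x + lm)) - lm
        - ∫ x in (i : ℝ)..(i + 1), p.eval x
        = ∫ x in (i : ℝ)..(i + 1),
          (clamp ((lm + lp + 1 : ℕ) : ℝ) (p.eval x + lm) - (p.eval x + lm)) := by
      have h5 : Continuous fun x => p.eval x + (lm : ℝ) := by fun_prop
      rw [intervalIntegral.integral_sub (hc.intervalIntegrable _ _) (h5.intervalIntegrable _ _),
        intervalIntegral.integral_add (p.continuous.intervalIntegrable _ _)
        (continuous_const.intervalIntegrable _ _)]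
      simp only [intervalIntegral.integral_const, smul_eq_mul]
      ring
    rw [h4, ← Real.norm_eq_abs]
    have h5 := intervalIntegral.norm_integral_le_of_norm_le_const_ae (C := η)
      (f := fun x => clamp ((lm + lp + 1 : ℕ) : ℝ) (p.eval x + lm) - (p.eval x + lm))
      (a := (i : ℝ)) (b := i + 1) ?_
    · simpa using h5
    -- The bounds on `p` hold over the open interval, so its right end point is discarded as a null
    -- set.
    · have hne : ∀ᵐ x : ℝ, x ≠ i + 1 := by
        simp [ae_iff]
      filter_upwards [hne] with x hx hxm
      rw [uIoc_of_le (by linarith)] at hxm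
      have hx' : x ∈ Ioo (i : ℝ) (i + 1) := ⟨hxm.1, lt_of_le_of_ne hxm.2 hx⟩
      -- The empty cell above and the full cell below the column confine `p`, up to `η`, to the
      -- range where nothing is cut off.
      have hu := h.le_of_volume_eq_zero (hbox _ (by omega) le_rfl) hup hx'
      have hl := h.ge_of_volume_eq_zero (hbox _ le_rfl (by omega)) hlow hx'
      push_cast at hu hl
      refine abs_clamp_sub_le (Nat.cast_nonneg _) hη (by linarith) ?_
      push_cast
      linarith
  rw [h2] at h1
  rw [abs_le] at h1 h3 ⊢
  constructor <;> linarith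

/-- The error of the recovery on the unit cell. -/
lemma exists_recovery_const (n L : ℕ) : ∃ C : ℝ, 0 ≤ C ∧
    ∀ (km kp lm lp : ℕ), km + kp = n → lm ≤ L → lp ≤ L → ∀ K : ℝ, n + L + 2 ≤ K →
    ∀ (Ω : Set (ℝ × ℝ)) (p q : ℝ[X]) (η : ℝ), 0 ≤ η → NearGraph K η Ω p →
      p.natDegree ≤ n → q.natDegree ≤ n →
      (∀ i : ℤ, -(km : ℤ) ≤ i → i ≤ kp → volume (cell 1 (i, (lp : ℤ) + 1) ∩ Ω) = 0 ∧
        volume (cell 1 (i, -(lm : ℤ) - 1) ∩ Ωᶜ) = 0 ∧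
        ∫ x in (i : ℝ)..(i + 1), q.eval x
          = (∑ j ∈ Finset.range (lm + lp + 1), volume.real (cell 1 (i, -(lm : ℤ) + j) ∩ Ω)) - lm) →
      volume (cell 1 0 ∩ {z | ¬ (z ∈ Ω ↔ z ∈ subgraph q.eval)}) ≤ ENNReal.ofReal (C * η) := by
  obtain ⟨C₀, hC₀, hstab⟩ := exists_stability_const n
  -- Each of the at most `2 L + 1` cells of a column costs `2 η` and the cut-off costs `η`;
  -- stability multiplies the sum by `C₀`.
  set C₁ : ℝ := C₀ * (2 * (2 * L + 1) + 1) with hC₁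
  -- The strip around `p` has half-width `C₁ η + η`: the distance to `q`, plus that between `Ω` and
  -- the subgraph of `p`.
  refine ⟨2 * (C₁ + 1), by positivity, ?_⟩
  intro km kp lm lp hk hlm hlp K hK Ω p q η hη hg hp hq hcol
  have hbox : ∀ i j : ℤ, -(km : ℤ) ≤ i → i ≤ kp → -(lm : ℤ) - 1 ≤ j → j ≤ lp + 1 →
      InBox K (i, j) := by
    intro i j hi1 hi2 hj1 hj2
    have h1 : |i| ≤ n := by rw [abs_le]; constructor <;> omega
    have h2 : |j| ≤ L + 1 := by rw [abs_le]; constructor <;> omega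
    have h1' : |(i : ℝ)| ≤ n := by exact_mod_cast h1
    have h2' : |(j : ℝ)| ≤ L + 1 := by exact_mod_cast h2
    have hL0 : (0 : ℝ) ≤ L := L.cast_nonneg
    have hn0 : (0 : ℝ) ≤ n := n.cast_nonneg
    exact inBox_of_abs_le (by simp only; linarith) (by simp only; linarith)
  have hpq : ∀ x ∈ Icc (0 : ℝ) 1, |(q - p).eval x| ≤ C₁ * η := by
    intro x hx
    have := hstab km (by omega) (q - p) ((natDegree_sub_le _ _).trans (max_le hq hp))
      ((2 * (2 * L + 1) + 1) * η) (fun i hi => ?_) x hx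
    · rw [hC₁, mul_assoc]; exact this
    · have hi' := Finset.mem_range.1 hi
      obtain ⟨hup, hlow, hint⟩ := hcol ((i : ℤ) - km) (by omega) (by omega)
      have h1 := hg.abs_column_sub_le hη
        (fun j hj1 hj2 => hbox ((i : ℤ) - km) j (by omega) (by omega) hj1 hj2) hup hlow
      rw [← hint] at h1
      push_cast at h1
      have h2 : ∫ x in (node km i)..(node km (i + 1)), (q - p).eval x
          = (∫ x in ((i : ℝ) - km)..((i : ℝ) - km + 1), q.eval x)
            - ∫ x in ((i : ℝ) - km)..((i : ℝ) - km + 1), p.eval x := by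
        rw [← intervalIntegral.integral_sub (q.continuous.intervalIntegrable _ _)
          (p.continuous.intervalIntegrable _ _)]
        simp only [eval_sub, node]
        push_cast
        rw [show (i : ℝ) + 1 - km = i - km + 1 by ring]
      rw [h2]
      refine h1.trans ?_
      have hlm' : (lm : ℝ) ≤ L := by exact_mod_cast hlm
      have hlp' : (lp : ℝ) ≤ L := by exact_mod_cast hlp
      refine mul_le_mul_of_nonneg_right ?_ hη
      linarith
  have hC₁0 : 0 ≤ C₁ := by positivity
  have hC₁η : 0 ≤ C₁ * η := by positivity
  refine (measure_mono (t := {z : ℝ × ℝ | z.1 ∈ Icc (0 : ℝ) 1 ∧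
    |z.2 - p.eval z.1| ≤ (C₁ + 1) * η}) ?_).trans
    ((volume_strip_le p.continuous 0 1 ((C₁ + 1) * η) (by positivity)).trans
      (ENNReal.ofReal_le_ofReal (le_of_eq (by ring))))
  rintro z ⟨hz, hzΩ⟩
  have hzb := hbox 0 0 (by omega) (by omega) (by omega) (by omega) z hz
  have hz1 : z.1 ∈ Icc (0 : ℝ) 1 := by
    have := (mem_cell_one.1 hz).1
    simpa using this
  refine ⟨hz1, ?_⟩
  have h1 := abs_le.1 (hpq z.1 hz1)
  rw [eval_sub] at h1
  have h2 := hg z hzb.1 hzb.2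
  simp only [subgraph, mem_ofPred_eq] at hzΩ
  rw [abs_le]
  by_cases hm : z ∈ Ω
  · have h3 : q.eval z.1 < z.2 := by
      by_contra! h3
      exact hzΩ ⟨fun _ => h3, fun _ => hm⟩
    have h4 := h2.1 hm
    constructor <;> linarith
  · have h3 : z.2 ≤ q.eval z.1 := by
      by_contra! h3
      exact hzΩ ⟨fun h => absurd h hm, fun h => absurd h h3.not_ge⟩
    have h4 := h2.2 hm
    constructor <;> linarith

/-! ### The orientation test in the unit mesh -/

/-- The areas of `Ω` in the cells of the unit mesh. -/
def unitArea (Ω : Set (ℝ × ℝ)) (T : ℤ × ℤ) : ℝ := volume.real (cell 1 T ∩ Ω)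

lemma unitArea_preimage {f : ℝ × ℝ → ℝ × ℝ} (hf : MeasurePreserving f) {Ω : Set (ℝ × ℝ)}
    (hΩ : MeasurableSet Ω) {T T' : ℤ × ℤ} (hT : f ⁻¹' cell 1 T' = cell 1 T) :
    unitArea (f ⁻¹' Ω) T = unitArea Ω T' := by
  rw [unitArea, unitArea, ← hT, ← preimage_inter, Measure.real, Measure.real,
    hf.measure_preimage ((measurableSet_cell 1 T').inter hΩ).nullMeasurableSet]

/-- Comparison of two cells through an isometry `f` from `T` to `T'`: points that violate `f z ∈ Ω →
z ∈ Ω` are confined to a square of side `β`. -/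
lemma unitArea_le_add {Ω : Set (ℝ × ℝ)} {f : ℝ × ℝ → ℝ × ℝ} (hf : MeasurePreserving f)
    (hΩ : MeasurableSet Ω) {T T' : ℤ × ℤ} (hT : f ⁻¹' cell 1 T' = cell 1 T) {a b β : ℝ}
    (hβ : 0 ≤ β) (hsub : ∀ z ∈ cell 1 T, f z ∈ Ω → z ∉ Ω →
      z ∈ Icc a (a + β) ×ˢ Icc b (b + β)) : unitArea Ω T' ≤ unitArea Ω T + β ^ 2 := by
  have hbox : volume.real (Icc a (a + β) ×ˢ Icc b (b + β)) = β ^ 2 := by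
    rw [Measure.real, Measure.volume_eq_prod, Measure.prod_prod, Real.volume_Icc, Real.volume_Icc,
      add_sub_cancel_left, add_sub_cancel_left, ← ENNReal.ofReal_mul hβ,
      ENNReal.toReal_ofReal (by positivity), sq]
  rw [← unitArea_preimage hf hΩ hT, ← hbox, unitArea, unitArea]
  refine (measureReal_mono (s₂ := (cell 1 T ∩ Ω) ∪ Icc a (a + β) ×ˢ Icc b (b + β)) ?_ ?_).trans
    (measureReal_union_le _ _)
  · rintro z ⟨hz, hzf⟩
    by_cases hm : z ∈ Ω
    · exact Or.inl ⟨hz, hm⟩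
    · exact Or.inr (hsub z hz hzf hm)
  · exact measure_union_ne_top (volume_cell_inter_ne_top _ _ _)
      (isCompact_Icc.prod isCompact_Icc).measure_lt_top.ne

/-- The strict form of the comparison: no point violates the implication, and a whole rectangle is
gained. -/
lemma unitArea_add_le {Ω : Set (ℝ × ℝ)} {f : ℝ × ℝ → ℝ × ℝ} (hf : MeasurePreserving f)
    (hΩ : MeasurableSet Ω) {T T' : ℤ × ℤ} (hT : f ⁻¹' cell 1 T' = cell 1 T)
    (hsub : ∀ z ∈ cell 1 T, f z ∈ Ω → z ∈ Ω) {a b γ γ' : ℝ} (hγ : 0 ≤ γ) (hγ' : 0 ≤ γ')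
    (hbox : ∀ z ∈ Icc a (a + γ) ×ˢ Icc b (b + γ'), z ∈ cell 1 T ∧ z ∈ Ω ∧ f z ∉ Ω) :
    unitArea Ω T' + γ * γ' ≤ unitArea Ω T := by
  have hvol : volume.real (Icc a (a + γ) ×ˢ Icc b (b + γ')) = γ * γ' := by
    rw [Measure.real, Measure.volume_eq_prod, Measure.prod_prod, Real.volume_Icc, Real.volume_Icc,
      add_sub_cancel_left, add_sub_cancel_left, ← ENNReal.ofReal_mul hγ,
      ENNReal.toReal_ofReal (by positivity)]
  rw [← unitArea_preimage hf hΩ hT, ← hvol, unitArea, unitArea,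
    ← measureReal_union ?_ (measurableSet_Icc.prod measurableSet_Icc)
      (volume_cell_inter_ne_top _ _ _) (isCompact_Icc.prod isCompact_Icc).measure_lt_top.ne]
  · refine measureReal_mono ?_ (volume_cell_inter_ne_top _ _ _)
    rintro z (⟨hz, hzf⟩ | hz)
    · exact ⟨hz, hsub z hz hzf⟩
    · exact ⟨(hbox z hz).1, (hbox z hz).2.1⟩
  · rw [Set.disjoint_left]
    exact fun z hz hz' => (hbox z hz').2.2 hz.2

/-- The reflection of the plane that exchanges the upper and lower sides of the unit square. -/
def reflY (z : ℝ × ℝ) : ℝ × ℝ := (z.1, 1 - z.2)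

lemma measurePreserving_swap : MeasurePreserving (Prod.swap : ℝ × ℝ → ℝ × ℝ) :=
  Measure.measurePreserving_swap

lemma measurePreserving_reflY : MeasurePreserving reflY :=
  (MeasurePreserving.id volume).prod (Measure.measurePreserving_sub_left volume 1)

lemma measurePreserving_shift (a : ℝ) :
    MeasurePreserving (fun z : ℝ × ℝ => (z.1, z.2 + a)) :=
  (MeasurePreserving.id volume).prod (measurePreserving_add_right volume a)

lemma swap_preimage_cell (T : ℤ × ℤ) : Prod.swap ⁻¹' cell 1 T.swap = cell 1 T := by
  ext z
  simp only [mem_preimage, mem_cell_one, Prod.fst_swap, Prod.snd_swap]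
  tauto

lemma reflY_preimage_cell (T : ℤ × ℤ) : reflY ⁻¹' cell 1 (T.1, -T.2) = cell 1 T := by
  ext z
  simp only [mem_preimage, mem_cell_one, reflY]
  push_cast
  constructor <;> rintro ⟨h1, h2, h3⟩ <;> exact ⟨h1, by linarith, by linarith⟩

lemma shift_preimage_cell (i j m : ℤ) :
    (fun z : ℝ × ℝ => (z.1, z.2 + (m : ℝ))) ⁻¹' cell 1 (i, j + m) = cell 1 (i, j) := by
  ext z
  simp only [mem_preimage, mem_cell_one]
  push_cast
  constructor <;> rintro ⟨h1, h2, h3⟩ <;> exact ⟨h1, by linarith, by linarith⟩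

lemma unitArea_swap {Ω : Set (ℝ × ℝ)} (hΩ : MeasurableSet Ω) (i j : ℤ) :
    unitArea (Prod.swap ⁻¹' Ω) (i, j) = unitArea Ω (j, i) :=
  unitArea_preimage measurePreserving_swap hΩ (swap_preimage_cell (i, j))

lemma unitArea_reflY {Ω : Set (ℝ × ℝ)} (hΩ : MeasurableSet Ω) (i j : ℤ) :
    unitArea (reflY ⁻¹' Ω) (i, j) = unitArea Ω (i, -j) :=
  unitArea_preimage measurePreserving_reflY hΩ (reflY_preimage_cell (i, j))

lemma NearHalfPlane.swap {K ε : ℝ} {Ω : Set (ℝ × ℝ)} {w₀ n : ℝ × ℝ}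
    (h : NearHalfPlane K ε Ω w₀ n) : NearHalfPlane K ε (Prod.swap ⁻¹' Ω) w₀.swap n.swap := by
  intro w h1 h2
  have := h w.swap h2 h1
  simp only [dot, mem_preimage, Prod.fst_sub, Prod.snd_sub, Prod.fst_swap, Prod.snd_swap] at this ⊢
  rwa [add_comm]

lemma NearHalfPlane.reflY {K K' ε : ℝ} {Ω : Set (ℝ × ℝ)} {w₀ n : ℝ × ℝ}
    (h : NearHalfPlane K ε Ω w₀ n) (hK : K' + 1 ≤ K) :
    NearHalfPlane K' ε (Aeros.reflY ⁻¹' Ω) (Aeros.reflY w₀) (n.1, -n.2) := by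
  intro w h1 h2
  have h2' := abs_le.1 h2
  have := h (Aeros.reflY w) (h1.trans (by linarith)) (by
    simp only [Aeros.reflY, abs_le]; constructor <;> linarith)
  have heq : dot (Aeros.reflY w - w₀) n = dot (w - Aeros.reflY w₀) (n.1, -n.2) := by
    simp only [dot, Aeros.reflY, Prod.fst_sub, Prod.snd_sub]; ring
  rwa [heq] at this

lemma swap_mem_unitCell {w : ℝ × ℝ} (h : w ∈ cell 1 0) : w.swap ∈ cell 1 0 := ⟨h.2, h.1⟩

lemma reflY_mem_unitCell {w : ℝ × ℝ} (h : w ∈ cell 1 0) : reflY w ∈ cell 1 0 := by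
  have := (reflY_preimage_cell 0).symm ▸ h
  exact this

section Sobel

variable {Ω : Set (ℝ × ℝ)} {w₀ n : ℝ × ℝ} {ε δ K : ℝ}

/-- If the normal points to the right of the diagonal, the upper left corner of the block of nine
cells contains more of `Ω` than its lower right corner. -/
lemma unitArea_corner_add_le (hΩ : MeasurableSet Ω) (hw₀ : w₀ ∈ cell 1 0)
    (h : NearHalfPlane K ε Ω w₀ n) (hK : 2 ≤ K) (hδ : 0 < δ) (hδ1 : δ ≤ 1)
    (hεδ : ε ≤ δ ^ 2 / 100) (hn1 : 1 / 2 ≤ n.1) (hle : |n.2| ≤ n.1)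
    (hdiff : n.1 * δ / 2 ≤ n.1 - n.2)
    (hbad : ∀ z : ℝ × ℝ, z.1 ∈ Icc (-1 : ℝ) 0 → z.2 ∈ Icc (1 : ℝ) 2 → z.swap ∈ Ω → z ∈ Ω) :
    unitArea Ω (1, -1) + δ / 8 * (δ / 8) ≤ unitArea Ω (-1, 1) := by
  obtain ⟨⟨hx0, hx1⟩, hy0, hy1⟩ := mem_cell_one.1 hw₀
  simp only [Prod.fst_zero, Prod.snd_zero, Int.cast_zero, zero_add] at hx0 hx1 hy0 hy1
  have hd0 : 0 ≤ n.1 - n.2 := by linarith [le_abs_self n.2]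
  -- The point `(-ξ, 1 + η)` and its mirror image `(1 + η, -ξ)` lie on the antidiagonal through
  -- `w₀`, on opposite sides and at horizontal distance at least `1` from it. They are thus
  -- separated from the boundary line by the margin `n.1 - n.2`.
  obtain ⟨ξ, η, hξ0, hξ1, hη0, hη1, hξη1, hξη2⟩ : ∃ ξ η : ℝ, 0 ≤ ξ ∧ ξ ≤ 1 ∧ 0 ≤ η ∧ η ≤ 1 ∧
      -n.1 * (w₀.1 + ξ) + n.2 * (1 + η - w₀.2) ≤ -(n.1 - n.2) ∧
      n.1 - n.2 ≤ n.1 * (1 + η - w₀.1) - n.2 * (ξ + w₀.2) := by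
    rcases le_total 1 (w₀.1 + w₀.2) with hc | hc
    · exact ⟨2 - w₀.1 - w₀.2, 1, by linarith, by linarith, by linarith, by linarith,
        by linarith [mul_nonneg hd0 (sub_nonneg.2 hy1)],
        by linarith [mul_nonneg hd0 (sub_nonneg.2 hx1)]⟩
    · exact ⟨1, w₀.1 + w₀.2, by linarith, by linarith, by linarith, by linarith,
        by linarith [mul_nonneg hd0 (hx0)], by linarith [mul_nonneg hd0 (hy0)]⟩
  -- A square of side `δ / 8` that stays in the cell and near the chosen point changes the products
  -- by at most `n.1 * δ / 4`, half of the guaranteed margin; the other half exceeds `ε`.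
  have hclose : ∀ u : ℝ, 0 ≤ u → u ≤ 1 → ∃ a : ℝ, 0 ≤ a ∧ a + δ / 8 ≤ 1 ∧
      u - δ / 8 ≤ a ∧ a ≤ u := by
    intro u hu0 hu1
    rcases le_total u (δ / 8) with hu | hu
    · exact ⟨0, le_rfl, by linarith, by linarith, hu0⟩
    · exact ⟨u - δ / 8, by linarith, by linarith, le_rfl, by linarith⟩
  obtain ⟨a, ha0, ha1, ha2, ha3⟩ := hclose ξ hξ0 hξ1
  obtain ⟨b, hb0, hb1, hb2, hb3⟩ := hclose η hη0 hη1
  refine unitArea_add_le measurePreserving_swap hΩ (swap_preimage_cell (-1, 1)) ?_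
    (a := -(a + δ / 8)) (b := 1 + b) (by positivity) (by positivity) ?_
  · intro z hz hs
    obtain ⟨⟨h1, h2⟩, h3, h4⟩ := mem_cell_one.1 hz
    norm_num at h1 h2 h3 h4
    exact hbad z ⟨h1, h2⟩ ⟨h3, by linarith⟩ hs
  · rintro ⟨x, y⟩ ⟨⟨h1, h2⟩, h3, h4⟩
    simp only at h1 h2 h3 h4
    have hxK : |x| ≤ K := abs_le.2 ⟨by linarith, by linarith⟩
    have hyK : |y| ≤ K := abs_le.2 ⟨by linarith, by linarith⟩
    have hs : |(-x) - ξ| ≤ δ / 8 := abs_le.2 ⟨by linarith, by linarith⟩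
    have ht : |y - 1 - η| ≤ δ / 8 := abs_le.2 ⟨by linarith, by linarith⟩
    have hp : ∀ s u : ℝ, |s| ≤ n.1 → |u| ≤ δ / 8 → |s * u| ≤ n.1 * (δ / 8) := fun s u h1 h2 => by
      rw [abs_mul]; exact mul_le_mul h1 h2 (abs_nonneg _) (by linarith)
    have hn1' : |n.1| ≤ n.1 := (abs_of_nonneg (by linarith)).le
    have p1 := abs_le.1 (hp n.1 _ hn1' hs)
    have p2 := abs_le.1 (hp n.2 _ hle ht)
    have p3 := abs_le.1 (hp n.1 _ hn1' ht)
    have p4 := abs_le.1 (hp n.2 _ hle hs)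
    have hεs : ε < n.1 * δ / 4 := by
      have e1 : δ ^ 2 ≤ δ := by nlinarith
      have e2 := mul_le_mul_of_nonneg_right hn1 hδ.le
      linarith
    refine ⟨mem_cell_one.2 ?_, ?_, ?_⟩
    · norm_num
      exact ⟨⟨by linarith, by linarith⟩, by linarith, by linarith⟩
    · by_contra hm
      have := (h (x, y) hxK hyK).2 hm
      simp only [dot, Prod.fst_sub, Prod.snd_sub] at this
      linarith
    · intro hm
      have := (h (y, x) hyK hxK).1 hm
      simp only [dot, Prod.fst_sub, Prod.snd_sub] at this
      linarith

/-- If the normal points to the right of the diagonal, then so does the numerical gradient. -/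
lemma sobelH_lt_sobelV (hΩ : MeasurableSet Ω) (hw₀ : w₀ ∈ cell 1 0)
    (h : NearHalfPlane K ε Ω w₀ n) (hK : 2 ≤ K) (hδ : 0 < δ) (hδ1 : δ ≤ 1) (hε : 0 < ε)
    (hεδ : ε ≤ δ ^ 2 / 100) (hn : 1 ≤ n.1 ^ 2 + n.2 ^ 2) (hdir : (1 + δ) * |n.2| ≤ n.1) :
    sobelH (unitArea Ω) 0 < sobelV (unitArea Ω) 0 := by
  obtain ⟨⟨hx0, hx1⟩, hy0, hy1⟩ := mem_cell_one.1 hw₀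
  simp only [Prod.fst_zero, Prod.snd_zero, Int.cast_zero, zero_add] at hx0 hx1 hy0 hy1
  have habs := abs_nonneg n.2
  have hn2a := neg_abs_le n.2
  have hn2b := le_abs_self n.2
  have hle : |n.2| ≤ n.1 := by nlinarith
  have hn1 : 1 / 2 ≤ n.1 := by nlinarith [sq_abs n.2]
  have hdiff : n.1 * δ / 2 ≤ n.1 - n.2 := by nlinarith
  have hdiff' : δ / 4 ≤ n.1 - n.2 := by nlinarith
  -- A point whose mirror image is in `Ω` while it is not satisfies `(n.1 - n.2) (z.2 - z.1) ≤ 2 ε`,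
  -- and `n.1 - n.2 ≥ δ / 4`. So it is within `β = 8 ε / δ` of the diagonal, or beyond it.
  set β := 8 * ε / δ with hβ
  have hβ0 : 0 < β := by positivity
  have hβδ : β * δ = 8 * ε := by rw [hβ]; field_simp
  have hβle : β ≤ 8 / 100 * δ := by
    rw [hβ, div_le_iff₀ hδ]; nlinarith
  have hbad : ∀ z : ℝ × ℝ, |z.1| ≤ 2 → |z.2| ≤ 2 → z.swap ∈ Ω → z ∉ Ω → z.2 - z.1 ≤ β := by
    intro z h1 h2 hs hz
    have ha := (h z (h1.trans hK) (h2.trans hK)).2 hz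
    have hb := (h z.swap (h2.trans hK) (h1.trans hK)).1 hs
    simp only [dot, Prod.fst_sub, Prod.snd_sub, Prod.fst_swap, Prod.snd_swap] at ha hb
    have hc : (n.1 - n.2) * (z.2 - z.1) ≤ 2 * ε := by linarith
    by_contra! hlt
    have : δ / 4 * β < (n.1 - n.2) * (z.2 - z.1) := by
      calc δ / 4 * β < δ / 4 * (z.2 - z.1) := by gcongr
        _ ≤ _ := mul_le_mul_of_nonneg_right hdiff' (by linarith)
    linarith
  -- The cells `(0, -1)` and `(-1, 0)` meet the diagonal only at a corner, near which all exceptions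
  -- lie. The same holds for the next pair.
  have hA : unitArea Ω (0, -1) ≤ unitArea Ω (-1, 0) + β ^ 2 := by
    refine unitArea_le_add measurePreserving_swap hΩ (swap_preimage_cell (-1, 0)) (a := -β)
      (b := 0) hβ0.le fun z hz hs hm => ?_
    obtain ⟨⟨h1, h2⟩, h3, h4⟩ := mem_cell_one.1 hz
    norm_num at h1 h2 h3 h4
    have := hbad z (abs_le.2 ⟨by linarith, by linarith⟩) (abs_le.2 ⟨by linarith, by linarith⟩) hs hm
    exact ⟨⟨by linarith, by linarith⟩, by linarith, by linarith⟩
  have hB : unitArea Ω (1, 0) ≤ unitArea Ω (0, 1) + β ^ 2 := by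
    refine unitArea_le_add measurePreserving_swap hΩ (swap_preimage_cell (0, 1)) (a := 1 - β)
      (b := 1) hβ0.le fun z hz hs hm => ?_
    obtain ⟨⟨h1, h2⟩, h3, h4⟩ := mem_cell_one.1 hz
    norm_num at h1 h2 h3 h4
    have := hbad z (abs_le.2 ⟨by linarith, by linarith⟩) (abs_le.2 ⟨by linarith, by linarith⟩) hs hm
    exact ⟨⟨by linarith, by linarith⟩, by linarith, by linarith⟩
  have hC := unitArea_corner_add_le hΩ hw₀ h hK hδ hδ1 hεδ hn1 hle hdiff
    fun z ⟨h1, h2⟩ ⟨h3, h4⟩ hs => by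
    by_contra hm
    have := hbad z (abs_le.2 ⟨by linarith, by linarith⟩) (abs_le.2 ⟨by linarith, by linarith⟩) hs hm
    linarith
  -- In the difference of the two filters the exceptions cost `4 β² ≤ 0.0256 δ²`, while the corner
  -- cells contribute at least `2 (δ / 8)² = 0.03125 δ²`.
  have hβsq : β ^ 2 ≤ (8 / 100 * δ) ^ 2 := by gcongr
  have hδsq : 0 < δ ^ 2 := by positivity
  simp only [sobelH, sobelV, Prod.fst_zero, Prod.snd_zero, zero_add, zero_sub]
  linarith

/-- A shift by two cells upward increases the product with the normal by `2 n.2 > 2 ε`, so no cell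
of the upper row contains more of `Ω` than its counterpart below. In the middle column a thin
rectangle next to the abscissa of `w₀` makes this strict. -/
lemma sobelV_neg (hΩ : MeasurableSet Ω) (hw₀ : w₀ ∈ cell 1 0)
    (h : NearHalfPlane K ε Ω w₀ n) (hK : 2 ≤ K)
    (hε : ε ≤ 1 / 100) (hn : 1 ≤ n.1 ^ 2 + n.2 ^ 2) (hn2 : 0 < n.2) (hdir : |n.1| ≤ 2 * n.2) :
    sobelV (unitArea Ω) 0 < 0 := by
  obtain ⟨⟨hx0, hx1⟩, hy0, hy1⟩ := mem_cell_one.1 hw₀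
  simp only [Prod.fst_zero, Prod.snd_zero, Int.cast_zero, zero_add] at hx0 hx1 hy0 hy1
  have hn2' : 2 / 5 ≤ n.2 := by
    have : n.1 ^ 2 ≤ (2 * n.2) ^ 2 := sq_le_sq' (by linarith [neg_abs_le n.1])
      (by linarith [le_abs_self n.1])
    nlinarith
  have hmono : ∀ z : ℝ × ℝ, |z.1| ≤ 2 → |z.2| ≤ 2 → |z.2 + 2| ≤ 2 → (z.1, z.2 + 2) ∈ Ω →
      z ∈ Ω := by
    intro z h1 h2 h3 hs
    by_contra hm
    have ha := (h z (h1.trans hK) (h2.trans hK)).2 hm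
    have hb := (h (z.1, z.2 + 2) (h1.trans hK) (h3.trans hK)).1 hs
    simp only [dot, Prod.fst_sub, Prod.snd_sub] at ha hb
    linarith
  have hcell : ∀ i : ℤ, |(i : ℝ)| ≤ 1 → ∀ z ∈ cell 1 (i, -1), (z.1, z.2 + ((2 : ℤ) : ℝ)) ∈ Ω →
      z ∈ Ω := by
    intro i hi z hz hs
    obtain ⟨⟨h1, h2⟩, h3, h4⟩ := mem_cell_one.1 hz
    norm_num at h1 h2 h3 h4 hs
    have := abs_le.1 hi
    exact hmono z (abs_le.2 ⟨by linarith, by linarith⟩) (abs_le.2 ⟨by linarith, by linarith⟩)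
      (abs_le.2 ⟨by linarith, by linarith⟩) hs
  have hside : ∀ i : ℤ, |(i : ℝ)| ≤ 1 → unitArea Ω (i, 1) ≤ unitArea Ω (i, -1) := by
    intro i hi
    have := unitArea_le_add (β := 0) (a := 0) (b := 0) (measurePreserving_shift ((2 : ℤ) : ℝ)) hΩ
      (shift_preimage_cell i (-1) 2) le_rfl
      (fun z hz hs hm => absurd (hcell i hi z hz hs) hm)
    norm_num at this
    exact this
  have hmid : unitArea Ω (0, 1) + 1 / 16 * (1 / 2) ≤ unitArea Ω (0, -1) := by
    obtain ⟨a, ha0, ha1, ha2, ha3⟩ : ∃ a : ℝ, 0 ≤ a ∧ a + 1 / 16 ≤ 1 ∧ w₀.1 - 1 / 16 ≤ a ∧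
        a ≤ w₀.1 := by
      rcases le_total w₀.1 (1 / 16) with hu | hu
      · exact ⟨0, le_rfl, by norm_num, by linarith, hx0⟩
      · exact ⟨w₀.1 - 1 / 16, by linarith, by linarith, le_rfl, by linarith⟩
    have := unitArea_add_le (measurePreserving_shift ((2 : ℤ) : ℝ)) hΩ
      (shift_preimage_cell 0 (-1) 2)
      (hcell 0 (by simp)) (a := a) (b := -3 / 4) (γ := 1 / 16) (γ' := 1 / 2) (by norm_num)
      (by norm_num) ?_
    · norm_num at this ⊢
      exact this
    rintro ⟨x, y⟩ ⟨⟨h1, h2⟩, h3, h4⟩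
    simp only at h1 h2 h3 h4
    have hs : |x - w₀.1| ≤ 1 / 16 := abs_le.2 ⟨by linarith, by linarith⟩
    have hp : |n.1 * (x - w₀.1)| ≤ 2 * n.2 * (1 / 16) := by
      rw [abs_mul]; exact mul_le_mul hdir hs (abs_nonneg _) (by linarith)
    have hp' := abs_le.1 hp
    refine ⟨mem_cell_one.2 ?_, ?_, ?_⟩
    · norm_num
      exact ⟨⟨by linarith, by linarith⟩, by linarith, by linarith⟩
    · by_contra hm
      have := (h (x, y) (abs_le.2 ⟨by linarith, by linarith⟩)
        (abs_le.2 ⟨by linarith, by linarith⟩)).2 hm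
      simp only [dot, Prod.fst_sub, Prod.snd_sub] at this
      nlinarith
    · intro hm
      have := (h (x, y + ((2 : ℤ) : ℝ)) (abs_le.2 ⟨by linarith, by linarith⟩)
        (abs_le.2 ⟨by push_cast; linarith, by push_cast; linarith⟩)).1 hm
      simp only [dot, Prod.fst_sub, Prod.snd_sub] at this
      push_cast at this
      nlinarith
  have h1 := hside 1 (by simp)
  have h2 := hside (-1) (by simp)
  simp only [sobelV, Prod.fst_zero, Prod.snd_zero, zero_add, zero_sub]
  linarith

lemma sobelH_reflY (hΩ : MeasurableSet Ω) :
    sobelH (unitArea (reflY ⁻¹' Ω)) 0 = sobelH (unitArea Ω) 0 := by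
  simp only [sobelH, Prod.fst_zero, Prod.snd_zero, zero_add, zero_sub, unitArea_reflY hΩ, neg_zero,
    neg_neg]
  ring

lemma sobelV_reflY (hΩ : MeasurableSet Ω) :
    sobelV (unitArea (reflY ⁻¹' Ω)) 0 = -sobelV (unitArea Ω) 0 := by
  simp only [sobelV, Prod.fst_zero, Prod.snd_zero, zero_add, zero_sub, unitArea_reflY hΩ, neg_neg]
  ring

lemma sobelH_swap (hΩ : MeasurableSet Ω) :
    sobelH (unitArea (Prod.swap ⁻¹' Ω)) 0 = sobelV (unitArea Ω) 0 := by
  simp only [sobelH, sobelV, Prod.fst_zero, Prod.snd_zero, zero_add, zero_sub, unitArea_swap hΩ]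

lemma sobelV_swap (hΩ : MeasurableSet Ω) :
    sobelV (unitArea (Prod.swap ⁻¹' Ω)) 0 = sobelH (unitArea Ω) 0 := by
  simp only [sobelH, sobelV, Prod.fst_zero, Prod.snd_zero, zero_add, zero_sub, unitArea_swap hΩ]

lemma measurableSet_swap (hΩ : MeasurableSet Ω) : MeasurableSet (Prod.swap ⁻¹' Ω) :=
  measurePreserving_swap.measurable hΩ

lemma measurableSet_reflY (hΩ : MeasurableSet Ω) : MeasurableSet (reflY ⁻¹' Ω) :=
  measurePreserving_reflY.measurable hΩ

/-- Comparison in one diagonal gives `H < V`; in the other one, after a reflection that changes the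
sign of `V` only, `H < -V`. The reflection is about `y = 1/2`, so it costs one unit of `K`. -/
lemma abs_sobelV_lt_of_pos (hΩ : MeasurableSet Ω) (hw₀ : w₀ ∈ cell 1 0)
    (h : NearHalfPlane K ε Ω w₀ n) (hK : 3 ≤ K) (hδ : 0 < δ) (hδ1 : δ ≤ 1) (hε : 0 < ε)
    (hεδ : ε ≤ δ ^ 2 / 100) (hn : 1 ≤ n.1 ^ 2 + n.2 ^ 2) (hdir : (1 + δ) * |n.2| ≤ n.1) :
    |sobelV (unitArea Ω) 0| < |sobelH (unitArea Ω) 0| := by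
  have h1 := sobelH_lt_sobelV hΩ hw₀ h (by linarith) hδ hδ1 hε hεδ hn hdir
  have h2 := sobelH_lt_sobelV (measurableSet_reflY hΩ) (reflY_mem_unitCell hw₀)
    (h.reflY (K' := 2) (by linarith)) le_rfl hδ hδ1 hε hεδ (by simpa using hn) (by simpa using hdir)
  rw [sobelH_reflY hΩ, sobelV_reflY hΩ] at h2
  have h3 : sobelH (unitArea Ω) 0 < 0 := by linarith
  rw [abs_of_neg h3, abs_lt]
  constructor <;> linarith

lemma abs_sobelV_lt (hΩ : MeasurableSet Ω) (hw₀ : w₀ ∈ cell 1 0)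
    (h : NearHalfPlane K ε Ω w₀ n) (hK : 4 ≤ K) (hδ : 0 < δ) (hδ1 : δ ≤ 1) (hε : 0 < ε)
    (hεδ : ε ≤ δ ^ 2 / 100) (hn : 1 ≤ n.1 ^ 2 + n.2 ^ 2) (hdir : (1 + δ) * |n.2| ≤ |n.1|) :
    |sobelV (unitArea Ω) 0| < |sobelH (unitArea Ω) 0| := by
  rcases le_total 0 n.1 with hpos | hneg
  · exact abs_sobelV_lt_of_pos hΩ hw₀ h (by linarith) hδ hδ1 hε hεδ hn
      (by rwa [abs_of_nonneg hpos] at hdir)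
  -- The reflection in `x`, written as `reflY` conjugated by the swap, reduces this case to a
  -- positive first component.
  · have hs := measurableSet_swap hΩ
    have hr := measurableSet_reflY hs
    have h1 := abs_sobelV_lt_of_pos (measurableSet_swap hr)
      (swap_mem_unitCell (reflY_mem_unitCell (swap_mem_unitCell hw₀)))
      (h.swap.reflY (K' := 3) (by linarith)).swap le_rfl hδ hδ1 hε hεδ
      (by simp only [Prod.fst_swap, Prod.snd_swap, neg_sq]; exact hn)
      (by simp only [Prod.fst_swap, Prod.snd_swap]; rwa [abs_of_nonpos hneg] at hdir)
    rw [sobelV_swap hr, sobelH_swap hr, sobelV_reflY hs, sobelH_reflY hs, sobelV_swap hΩ,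
      sobelH_swap hΩ, abs_neg] at h1
    exact h1

lemma sobelV_pos (hΩ : MeasurableSet Ω) (hw₀ : w₀ ∈ cell 1 0)
    (h : NearHalfPlane K ε Ω w₀ n) (hK : 3 ≤ K)
    (hε : ε ≤ 1 / 100) (hn : 1 ≤ n.1 ^ 2 + n.2 ^ 2) (hn2 : n.2 < 0) (hdir : |n.1| ≤ -2 * n.2) :
    0 < sobelV (unitArea Ω) 0 := by
  have := sobelV_neg (measurableSet_reflY hΩ) (reflY_mem_unitCell hw₀)
    (h.reflY (K' := 2) (by linarith)) le_rfl hε (by simpa using hn) (by simpa using hn2)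
    (by simp only; linarith)
  rw [sobelV_reflY hΩ] at this
  linarith

/-- When the gradient test prefers the vertical direction, then so does the normal, up to a small
tolerance, with the same sign. -/
lemma normal_of_abs_sobelH_le (hΩ : MeasurableSet Ω) (hw₀ : w₀ ∈ cell 1 0)
    (h : NearHalfPlane K ε Ω w₀ n) (hK : 4 ≤ K) (hδ : 0 < δ) (hδ1 : δ ≤ 1) (hε : 0 < ε)
    (hεδ : ε ≤ δ ^ 2 / 100) (hn : 1 ≤ n.1 ^ 2 + n.2 ^ 2)
    (hHV : |sobelH (unitArea Ω) 0| ≤ |sobelV (unitArea Ω) 0|) :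
    (sobelV (unitArea Ω) 0 ≤ 0 → 0 < n.2 ∧ |n.1| ≤ (1 + δ) * n.2) ∧
    (0 ≤ sobelV (unitArea Ω) 0 → 0 < -n.2 ∧ |n.1| ≤ (1 + δ) * -n.2) := by
  have hε' : ε ≤ 1 / 100 := by nlinarith
  have hdir : |n.1| < (1 + δ) * |n.2| := by
    by_contra! hcon
    exact (abs_sobelV_lt hΩ hw₀ h hK hδ hδ1 hε hεδ hn hcon).not_ge hHV
  have hne : n.2 ≠ 0 := by
    intro h0
    rw [h0, abs_zero, mul_zero] at hdir
    exact (abs_nonneg _).not_gt hdir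
  rcases lt_or_gt_of_ne hne with hneg | hpos
  · rw [abs_of_neg hneg] at hdir
    have := sobelV_pos hΩ hw₀ h (by linarith) hε' hn hneg (by nlinarith)
    exact ⟨fun hle => absurd hle this.not_ge, fun _ => ⟨by linarith, hdir.le⟩⟩
  · rw [abs_of_pos hpos] at hdir
    have := sobelV_neg hΩ hw₀ h (by linarith) hε' hn hpos (by nlinarith)
    exact ⟨fun _ => ⟨hpos, hdir.le⟩, fun hle => absurd hle this.not_ge⟩

/-- The selected orientation brings the normal close to the upper quarter of directions. -/
lemma normal_toStdPoint (hΩ : MeasurableSet Ω) (hw₀ : w₀ ∈ cell 1 0)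
    (h : NearHalfPlane K ε Ω w₀ n) (hK : 4 ≤ K) (hδ : 0 < δ) (hδ1 : δ ≤ 1) (hε : 0 < ε)
    (hεδ : ε ≤ δ ^ 2 / 100) (hn : 1 ≤ n.1 ^ 2 + n.2 ^ 2) :
    0 < ((orientation (unitArea Ω) 0).toStdPoint n).2 ∧
      |((orientation (unitArea Ω) 0).toStdPoint n).1|
        ≤ (1 + δ) * ((orientation (unitArea Ω) 0).toStdPoint n).2 := by
  unfold orientation
  split_ifs with h1 h2 h2
  · exact (normal_of_abs_sobelH_le hΩ hw₀ h hK hδ hδ1 hε hεδ hn h1).1 h2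
  · exact (normal_of_abs_sobelH_le hΩ hw₀ h hK hδ hδ1 hε hεδ hn h1).2 (not_le.1 h2).le
  all_goals
    have h3 := normal_of_abs_sobelH_le (measurableSet_swap hΩ) (swap_mem_unitCell hw₀) h.swap hK hδ
      hδ1 hε hεδ (by simpa [add_comm] using hn)
      (by rw [sobelV_swap hΩ, sobelH_swap hΩ]; exact (not_le.1 h1).le)
    rw [sobelV_swap hΩ] at h3
  · exact h3.1 h2
  · exact h3.2 (not_le.1 h2).le

end Sobel

/-! ### Changes of variables -/

namespace Orientation

/-- The inverse of `toStdPoint`. -/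
def fromStdPoint : Orientation → ℝ × ℝ → ℝ × ℝ
  | subY, z => z
  | epiY, z => (z.1, -z.2)
  | subX, z => (z.2, z.1)
  | epiX, z => (-z.2, z.1)

lemma toStdPoint_fromStdPoint (o : Orientation) (z : ℝ × ℝ) :
    o.toStdPoint (o.fromStdPoint z) = z := by
  cases o <;> simp [toStdPoint, fromStdPoint]

lemma fromStdPoint_toStdPoint (o : Orientation) (z : ℝ × ℝ) :
    o.fromStdPoint (o.toStdPoint z) = z := by
  cases o <;> simp [toStdPoint, fromStdPoint]

lemma fromStdCell_toStdCell (o : Orientation) (T : ℤ × ℤ) :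
    o.fromStdCell (o.toStdCell T) = T := by
  cases o <;> simp [toStdCell, fromStdCell]

lemma fromStdPoint_add (o : Orientation) (z w : ℝ × ℝ) :
    o.fromStdPoint (z + w) = o.fromStdPoint z + o.fromStdPoint w := by
  cases o <;> ext <;> simp [fromStdPoint] <;> ring

lemma dot_fromStdPoint (o : Orientation) (v e : ℝ × ℝ) :
    dot (o.fromStdPoint v) e = dot v (o.toStdPoint e) := by
  cases o <;> simp only [dot, toStdPoint, fromStdPoint] <;> ring

lemma abs_fromStdPoint_le (o : Orientation) {v : ℝ × ℝ} {τ : ℝ} (h1 : |v.1| ≤ τ)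
    (h2 : |v.2| ≤ τ) : |(o.fromStdPoint v).1| ≤ τ ∧ |(o.fromStdPoint v).2| ≤ τ := by
  cases o <;> simp [fromStdPoint, h1, h2]

lemma normal_toStdPoint (o : Orientation) (e₁ e₂ : ℝ × ℝ) (c : ℕ → ℝ) :
    normal (o.toStdPoint e₁) (o.toStdPoint e₂) c = o.toStdPoint (normal e₁ e₂ c) := by
  cases o <;> ext <;> simp [normal, toStdPoint] <;> ring

lemma isOrthonormalPair_toStdPoint (o : Orientation) {e₁ e₂ : ℝ × ℝ}
    (h : IsOrthonormalPair e₁ e₂) : IsOrthonormalPair (o.toStdPoint e₁) (o.toStdPoint e₂) := by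
  obtain ⟨h1, h2, h3⟩ := h
  cases o <;> refine ⟨?_, ?_, ?_⟩ <;> simp only [toStdPoint, neg_sq, neg_mul_neg] <;> linarith

lemma measurePreserving_fromStdPoint (o : Orientation) : MeasurePreserving o.fromStdPoint := by
  have hneg : MeasurePreserving (fun z : ℝ × ℝ => (-z.1, z.2)) :=
    (Measure.measurePreserving_neg volume).prod (MeasurePreserving.id volume)
  cases o
  · exact MeasurePreserving.id volume
  · exact (MeasurePreserving.id volume).prod (Measure.measurePreserving_neg volume)
  · exact measurePreserving_swap
  · exact hneg.comp measurePreserving_swap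

lemma fromStdPoint_preimage_cell (o : Orientation) (h : ℝ) (T : ℤ × ℤ) :
    o.fromStdPoint ⁻¹' cell h (o.fromStdCell T) = cell h T := by
  cases o
  · rfl
  all_goals
    ext z
    simp only [mem_preimage, cell, fromStdPoint, fromStdCell, mem_prod, mem_Icc]
    push_cast
  · constructor <;> rintro ⟨h1, h2, h3⟩ <;> exact ⟨h1, by linarith, by linarith⟩
  · tauto
  · constructor
    · rintro ⟨⟨h1, h2⟩, h3⟩; exact ⟨h3, by linarith, by linarith⟩
    · rintro ⟨h1, h2, h3⟩; exact ⟨⟨by linarith, by linarith⟩, h1⟩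

lemma toStdPoint_mem_cell (o : Orientation) {h : ℝ} {T : ℤ × ℤ} {z : ℝ × ℝ} (hz : z ∈ cell h T) :
    o.toStdPoint z ∈ cell h (o.toStdCell T) := by
  rw [← o.fromStdPoint_preimage_cell, mem_preimage, fromStdPoint_toStdPoint,
    fromStdCell_toStdCell]
  exact hz

end Orientation

lemma BoundaryExpansion.toStd {n : ℕ} {M A r ρ : ℝ} {Ω : Set (ℝ × ℝ)} {z₀ e₁ e₂ : ℝ × ℝ}
    {c : ℕ → ℝ} (H : BoundaryExpansion n M A r ρ Ω z₀ e₁ e₂ c) (o : Orientation) :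
    BoundaryExpansion n M A r ρ (o.fromStdPoint ⁻¹' Ω) (o.toStdPoint z₀) (o.toStdPoint e₁)
      (o.toStdPoint e₂) c where
  orthonormal := o.isOrthonormalPair_toStdPoint H.orthonormal
  abs_coeff_le := H.abs_coeff_le
  coeff_zero := H.coeff_zero
  approx τ hτ v h1 h2 := by
    have hv := o.abs_fromStdPoint_le h1 h2
    have := H.approx τ hτ (o.fromStdPoint v) hv.1 hv.2
    rw [mem_preimage, o.fromStdPoint_add, o.fromStdPoint_toStdPoint, ← o.dot_fromStdPoint,
      ← o.dot_fromStdPoint]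
    exact this

/-- The change of variables that sends the unit square to the cell `T` of the mesh of size `h`. -/
def zoomMap (h : ℝ) (T : ℤ × ℤ) (w : ℝ × ℝ) : ℝ × ℝ := (h * (w.1 + T.1), h * (w.2 + T.2))

lemma zoom_eq_preimage (h : ℝ) (T : ℤ × ℤ) (Ω : Set (ℝ × ℝ)) : zoom h T Ω = zoomMap h T ⁻¹' Ω := rfl

lemma continuous_zoomMap (h : ℝ) (T : ℤ × ℤ) : Continuous (zoomMap h T) := by
  unfold zoomMap; fun_prop

lemma volume_zoom {h : ℝ} (hh : 0 < h) (T : ℤ × ℤ) (E : Set (ℝ × ℝ)) :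
    volume E = ENNReal.ofReal (h ^ 2) * volume (zoom h T E) := by
  have h1 : zoom h T E = (fun w : ℝ × ℝ => w + ((T.1 : ℝ), (T.2 : ℝ))) ⁻¹' ((h • ·) ⁻¹' E) := rfl
  rw [h1, measure_preimage_add_right, Measure.addHaar_preimage_smul volume hh.ne', ← mul_assoc,
    ← ENNReal.ofReal_mul (by positivity)]
  have h2 : Module.finrank ℝ (ℝ × ℝ) = 2 := by simp
  rw [h2, abs_of_pos (by positivity), mul_inv_cancel₀ (by positivity), ENNReal.ofReal_one, one_mul]

lemma zoom_cell {h : ℝ} (hh : 0 < h) (T T' : ℤ × ℤ) : zoom h T (cell h (T + T')) = cell 1 T' := by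
  ext z
  simp only [zoom_eq_preimage, mem_preimage, zoomMap, cell, mem_prod, mem_Icc, Prod.fst_add,
    Prod.snd_add]
  push_cast
  have e1 : ∀ x a b : ℝ, (a + b) * h ≤ h * (x + a) ↔ b * 1 ≤ x := fun x a b => by
    rw [mul_comm h, mul_le_mul_iff_left₀ hh]; constructor <;> intro <;> linarith
  have e2 : ∀ x a b : ℝ, h * (x + a) ≤ (a + b + 1) * h ↔ x ≤ (b + 1) * 1 := fun x a b => by
    rw [mul_comm h, mul_le_mul_iff_left₀ hh]; constructor <;> intro <;> linarith
  rw [e1, e1, e2, e2]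

lemma exists_zoom_point {h : ℝ} (hh : 0 < h) {T : ℤ × ℤ} {z : ℝ × ℝ} (hz : z ∈ cell h T) :
    ∃ w ∈ cell 1 0, z = (h * (w.1 + T.1), h * (w.2 + T.2)) := by
  have hz' : z = zoomMap h T (z.1 / h - T.1, z.2 / h - T.2) := by
    ext <;> simp only [zoomMap] <;> field_simp <;> ring
  refine ⟨(z.1 / h - T.1, z.2 / h - T.2), ?_, hz'⟩
  rw [← zoom_cell hh T 0, add_zero, zoom_eq_preimage, mem_preimage, ← hz']
  exact hz

/-- `Ω` in the coordinates where the selected form is the standard one and the cell `T` is the unit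
square. -/
def stdZoom (h : ℝ) (o : Orientation) (T : ℤ × ℤ) (Ω : Set (ℝ × ℝ)) : Set (ℝ × ℝ) :=
  zoom h T (o.fromStdPoint ⁻¹' Ω)

lemma measurableSet_stdZoom (h : ℝ) (o : Orientation) (T : ℤ × ℤ) {Ω : Set (ℝ × ℝ)}
    (hΩ : MeasurableSet Ω) : MeasurableSet (stdZoom h o T Ω) :=
  (continuous_zoomMap h T).measurable (o.measurePreserving_fromStdPoint.measurable hΩ)

lemma volume_stdZoom {h : ℝ} (hh : 0 < h) (o : Orientation) (T : ℤ × ℤ) {E : Set (ℝ × ℝ)}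
    (hE : MeasurableSet E) : volume E = ENNReal.ofReal (h ^ 2) * volume (stdZoom h o T E) := by
  rw [stdZoom, ← volume_zoom hh,
    o.measurePreserving_fromStdPoint.measure_preimage hE.nullMeasurableSet]

lemma stdZoom_cell {h : ℝ} (hh : 0 < h) (o : Orientation) (T T' : ℤ × ℤ) :
    stdZoom h o T (cell h (o.fromStdCell (T + T'))) = cell 1 T' := by
  rw [stdZoom, o.fromStdPoint_preimage_cell, zoom_cell hh]

lemma cellAverages_chi {h : ℝ} (hh : 0 < h) {Ω : Set (ℝ × ℝ)} (hΩ : MeasurableSet Ω)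
    (T : ℤ × ℤ) : cellAverages h (chi Ω) T = (h ^ 2)⁻¹ * volume.real (cell h T ∩ Ω) := by
  rw [cellAverages, setAverage_eq, chi, integral_indicator_one hΩ, measureReal_restrict_apply hΩ,
    Measure.real, volume_cell hh.le, ENNReal.toReal_ofReal (by positivity), smul_eq_mul,
    inter_comm]

lemma cellAverages_fromStdCell {h : ℝ} (hh : 0 < h) {Ω : Set (ℝ × ℝ)} (hΩ : MeasurableSet Ω)
    (o : Orientation) (T T' : ℤ × ℤ) :
    cellAverages h (chi Ω) (o.fromStdCell (T + T')) = unitArea (stdZoom h o T Ω) T' := by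
  rw [cellAverages_chi hh hΩ, Measure.real,
    volume_stdZoom hh o T ((measurableSet_cell _ _).inter hΩ), ENNReal.toReal_mul,
    ENNReal.toReal_ofReal (by positivity), ← mul_assoc, inv_mul_cancel₀ (by positivity), one_mul]
  have : stdZoom h o T (cell h (o.fromStdCell (T + T')) ∩ Ω)
      = stdZoom h o T (cell h (o.fromStdCell (T + T'))) ∩ stdZoom h o T Ω := rfl
  rw [this, stdZoom_cell hh, unitArea, Measure.real]

lemma orientation_cellAverages {h : ℝ} (hh : 0 < h) {Ω : Set (ℝ × ℝ)} (hΩ : MeasurableSet Ω)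
    (T : ℤ × ℤ) :
    orientation (cellAverages h (chi Ω)) T = orientation (unitArea (zoom h T Ω)) 0 := by
  have key : ∀ i j : ℤ, cellAverages h (chi Ω) (T.1 + i, T.2 + j) = unitArea (zoom h T Ω) (i, j) :=
    fun i j => cellAverages_fromStdCell hh hΩ Orientation.subY T (i, j)
  have k0 : ∀ i : ℤ, cellAverages h (chi Ω) (T.1 + i, T.2) = unitArea (zoom h T Ω) (i, 0) :=
    fun i => by simpa using key i 0
  have k0' : ∀ j : ℤ, cellAverages h (chi Ω) (T.1, T.2 + j) = unitArea (zoom h T Ω) (0, j) :=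
    fun j => by simpa using key 0 j
  have hH : sobelH (cellAverages h (chi Ω)) T = sobelH (unitArea (zoom h T Ω)) 0 := by
    simp only [sobelH, sub_eq_add_neg, key, k0, Prod.fst_zero, Prod.snd_zero, zero_add]
  have hV : sobelV (cellAverages h (chi Ω)) T = sobelV (unitArea (zoom h T Ω)) 0 := by
    simp only [sobelV, sub_eq_add_neg, key, k0', Prod.fst_zero, Prod.snd_zero, zero_add]
  rw [orientation, orientation, hH, hV]

/-- The cell is connected, and off the frontier it would be split by the open sets `interior Ω` and
`Ωᶜ`, both of which it meets. -/
lemma IsSingular.exists_mem_frontier {h : ℝ} {Ω : Set (ℝ × ℝ)} (hΩ : IsClosed Ω) {T : ℤ × ℤ}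
    (hT : IsSingular h Ω T) : ∃ z ∈ cell h T, z ∈ frontier Ω := by
  obtain ⟨x, hx⟩ := nonempty_of_measure_ne_zero hT.1
  have hy := nonempty_of_measure_ne_zero hT.2
  by_contra! hcon
  have hpre : IsPreconnected (cell h T) := ((convex_Icc _ _).prod (convex_Icc _ _)).isPreconnected
  have hint : ∀ z ∈ cell h T, z ∈ Ω → z ∈ interior Ω := by
    intro z hz hzΩ
    by_contra hzi
    exact hcon z hz ⟨subset_closure hzΩ, hzi⟩
  obtain ⟨z, -, hz1, hz2⟩ := hpre (interior Ω) Ωᶜ isOpen_interior hΩ.isOpen_compl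
    (fun z hz => by
      by_cases hzΩ : z ∈ Ω
      · exact Or.inl (hint z hz hzΩ)
      · exact Or.inr hzΩ) ⟨x, hx.1, hint x hx.1 hx.2⟩ hy
  exact hz2 (interior_subset hz1)

lemma eLpNorm_chi_sub_chi {Ω E : Set (ℝ × ℝ)} (hΩ : MeasurableSet Ω) (hE : MeasurableSet E)
    (F : Set (ℝ × ℝ)) :
    eLpNorm (fun z => chi Ω z - chi E z) 1 (volume.restrict F)
      = volume (F ∩ {z | ¬ (z ∈ Ω ↔ z ∈ E)}) := by
  have hm : MeasurableSet {z | ¬ (z ∈ Ω ↔ z ∈ E)} := by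
    have : {z | ¬ (z ∈ Ω ↔ z ∈ E)} = (Ω \ E) ∪ (E \ Ω) := by
      ext z; simp only [mem_ofPred_eq, mem_union, mem_sdiff]; tauto
    rw [this]
    exact (hΩ.diff hE).union (hE.diff hΩ)
  rw [eLpNorm_one_eq_lintegral_enorm, inter_comm, ← Measure.restrict_apply hm,
    ← lintegral_indicator_one hm]
  refine lintegral_congr fun z => ?_
  by_cases h1 : z ∈ Ω <;> by_cases h2 : z ∈ E <;> simp [chi, h1, h2, indicator]

/-! ### The error on a singular cell -/

lemma volume_eq_zero_of_unitArea_eq_zero {Ω : Set (ℝ × ℝ)} {T : ℤ × ℤ} (h : unitArea Ω T = 0) :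
    volume (cell 1 T ∩ Ω) = 0 :=
  (ENNReal.toReal_eq_zero_iff _).1 h |>.resolve_right (volume_cell_inter_ne_top _ _ _)

lemma volume_compl_eq_zero_of_unitArea_eq_one {Ω : Set (ℝ × ℝ)} (hΩ : MeasurableSet Ω) {T : ℤ × ℤ}
    (h : unitArea Ω T = 1) : volume (cell 1 T ∩ Ωᶜ) = 0 := by
  have h1 := measureReal_inter_add_sdiff (μ := volume) (s := cell 1 T) hΩ
    (isCompact_cell 1 T).measure_lt_top.ne
  rw [← unitArea, h, Measure.real, Measure.real, volume_cell zero_le_one,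
    ENNReal.toReal_ofReal (by norm_num)] at h1
  have h2 : (volume (cell 1 T \ Ω)).toReal = 0 := by linarith
  rw [← sdiff_eq]
  exact ((ENNReal.toReal_eq_zero_iff _).1 h2).resolve_right
    (measure_ne_top_of_subset sdiff_subset (isCompact_cell 1 T).measure_lt_top.ne)

lemma unitArea_eq_one_of_subset {Ω : Set (ℝ × ℝ)} {T : ℤ × ℤ} (h : cell 1 T ⊆ Ω) :
    unitArea Ω T = 1 := by
  rw [unitArea, inter_eq_left.2 h, Measure.real, volume_cell zero_le_one]
  simp

lemma unitArea_eq_zero_of_disjoint {Ω : Set (ℝ × ℝ)} {T : ℤ × ℤ} (h : ∀ z ∈ cell 1 T, z ∉ Ω) :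
    unitArea Ω T = 0 := by
  have : cell 1 T ∩ Ω = ∅ := by
    ext z; simpa using h z
  rw [unitArea, this, measureReal_empty]

/-- Rows of cells that are far enough below or above the boundary are full or empty. -/
lemma NearHalfPlane.unitArea_row {K ε σ x : ℝ} {Ω : Set (ℝ × ℝ)} {w₀ n : ℝ × ℝ}
    (h : NearHalfPlane K ε Ω w₀ n) (hw₀ : w₀ ∈ cell 1 0) (hε : ε < n.2 / 2) (hn : 0 < n.2)
    (hdir : |n.1| ≤ σ * n.2) {i : ℤ} {l : ℕ} (hi : -x ≤ (i : ℝ)) (hi' : (i : ℝ) + 1 ≤ x + 1)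
    (hl : σ * (x + 1) + 1 / 2 ≤ l) (hKx : x + 1 ≤ K) (hKl : (l : ℝ) + 2 ≤ K) :
    unitArea Ω (i, -(l : ℤ) - 1) = 1 ∧ unitArea Ω (i, (l : ℤ) + 1) = 0 := by
  obtain ⟨⟨hx0, hx1⟩, hy0, hy1⟩ := mem_cell_one.1 hw₀
  simp only [Prod.fst_zero, Prod.snd_zero, Int.cast_zero, zero_add] at hx0 hx1 hy0 hy1
  have hl0 : (0 : ℝ) ≤ l := l.cast_nonneg
  have hhor : ∀ z : ℝ × ℝ, (i : ℝ) ≤ z.1 → z.1 ≤ i + 1 →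
      |n.1 * (z.1 - w₀.1)| ≤ n.2 * (σ * (x + 1)) := by
    intro z h1 h2
    rw [abs_mul]
    calc |n.1| * |z.1 - w₀.1| ≤ (σ * n.2) * (x + 1) := by
          refine mul_le_mul hdir (abs_le.2 ⟨by linarith, by linarith⟩) (abs_nonneg _)
            ((abs_nonneg _).trans hdir)
      _ = _ := by ring
  have hl' := mul_le_mul_of_nonneg_left hl hn.le
  constructor
  · refine unitArea_eq_one_of_subset fun z hz => ?_
    obtain ⟨⟨h1, h2⟩, h3, h4⟩ := mem_cell_one.1 hz
    push_cast at h1 h2 h3 h4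
    by_contra hm
    have h5 := (h z (abs_le.2 ⟨by linarith, by linarith⟩)
      (abs_le.2 ⟨by linarith, by linarith⟩)).2 hm
    have h6 := abs_le.1 (hhor z h1 h2)
    have h7 : n.2 * (z.2 - w₀.2) ≤ n.2 * (-l) := mul_le_mul_of_nonneg_left (by linarith) hn.le
    simp only [dot, Prod.fst_sub, Prod.snd_sub] at h5
    linarith
  · refine unitArea_eq_zero_of_disjoint fun z hz hm => ?_
    obtain ⟨⟨h1, h2⟩, h3, h4⟩ := mem_cell_one.1 hz
    push_cast at h1 h2 h3 h4
    have h5 := (h z (abs_le.2 ⟨by linarith, by linarith⟩)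
      (abs_le.2 ⟨by linarith, by linarith⟩)).1 hm
    have h6 := abs_le.1 (hhor z h1 h2)
    have h7 : n.2 * l ≤ n.2 * (z.2 - w₀.2) := mul_le_mul_of_nonneg_left (by linarith) hn.le
    simp only [dot, Prod.fst_sub, Prod.snd_sub] at h5
    linarith

/-- Every stencil that the method may use reaches full cells below and empty cells above. -/
lemma stencil_spec {k : ℕ} {a : ℤ × ℤ → ℝ} {T : ℤ × ℤ} {S : Stencil} {K ε : ℝ}
    {Ω : Set (ℝ × ℝ)} {w₀ n : ℝ × ℝ} (ha : ∀ i j, a (T.1 + i, T.2 + j) = unitArea Ω (i, j))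
    (h : NearHalfPlane K ε Ω w₀ n) (hw₀ : w₀ ∈ cell 1 0) (hε : ε < n.2 / 2) (hn : 0 < n.2)
    (hdir : |n.1| ≤ (1 + 1 / (2 * (k + 1))) * n.2) (hK : 6 * (k : ℝ) + 6 ≤ K)
    (hS : IsFixedStencil k S ∨ IsAdaptiveStencil k a T S) :
    S.km + S.kp = 2 * k ∧ S.lm ≤ 4 * k + 4 ∧ S.lp ≤ 4 * k + 4 ∧
    ∀ i : ℤ, -(S.km : ℤ) ≤ i → i ≤ S.kp →
      unitArea Ω (i, -(S.lm : ℤ) - 1) = 1 ∧ unitArea Ω (i, (S.lp : ℤ) + 1) = 0 := by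
  have hk0 : (0 : ℝ) ≤ k := k.cast_nonneg
  rcases hS with ⟨h1, h2, h3, h4⟩ | ⟨hw, hlow, hup⟩
  · refine ⟨by omega, by omega, by omega, fun i hi hi' => ?_⟩
    rw [h1] at hi
    rw [h2] at hi'
    rw [h3, h4]
    have hir : -(k : ℝ) ≤ i := by exact_mod_cast hi
    have hir' : (i : ℝ) ≤ k := by exact_mod_cast hi'
    refine h.unitArea_row hw₀ hε hn hdir hir (by linarith) ?_ (by linarith)
      (by push_cast; linarith)
    -- The slope times the horizontal reach `k + 1` is `k + 3/2`; the further `1/2` required for the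
    -- tolerance `ε` gives exactly the half-height `k + 2`.
    have : (1 + 1 / (2 * ((k : ℝ) + 1))) * (k + 1) = k + 1 + 1 / 2 := by field_simp
    rw [this]
    push_cast
    linarith
  -- An uncentered stencil may extend `2k` columns to one side, and for it slope `2` suffices: `2
  -- (2k + 1) + 1/2 ≤ 4k + 4`.
  · have hdir' : |n.1| ≤ 2 * n.2 := by
      refine hdir.trans (mul_le_mul_of_nonneg_right ?_ hn.le)
      have : 1 / (2 * ((k : ℝ) + 1)) ≤ 1 := by
        rw [div_le_one (by positivity)]; linarith
      linarith
    have hrow : ∀ i : ℤ, -(S.km : ℤ) ≤ i → i ≤ S.kp →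
        unitArea Ω (i, -((4 * k + 4 : ℕ) : ℤ) - 1) = 1 ∧
        unitArea Ω (i, ((4 * k + 4 : ℕ) : ℤ) + 1) = 0 := by
      intro i hi hi'
      have hir : -(2 * k : ℝ) ≤ i := by exact_mod_cast (show -(2 * k : ℤ) ≤ i by omega)
      have hir' : (i : ℝ) ≤ 2 * k := by exact_mod_cast (show i ≤ (2 * k : ℤ) by omega)
      exact h.unitArea_row hw₀ hε hn hdir' hir (by linarith)
        (by push_cast; linarith) (by linarith) (by push_cast; linarith)
    have hla : ∀ l : ℕ, ∀ i : ℤ, a (i, T.2 - l - 1) = unitArea Ω (i - T.1, -(l : ℤ) - 1) := by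
      intro l i
      rw [← ha]; congr 2 <;> ring
    have hua : ∀ l : ℕ, ∀ i : ℤ, a (i, T.2 + l + 1) = unitArea Ω (i - T.1, (l : ℤ) + 1) := by
      intro l i
      rw [← ha]; congr 2 <;> ring
    have hmemlow : 4 * k + 4 ∈ lowerShifts a T S.km S.kp := by
      refine ⟨by omega, fun i hi => ?_⟩
      rw [hla]
      exact (hrow _ (by have := hi.1; omega) (by have := hi.2; omega)).1
    have hmemup : 4 * k + 4 ∈ upperShifts a T S.km S.kp := by
      refine ⟨by omega, fun i hi => ?_⟩
      rw [hua]
      exact (hrow _ (by have := hi.1; omega) (by have := hi.2; omega)).2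
    -- The shift `4k + 4` is admissible, so the least one exists, is no larger, and reaches the
    -- required row by definition.
    have hL := hlow ⟨_, hmemlow⟩
    have hU := hup ⟨_, hmemup⟩
    refine ⟨hw, hL.2 hmemlow, hU.2 hmemup, fun i hi hi' => ⟨?_, ?_⟩⟩
    · have := hL.1.2 (T.1 + i) ⟨by omega, by omega⟩
      rwa [hla, add_sub_cancel_left] at this
    · have := hU.1.2 (T.1 + i) ⟨by omega, by omega⟩
      rwa [hua, add_sub_cancel_left] at this

lemma sum_Icc_int (c : ℤ) (N : ℕ) (f : ℤ → ℝ) :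
    ∑ j ∈ Finset.Icc c (c + N), f j = ∑ i ∈ Finset.range (N + 1), f (c + i) := by
  symm
  refine Finset.sum_nbij' (fun i : ℕ => c + (i : ℤ)) (fun j : ℤ => (j - c).toNat) ?_ ?_ ?_ ?_ ?_
  · intro i hi
    have := Finset.mem_range.1 hi
    rw [Finset.mem_Icc]; omega
  · intro j hj
    rw [Finset.mem_Icc] at hj
    rw [Finset.mem_range]; omega
  · intro i _; simp
  · intro j hj
    rw [Finset.mem_Icc] at hj
    omega
  · intro i _; rfl

/-- The averages of the interpolant, in the coordinates where `T` is the unit square. -/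
lemma integral_rescale_interpolant {k : ℕ} {h : ℝ} (hh : 0 < h) {a : ℤ × ℤ → ℝ} {T : ℤ × ℤ}
    {S : Stencil} {Ω : Set (ℝ × ℝ)} (ha : ∀ i j, a (T.1 + i, T.2 + j) = unitArea Ω (i, j))
    (hS : S.km + S.kp = 2 * k) {i : ℤ} (hi : -(S.km : ℤ) ≤ i) (hi' : i ≤ S.kp) :
    ∫ x in (i : ℝ)..(i + 1), (rescale h T (interpolant k h a T S)).eval x
      = (∑ j ∈ Finset.range (S.lm + S.lp + 1), unitArea Ω (i, -(S.lm : ℤ) + j)) - S.lm := by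
  have hspec := (interpolant_spec k hh a T S hS).2 (T.1 + i) ⟨by omega, by omega⟩
  rw [integral_rescale hh, hspec, columnAverage]
  have h1 := sum_Icc_int (T.2 - S.lm) (S.lm + S.lp) (fun j => a (T.1 + i, j))
  rw [show T.2 - (S.lm : ℤ) + ((S.lm + S.lp : ℕ) : ℤ) = T.2 + S.lp by push_cast; ring] at h1
  rw [h1]
  have h2 : ∀ j : ℕ, a (T.1 + i, T.2 - S.lm + j) = unitArea Ω (i, -(S.lm : ℤ) + j) := fun j => by
    rw [← ha, ← add_assoc, ← sub_eq_add_neg]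
  simp only [h2]
  field_simp
  ring

lemma zoom_subgraph {h : ℝ} (hh : 0 < h) (T : ℤ × ℤ) (p : ℝ[X]) :
    zoom h T (subgraph p.eval) = subgraph (rescale h T p).eval := by
  ext w
  simp only [zoom, subgraph, mem_ofPred_eq, rescale_eval]
  rw [le_sub_iff_add_le, inv_mul_eq_div, le_div_iff₀ hh, mul_comm]

/-- The set described by the local recovery. -/
lemma recovery_eq_chi (k : ℕ) (h : ℝ) (a : ℤ × ℤ → ℝ) (T : ℤ × ℤ) (S : Stencil) :
    recovery k h a T S = chi ((orientation a T).toStdPoint ⁻¹' subgraph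
      (interpolant k h (a ∘ (orientation a T).fromStdCell)
        ((orientation a T).toStdCell T) S).eval) := rfl

lemma measurable_toStdPoint (o : Orientation) : Measurable o.toStdPoint := by
  cases o <;> unfold Orientation.toStdPoint <;> fun_prop

lemma measurableSet_recoverySet (o : Orientation) (p : ℝ[X]) :
    MeasurableSet (o.toStdPoint ⁻¹' subgraph p.eval) :=
  measurable_toStdPoint o (isClosed_subgraph p.continuous).measurableSet

/-- The order of the method on a singular cell of a fine mesh. -/
lemma exists_local_const {s : ℝ} (hs : 1 < s) {k : ℕ} (hk : 1 ≤ k) {Ω : Set (ℝ × ℝ)}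
    (hΩ : IsCsDomain s Ω) : ∃ C h₀ : ℝ, 0 ≤ C ∧ 0 < h₀ ∧ ∀ h : ℝ, 0 < h → h ≤ h₀ →
      ∀ (T : ℤ × ℤ) (S : Stencil), IsSingular h Ω T →
        IsAerosStencil k (cellAverages h (chi Ω)) T S →
        eLpNorm (fun z => chi Ω z - recovery k h (cellAverages h (chi Ω)) T S z) 1
          (volume.restrict (cell h T)) ≤ ENNReal.ofReal (C * h ^ (min s (2 * k + 1) + 1)) := by
  have hcl := hΩ.isClosed
  have hm := hcl.measurableSet
  have hk1 : (1 : ℝ) ≤ k := by exact_mod_cast hk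
  obtain ⟨M, A, ρ, hM, hA, hρ, hexp⟩ := hΩ.exists_polyApprox hs.le (2 * k)
  push_cast at hexp
  set r := min s (2 * (k : ℝ) + 1) with hr
  have hr1 : 1 < r := lt_min hs (by linarith)
  -- The box must hold `2k` columns to a side, heights up to `4k + 4`, the row just outside the
  -- stencil and the extent of a cell.
  set K : ℝ := 6 * k + 6 with hK
  set δ : ℝ := 1 / (2 * (k + 1)) with hδ
  have hδ0 : 0 < δ := by positivity
  have hδ1 : δ ≤ 1 / 4 := by
    rw [hδ]; apply one_div_le_one_div_of_le (by norm_num); linarith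
  set ε : ℝ := δ ^ 2 / 100 with hε
  have hε0 : 0 < ε := by positivity
  have hε1 : ε ≤ 1 / 100 := by rw [hε]; nlinarith
  obtain ⟨h₁, hh₁, hHP⟩ := exists_nearHalfPlane (n := 2 * k) (by omega) hM.le hA hr1 hρ
    (show 0 ≤ K by positivity) hε0
  -- After orientation the normal has slope at most `2` and length at least `1`, hence vertical
  -- component at least `1/√5 > 1/3`.
  obtain ⟨h₂, B, hh₂, hB, hNG⟩ := exists_nearGraph (n := 2 * k) (K := K) (κ := 1 / 3) (r := r)
    (by omega) hM.le hA (by rw [hr]; push_cast; exact min_le_right _ _) hρ (by positivity)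
    (by norm_num)
  obtain ⟨C₀, hC₀, hrec⟩ := exists_recovery_const (2 * k) (4 * k + 4)
  refine ⟨C₀ * B, min h₁ h₂, by positivity, lt_min hh₁ hh₂, ?_⟩
  intro h hh hle T S hT hS
  obtain ⟨z₀, hz₀T, hz₀⟩ := hT.exists_mem_frontier hcl
  obtain ⟨e₁, e₂, c, horth, hcM, hc0, happ⟩ := hexp z₀ hz₀
  have H : BoundaryExpansion (2 * k) M A r ρ Ω z₀ e₁ e₂ c := ⟨horth, hcM, hc0, happ⟩
  obtain ⟨w₀, hw₀, hzw⟩ := exists_zoom_point hh hz₀T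
  have hHP₀ := hHP Ω z₀ e₁ e₂ c H h hh (hle.trans (min_le_left _ _)) T w₀ hw₀ hzw
  have horient := normal_toStdPoint (measurableSet_stdZoom h Orientation.subY T hm) hw₀ hHP₀
    (by linarith) hδ0 (by linarith) hε0 le_rfl (one_le_normal horth c)
  rw [show stdZoom h Orientation.subY T Ω = zoom h T Ω from rfl,
    ← orientation_cellAverages hh hm T] at horient
  rw [recovery_eq_chi]
  unfold IsAerosStencil at hS
  generalize orientation (cellAverages h (chi Ω)) T = o at horient hS ⊢
  set T' := o.toStdCell T with hT'
  set Ω' := stdZoom h o T' Ω with hΩ'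
  have hmΩ' : MeasurableSet Ω' := measurableSet_stdZoom h o T' hm
  have H' := H.toStd o
  obtain ⟨w₁, hw₁, hzw₁⟩ := exists_zoom_point hh (o.toStdPoint_mem_cell hz₀T)
  -- The half plane was first used in the original coordinates to find the orientation; it is now
  -- needed in the standard ones, for the stencil.
  have hHP₁ := hHP _ _ _ _ c H' h hh (hle.trans (min_le_left _ _)) T' w₁ hw₁ hzw₁
  have hnn := one_le_normal H'.orthonormal c
  have hnorm := o.normal_toStdPoint e₁ e₂ c
  rw [← hnorm] at horient
  set ν := normal (o.toStdPoint e₁) (o.toStdPoint e₂) c with hν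
  have hν2 : 1 / 3 ≤ ν.2 := by
    have h1 : |ν.1| ≤ 2 * ν.2 := horient.2.trans
      (mul_le_mul_of_nonneg_right (by linarith) horient.1.le)
    have h2 : ν.1 ^ 2 ≤ (2 * ν.2) ^ 2 := sq_le_sq' (by linarith [neg_abs_le ν.1])
      (by linarith [le_abs_self ν.1])
    nlinarith [horient.1]
  obtain ⟨p, hpd, hp⟩ := hNG _ _ _ _ c H' hν2 h hh (hle.trans (min_le_right _ _)) T' w₁ hw₁ hzw₁
  have ha : ∀ i j, (cellAverages h (chi Ω) ∘ o.fromStdCell) (T'.1 + i, T'.2 + j)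
      = unitArea Ω' (i, j) := fun i j => cellAverages_fromStdCell hh hm o T' (i, j)
  obtain ⟨hkk, hlm, hlp, hrows⟩ := stencil_spec ha hHP₁ hw₁ (by linarith) horient.1 horient.2
    le_rfl hS
  set q := interpolant k h (cellAverages h (chi Ω) ∘ o.fromStdCell) T' S with hq
  have hqd : (rescale h T' q).natDegree ≤ 2 * k :=
    (natDegree_rescale_le h T' q).trans (interpolant_spec k hh _ T' S hkk).1
  have herr := hrec S.km S.kp S.lm S.lp hkk hlm hlp K (by rw [hK]; push_cast; linarith) Ω' p
    (rescale h T' q) (B * h ^ (r - 1)) (by positivity) hp hpd hqd (fun i hi hi' =>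
      ⟨volume_eq_zero_of_unitArea_eq_zero (hrows i hi hi').2,
        volume_compl_eq_zero_of_unitArea_eq_one hmΩ' (hrows i hi hi').1,
        integral_rescale_interpolant hh ha hkk hi hi'⟩)
  have hmE := measurableSet_recoverySet o q
  rw [eLpNorm_chi_sub_chi hm hmE]
  have hmF : MeasurableSet (cell h T ∩ {z | ¬ (z ∈ Ω ↔ z ∈ o.toStdPoint ⁻¹' subgraph q.eval)}) := by
    refine (measurableSet_cell h T).inter ?_
    have : {z | ¬ (z ∈ Ω ↔ z ∈ o.toStdPoint ⁻¹' subgraph q.eval)}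
        = (Ω \ (o.toStdPoint ⁻¹' subgraph q.eval)) ∪ ((o.toStdPoint ⁻¹' subgraph q.eval) \ Ω) := by
      ext z; simp only [mem_ofPred_eq, mem_union, mem_sdiff]; tauto
    rw [this]
    exact (hm.diff hmE).union (hmE.diff hm)
  have hset : stdZoom h o T' (cell h T ∩ {z | ¬ (z ∈ Ω ↔ z ∈ o.toStdPoint ⁻¹' subgraph q.eval)})
      = cell 1 0 ∩ {z | ¬ (z ∈ Ω' ↔ z ∈ subgraph (rescale h T' q).eval)} := by
    have h1 : stdZoom h o T' (cell h T) = cell 1 0 := by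
      have := stdZoom_cell hh o T' 0
      rwa [add_zero, hT', o.fromStdCell_toStdCell] at this
    have h2 : stdZoom h o T' (o.toStdPoint ⁻¹' subgraph q.eval)
        = subgraph (rescale h T' q).eval := by
      rw [stdZoom, ← preimage_comp]
      have : o.toStdPoint ∘ o.fromStdPoint = id := funext o.toStdPoint_fromStdPoint
      rw [this, preimage_id, zoom_subgraph hh]
    rw [← h1, ← h2]
    rfl
  rw [volume_stdZoom hh o T' hmF, hset]
  calc ENNReal.ofReal (h ^ 2) * _
      ≤ ENNReal.ofReal (h ^ 2) * ENNReal.ofReal (C₀ * (B * h ^ (r - 1))) := by gcongr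
    _ = ENNReal.ofReal (C₀ * B * h ^ (r + 1)) := by
      rw [← ENNReal.ofReal_mul (by positivity)]
      congr 1
      rw [show r + 1 = (r - 1) + 2 by ring, Real.rpow_add hh, Real.rpow_two]
      ring

/-! ### Counting the singular cells -/

/-- A Lipschitz graph meets at most `O(1/h)` cells. -/
lemma IsChart.card_cells_le {s R P M : ℝ} {Ω : Set (ℝ × ℝ)} {z₀ e₁ e₂ : ℝ × ℝ} {ψ : ℝ → ℝ}
    (hc : IsChart s R P M Ω z₀ e₁ e₂ ψ) (hs : 1 ≤ s) (hR : 0 < R) (hP : 1 < P)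
    {h : ℝ} (hh : 0 < h) (hh1 : h ≤ 1) (G : Finset (ℤ × ℤ))
    (hG : ∀ T ∈ G, ∃ z ∈ cell h T, z ∈ frontier Ω ∧ |(z - z₀).1| ≤ R / 4 ∧ |(z - z₀).2| ≤ R / 4) :
    (G.card : ℝ) ≤ (2 * (⌈M⌉₊ + 2) + 1) ^ 2 * (R + 2) / h := by
  classical
  choose! z hzc hzf hz1 hz2 using hG
  obtain ⟨ha, hb, hc1, hd⟩ := hc.orthonormal.abs_coord_le
  have ht : ∀ T ∈ G, |dot (z T - z₀) e₁| ≤ R / 2 := fun T hT => by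
    have := abs_dot_le (hz1 T hT) (hz2 T hT) ha hb; linarith
  have ht2 : ∀ T ∈ G, |dot (z T - z₀) e₂| ≤ R / 2 := fun T hT => by
    have := abs_dot_le (hz1 T hT) (hz2 T hT) hc1 hd; linarith
  have hgraph : ∀ T ∈ G, dot (z T - z₀) e₂ = ψ (dot (z T - z₀) e₁) := fun T hT =>
    hc.eq_of_mem_frontier (hzf T hT) ((ht T hT).trans_lt (by linarith))
      ((ht2 T hT).trans_lt (by nlinarith))
  -- Cells are sorted by the tangential coordinate of their boundary point, in bins of width `h`.
  -- Within a bin the points differ by at most `h` along `e₁` and `⌈M⌉ h` along `e₂`, so the cell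
  -- indices differ by at most `m = ⌈M⌉ + 2`.
  set g : ℤ × ℤ → ℤ := fun T => ⌊dot (z T - z₀) e₁ / h⌋ with hg
  set m : ℕ := ⌈M⌉₊ + 2 with hm
  set V : Finset ℤ := Finset.Icc ⌊-(R / 2) / h⌋ ⌊R / 2 / h⌋ with hV
  have hmaps : ∀ T ∈ G, g T ∈ V := by
    intro T hT
    have := abs_le.1 (ht T hT)
    rw [hV, Finset.mem_Icc]
    exact ⟨Int.floor_le_floor (by gcongr; exact this.1),
      Int.floor_le_floor (by gcongr; exact this.2)⟩
  have hfib : ∀ b ∈ V, (G.filter fun T => g T = b).card ≤ (2 * m + 1) ^ 2 := by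
    intro b _
    rcases (G.filter fun T => g T = b).eq_empty_or_nonempty with he | ⟨T₀, hT₀⟩
    · rw [he]; simp
    rw [Finset.mem_filter] at hT₀
    obtain ⟨hT₀, hb₀⟩ := hT₀
    have hsub : (G.filter fun T => g T = b) ⊆
        Finset.Icc (T₀.1 - m) (T₀.1 + m) ×ˢ Finset.Icc (T₀.2 - m) (T₀.2 + m) := by
      intro T hT
      rw [Finset.mem_filter] at hT
      obtain ⟨hT, hbT⟩ := hT
      have h1 : |dot (z T - z₀) e₁ - dot (z T₀ - z₀) e₁| ≤ h := by
        have := (Int.abs_sub_lt_one_of_floor_eq_floor (hbT.trans hb₀.symm)).le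
        rwa [← sub_div, abs_div, abs_of_pos hh, div_le_one hh] at this
      have hI : ∀ T ∈ G, dot (z T - z₀) e₁ ∈ Icc (-R) R := fun T hT => by
        have := abs_le.1 (ht T hT); constructor <;> linarith
      have h2 : |dot (z T - z₀) e₂ - dot (z T₀ - z₀) e₂| ≤ ⌈M⌉₊ * h := by
        rw [hgraph T hT, hgraph T₀ hT₀]
        refine (hc.holder.abs_sub_le hR hs _ (hI T hT) _ (hI T₀ hT₀)).trans ?_
        have := Nat.le_ceil M
        gcongr
      have hd1 : ∀ e, dot (z T - z₀) e - dot (z T₀ - z₀) e = dot (z T - z T₀) e := fun e => by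
        simp only [dot, Prod.fst_sub, Prod.snd_sub]; ring
      rw [hd1] at h1 h2
      have hexp := hc.orthonormal.expand (z T - z T₀)
      have hcoord : ∀ u v : ℝ, |u| ≤ 1 → |v| ≤ 1 →
          |dot (z T - z T₀) e₁ * u + dot (z T - z T₀) e₂ * v| ≤ (1 + ⌈M⌉₊) * h := by
        intro u v hu hv
        refine (abs_add_le _ _).trans ?_
        rw [abs_mul, abs_mul]
        have e1 := mul_le_mul h1 hu (abs_nonneg _) hh.le
        have e2 := mul_le_mul h2 hv (abs_nonneg _) (by positivity)
        linarith
      have hx : |(z T).1 - (z T₀).1| ≤ (1 + ⌈M⌉₊) * h := by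
        have := congrArg Prod.fst hexp
        simp only [Prod.fst_add, Prod.smul_fst, smul_eq_mul, Prod.fst_sub] at this
        rw [← this]; exact hcoord _ _ ha hc1
      have hy : |(z T).2 - (z T₀).2| ≤ (1 + ⌈M⌉₊) * h := by
        have := congrArg Prod.snd hexp
        simp only [Prod.snd_add, Prod.smul_snd, smul_eq_mul, Prod.snd_sub] at this
        rw [← this]; exact hcoord _ _ hb hd
      have hidx : ∀ (i i' : ℤ) (x x' : ℝ), x ∈ Icc (i * h) ((i + 1) * h) →
          x' ∈ Icc (i' * h) ((i' + 1) * h) → |x - x'| ≤ (1 + ⌈M⌉₊) * h →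
          i ∈ Finset.Icc (i' - m) (i' + m) := by
        intro i i' x x' hx hx' hxx
        have h3 := abs_le.1 hxx
        have h4 : ((i : ℝ) - i') * h ≤ (⌈M⌉₊ + 2) * h := by linarith [hx.1, hx'.2]
        have h5 : ((i' : ℝ) - i) * h ≤ (⌈M⌉₊ + 2) * h := by linarith [hx'.1, hx.2]
        have h4' := le_of_mul_le_mul_right h4 hh
        have h5' := le_of_mul_le_mul_right h5 hh
        have h6 : i - i' ≤ (m : ℤ) := by rw [hm]; exact_mod_cast h4'
        have h7 : i' - i ≤ (m : ℤ) := by rw [hm]; exact_mod_cast h5'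
        rw [Finset.mem_Icc]; omega
      rw [Finset.mem_product]
      exact ⟨hidx _ _ _ _ (hzc T hT).1 (hzc T₀ hT₀).1 hx,
        hidx _ _ _ _ (hzc T hT).2 (hzc T₀ hT₀).2 hy⟩
    refine (Finset.card_le_card hsub).trans (le_of_eq ?_)
    rw [Finset.card_product, Int.card_Icc, Int.card_Icc, sq]
    congr 1 <;> omega
  have hcard := Finset.card_le_mul_card_image_of_maps_to hmaps ((2 * m + 1) ^ 2) hfib
  have hVcard : (V.card : ℝ) ≤ (R + 2) / h := by
    have hab : ⌊-(R / 2) / h⌋ ≤ ⌊R / 2 / h⌋ := Int.floor_le_floor (by gcongr; linarith)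
    have h1 : (V.card : ℤ) = ⌊R / 2 / h⌋ + 1 - ⌊-(R / 2) / h⌋ := by
      rw [hV, Int.card_Icc]; omega
    have h2 : (V.card : ℝ) = ⌊R / 2 / h⌋ + 1 - ⌊-(R / 2) / h⌋ := by exact_mod_cast h1
    have h3 := Int.floor_le (R / 2 / h)
    have h4 := Int.lt_floor_add_one (-(R / 2) / h)
    have h5 : 1 ≤ 1 / h := by rwa [le_div_iff₀ hh, one_mul]
    have h6 : (R + 2) / h = R / 2 / h - -(R / 2) / h + 2 * (1 / h) := by ring
    rw [h2, h6]
    linarith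
  calc (G.card : ℝ) ≤ ((2 * m + 1) ^ 2 * V.card : ℕ) := by exact_mod_cast hcard
    _ = (2 * (m : ℝ) + 1) ^ 2 * V.card := by push_cast; ring
    _ ≤ (2 * (m : ℝ) + 1) ^ 2 * ((R + 2) / h) := by gcongr
    _ = _ := by rw [hm]; push_cast; ring

lemma IsCsDomain.exists_card_const {s : ℝ} (hs : 1 ≤ s) {Ω : Set (ℝ × ℝ)} (hΩD : Ω ⊆ unitSquare)
    (hΩ : IsCsDomain s Ω) : ∃ N : ℝ, 0 ≤ N ∧ ∀ h : ℝ, 0 < h → h ≤ 1 → ∀ G : Finset (ℤ × ℤ),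
      (∀ T ∈ G, IsSingular h Ω T) → (G.card : ℝ) ≤ N / h := by
  classical
  have hcl := hΩ.isClosed
  obtain ⟨R, P, M, hR, hP, hM, hchart⟩ := hΩ.exists_chart
  have hcomp : IsCompact (frontier Ω) :=
    (isCompact_Icc.prod isCompact_Icc).of_isClosed_subset isClosed_frontier
      (hcl.frontier_subset.trans hΩD)
  obtain ⟨t, htsub, htfin, htcov⟩ := hcomp.finite_cover_balls (show 0 < R / 4 by positivity)
  set N₁ : ℝ := (2 * (⌈M⌉₊ + 2) + 1) ^ 2 * (R + 2) with hN₁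
  -- The boundary is compact and covered by finitely many balls of radius `R / 4` about its points,
  -- in each of which one chart counts the cells.
  refine ⟨htfin.toFinset.card * N₁, by positivity, fun h hh hh1 G hG => ?_⟩
  let F : ℝ × ℝ → Finset (ℤ × ℤ) := fun x => G.filter fun T =>
    ∃ z ∈ cell h T, z ∈ frontier Ω ∧ |(z - x).1| ≤ R / 4 ∧ |(z - x).2| ≤ R / 4
  have hsub : G ⊆ htfin.toFinset.biUnion F := by
    intro T hT
    obtain ⟨z, hzT, hz⟩ := (hG T hT).exists_mem_frontier hcl
    obtain ⟨x, hx, hzx⟩ := mem_iUnion₂.1 (htcov hz)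
    rw [Metric.mem_ball, dist_eq_norm] at hzx
    rw [Finset.mem_biUnion]
    refine ⟨x, htfin.mem_toFinset.2 hx, Finset.mem_filter.2 ⟨hT, z, hzT, hz, ?_, ?_⟩⟩
    · exact (norm_fst_le (z - x)).trans hzx.le
    · exact (norm_snd_le (z - x)).trans hzx.le
  have hcard : ∀ x ∈ htfin.toFinset, ((F x).card : ℝ) ≤ N₁ / h := by
    intro x hx
    obtain ⟨e₁, e₂, ψ, hc⟩ := hchart x (htsub (htfin.mem_toFinset.1 hx))
    exact hc.card_cells_le hs hR hP hh hh1 (F x) fun T hT => (Finset.mem_filter.1 hT).2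
  calc (G.card : ℝ) ≤ ∑ x ∈ htfin.toFinset, ((F x).card : ℝ) := by
        exact_mod_cast (Finset.card_le_card hsub).trans Finset.card_biUnion_le
    _ ≤ ∑ x ∈ htfin.toFinset, N₁ / h := Finset.sum_le_sum hcard
    _ = _ := by rw [Finset.sum_const, nsmul_eq_mul]; ring

/-! ### The global error -/

lemma eLpNorm_recovery_le {k : ℕ} {h : ℝ} (hh : 0 ≤ h) {Ω : Set (ℝ × ℝ)} (hΩ : MeasurableSet Ω)
    (T : ℤ × ℤ) (S : Stencil) :
    eLpNorm (fun z => chi Ω z - recovery k h (cellAverages h (chi Ω)) T S z) 1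
      (volume.restrict (cell h T)) ≤ ENNReal.ofReal (h ^ 2) := by
  rw [recovery_eq_chi, eLpNorm_chi_sub_chi hΩ (measurableSet_recoverySet _ _), ← volume_cell hh T]
  exact measure_mono inter_subset_left

/-- The order of the method on a singular cell. -/
lemma exists_cell_const {s : ℝ} (hs : 1 ≤ s) {k : ℕ} (hk : 1 ≤ k) {Ω : Set (ℝ × ℝ)}
    (hΩ : IsCsDomain s Ω) : ∃ C : ℝ, 0 ≤ C ∧ ∀ h : ℝ, 0 < h →
      ∀ (T : ℤ × ℤ) (S : Stencil), IsSingular h Ω T →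
        IsAerosStencil k (cellAverages h (chi Ω)) T S →
        eLpNorm (fun z => chi Ω z - recovery k h (cellAverages h (chi Ω)) T S z) 1
          (volume.restrict (cell h T)) ≤ ENNReal.ofReal (C * h ^ (min s (2 * k + 1) + 1)) := by
  have hm := hΩ.isClosed.measurableSet
  have hk1 : (1 : ℝ) ≤ k := by exact_mod_cast hk
  rcases hs.eq_or_lt with rfl | hs
  -- Here `r = 1`, and the trivial bound `h²` is already of the required order.
  · refine ⟨1, zero_le_one, fun h hh T S _ _ => (eLpNorm_recovery_le hh.le hm T S).trans ?_⟩
    rw [min_eq_left (by linarith), one_mul, show (1 : ℝ) + 1 = 2 by norm_num, Real.rpow_two]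
  · obtain ⟨C, h₀, hC, hh₀, hloc⟩ := exists_local_const hs hk hΩ
    set r := min s (2 * (k : ℝ) + 1) with hr
    have hr1 : 1 < r := lt_min hs (by linarith)
    refine ⟨C + h₀ ^ (1 - r), by positivity, fun h hh T S hT hS => ?_⟩
    have hp : 0 < h ^ (r + 1) := by positivity
    have hp0 : 0 < h₀ ^ (1 - r) := by positivity
    rcases le_or_gt h h₀ with hle | hgt
    · refine (hloc h hh hle T S hT hS).trans (ENNReal.ofReal_le_ofReal ?_)
      gcongr
      linarith
    · refine (eLpNorm_recovery_le hh.le hm T S).trans (ENNReal.ofReal_le_ofReal ?_)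
      -- On coarse meshes `h > h₀` and `1 - r < 0`, so the area of the cell is absorbed into the
      -- constant.
      calc h ^ 2 = h ^ (1 - r) * h ^ (r + 1) := by
            rw [← Real.rpow_add hh, ← Real.rpow_two]; congr 1; ring
        _ ≤ h₀ ^ (1 - r) * h ^ (r + 1) := by
            refine mul_le_mul_of_nonneg_right ?_ hp.le
            exact Real.rpow_le_rpow_of_nonpos hh₀ hgt.le (by linarith)
        _ ≤ _ := by gcongr; linarith

lemma exists_mesh_index {l : ℕ} (hl : 0 < l) {x : ℝ} (hx : x ∈ Icc (0 : ℝ) 1) :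
    ∃ i ∈ Finset.Ico 0 (l : ℤ), x ∈ Icc (i * (1 / (l : ℝ))) ((i + 1) * (1 / (l : ℝ))) := by
  have hl' : (0 : ℝ) < l := by exact_mod_cast hl
  rcases hx.2.eq_or_lt with rfl | hlt
  · refine ⟨(l : ℤ) - 1, by rw [Finset.mem_Ico]; omega, ?_⟩
    rw [mul_one_div, mul_one_div, mem_Icc, div_le_one hl', le_div_iff₀ hl']
    push_cast
    constructor <;> linarith
  · have h0 : 0 ≤ x * l := mul_nonneg hx.1 hl'.le
    refine ⟨⌊x * l⌋, ?_, ?_⟩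
    · rw [Finset.mem_Ico]
      refine ⟨Int.floor_nonneg.2 h0, Int.floor_lt.2 ?_⟩
      push_cast
      nlinarith
    · rw [mul_one_div, mul_one_div, mem_Icc, div_le_iff₀ hl', le_div_iff₀ hl']
      exact ⟨Int.floor_le _, (Int.lt_floor_add_one _).le⟩

lemma unitSquare_subset_iUnion_cell {l : ℕ} (hl : 0 < l) :
    unitSquare ⊆ ⋃ T : mesh l, cell (1 / (l : ℝ)) T := by
  rintro z ⟨h1, h2⟩
  obtain ⟨i, hi, hi'⟩ := exists_mesh_index hl h1
  obtain ⟨j, hj, hj'⟩ := exists_mesh_index hl h2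
  exact mem_iUnion.2 ⟨⟨(i, j), Finset.mem_product.2 ⟨hi, hj⟩⟩, hi', hj'⟩

lemma ae_notMem_grid (h : ℝ) :
    ∀ᵐ z : ℝ × ℝ, ∀ i : ℤ, z.1 ≠ i * h ∧ z.2 ≠ i * h := by
  rw [ae_all_iff]
  intro i
  have h1 : volume {z : ℝ × ℝ | z.1 = i * h} = 0 := by
    have : {z : ℝ × ℝ | z.1 = i * h} = {(i : ℝ) * h} ×ˢ univ := by ext z; simp
    rw [this, Measure.volume_eq_prod, Measure.prod_prod, Real.volume_singleton, zero_mul]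
  have h2 : volume {z : ℝ × ℝ | z.2 = i * h} = 0 := by
    have : {z : ℝ × ℝ | z.2 = i * h} = univ ×ˢ {(i : ℝ) * h} := by ext z; simp
    rw [this, Measure.volume_eq_prod, Measure.prod_prod, Real.volume_singleton, mul_zero]
  have h3 : ∀ᵐ z : ℝ × ℝ, z.1 ≠ i * h := by rw [ae_iff]; simpa using h1
  have h4 : ∀ᵐ z : ℝ × ℝ, z.2 ≠ i * h := by rw [ae_iff]; simpa using h2
  filter_upwards [h3, h4] with z hz1 hz2 using ⟨hz1, hz2⟩

/-- Closed cells overlap only on grid lines, which are null; elsewhere a single term of the sum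
survives. -/
lemma reconstruction_ae_eq (k : ℕ) {l : ℕ} (hl : 0 < l) (a : ℤ × ℤ → ℝ) (S : ℤ × ℤ → Stencil)
    {T : ℤ × ℤ} (hT : T ∈ mesh l) :
    ∀ᵐ z ∂(volume.restrict (cell (1 / (l : ℝ)) T)),
      reconstruction k l a S z = cellReconstruction k (1 / l) a S T z := by
  set h : ℝ := 1 / (l : ℝ) with hh
  have hpos : 0 < h := by rw [hh]; positivity
  rw [ae_restrict_iff' (measurableSet_cell h T)]
  filter_upwards [ae_notMem_grid h] with z hz hzT
  have huniq : ∀ (i j : ℤ) (x : ℝ), (∀ m : ℤ, x ≠ m * h) → x ∈ Icc (i * h) ((i + 1) * h) →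
      x ∈ Icc (j * h) ((j + 1) * h) → i = j := by
    intro i j x hx hi hj
    have h1 : (i : ℝ) * h < (j + 1) * h :=
      lt_of_lt_of_le (lt_of_le_of_ne hi.1 (hx i).symm) hj.2
    have h2 : (j : ℝ) * h < (i + 1) * h :=
      lt_of_lt_of_le (lt_of_le_of_ne hj.1 (hx j).symm) hi.2
    have h1' : i < j + 1 := by exact_mod_cast lt_of_mul_lt_mul_right h1 hpos.le
    have h2' : j < i + 1 := by exact_mod_cast lt_of_mul_lt_mul_right h2 hpos.le
    omega
  rw [reconstruction, Finset.sum_eq_single_of_mem T hT]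
  · rw [chi, indicator_of_mem hzT, Pi.one_apply, mul_one]
  · intro T' _ hne
    rw [chi, indicator_of_notMem, mul_zero]
    intro hzT'
    exact hne (Prod.ext (huniq _ _ _ (fun m => (hz m).1) hzT'.1 hzT.1)
      (huniq _ _ _ (fun m => (hz m).2) hzT'.2 hzT.2))

/-- On a cell where the average is `0` or `1`, the reconstruction is exact. -/
lemma isSingular_or_chi_ae_eq {h : ℝ} (hh : 0 < h) {Ω : Set (ℝ × ℝ)} (hΩ : MeasurableSet Ω)
    (T : ℤ × ℤ) :
    ((0 < cellAverages h (chi Ω) T ∧ cellAverages h (chi Ω) T < 1) → IsSingular h Ω T) ∧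
    (¬ (0 < cellAverages h (chi Ω) T ∧ cellAverages h (chi Ω) T < 1) →
      ∀ᵐ z ∂(volume.restrict (cell h T)), chi Ω z = cellAverages h (chi Ω) T) := by
  have hfin : volume (cell h T) ≠ ⊤ := (isCompact_cell h T).measure_lt_top.ne
  have h1 := measureReal_inter_add_sdiff (μ := volume) (s := cell h T) hΩ hfin
  have hcell : volume.real (cell h T) = h ^ 2 := by
    rw [Measure.real, volume_cell hh.le, ENNReal.toReal_ofReal (by positivity)]
  rw [hcell] at h1
  have hsdiff : cell h T \ Ω = cell h T ∩ Ωᶜ := sdiff_eq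
  rw [hsdiff] at h1
  have hh2 : 0 < h ^ 2 := by positivity
  rw [cellAverages_chi hh hΩ]
  set x := volume.real (cell h T ∩ Ω) with hx
  set y := volume.real (cell h T ∩ Ωᶜ) with hy
  have hx0 : 0 ≤ x := measureReal_nonneg
  have hy0 : 0 ≤ y := measureReal_nonneg
  have hzero : ∀ E : Set (ℝ × ℝ), volume.real (cell h T ∩ E) = 0 → volume (cell h T ∩ E) = 0 :=
    fun E hE => ((ENNReal.toReal_eq_zero_iff _).1 hE).resolve_right
      (volume_cell_inter_ne_top _ _ _)
  rw [inv_mul_eq_div, div_pos_iff_of_pos_right hh2, div_lt_one hh2]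
  refine ⟨fun ⟨hx1, hx2⟩ => ⟨fun h0 => ?_, fun h0 => ?_⟩, fun hn => ?_⟩
  · rw [hx, Measure.real, h0] at hx1; simp at hx1
  · have : y = 0 := by rw [hy, Measure.real, h0]; simp
    linarith
  · rw [ae_restrict_iff' (measurableSet_cell h T)]
    rcases hx0.eq_or_lt with hx1 | hx1
    · rw [← hx1, zero_div]
      have h0 := hzero Ω hx1.symm
      filter_upwards [measure_eq_zero_iff_ae_notMem.1 h0] with z hz hzT
      exact indicator_of_notMem (fun hzΩ => hz ⟨hzT, hzΩ⟩) _
    · have hx2 : x = h ^ 2 := by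
        have : h ^ 2 ≤ x := by by_contra! hlt; exact hn ⟨hx1, hlt⟩
        linarith
      rw [hx2, div_self hh2.ne']
      have h0 := hzero Ωᶜ (by linarith)
      filter_upwards [measure_eq_zero_iff_ae_notMem.1 h0] with z hz hzT
      have hzΩ : z ∈ Ω := by by_contra hc; exact hz ⟨hzT, hc⟩
      rw [chi, indicator_of_mem hzΩ, Pi.one_apply]

end Aeros

end

/-! ### Summation over the mesh -/

theorem mainTheorem1 (s : ℝ) (hs : 1 ≤ s) (k : ℕ) (hk : 1 ≤ k)
    (Ω : Set (ℝ × ℝ)) (hΩD : Ω ⊆ Aeros.unitSquare) (hΩ : Aeros.IsCsDomain s Ω) :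
    ∃ C : ℝ, ∀ l : ℕ, 1 < l → ∀ S : ℤ × ℤ → Aeros.Stencil,
      (∀ T ∈ Aeros.mesh l, Aeros.IsSingular (1 / l) Ω T →
        Aeros.IsAerosStencil k (Aeros.cellAverages (1 / l) (Aeros.chi Ω)) T (S T)) →
      (∀ T ∈ Aeros.mesh l, Aeros.IsSingular (1 / l) Ω T →
        MeasureTheory.eLpNorm
          (fun z => Aeros.chi Ω z -
            Aeros.recovery k (1 / l) (Aeros.cellAverages (1 / l) (Aeros.chi Ω)) T (S T) z) 1
          (MeasureTheory.volume.restrict (Aeros.cell (1 / l) T))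
          ≤ ENNReal.ofReal (C * (1 / (l : ℝ)) ^ (min s (2 * k + 1) + 1))) ∧
      MeasureTheory.eLpNorm
        (fun z => Aeros.chi Ω z -
          Aeros.reconstruction k l (Aeros.cellAverages (1 / l) (Aeros.chi Ω)) S z) 1
        (MeasureTheory.volume.restrict Aeros.unitSquare)
        ≤ ENNReal.ofReal (C * (1 / (l : ℝ)) ^ min s (2 * k + 1)) := by
  classical
  obtain ⟨C, hC, hcell⟩ := Aeros.exists_cell_const hs hk hΩ
  obtain ⟨N, hN, hcard⟩ := hΩ.exists_card_const hs hΩD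
  have hm := hΩ.isClosed.measurableSet
  refine ⟨C + N * C, fun l hl S hS => ?_⟩
  have hl0 : 0 < l := by omega
  have hl' : (1 : ℝ) ≤ l := by exact_mod_cast hl.le
  have hh : 0 < 1 / (l : ℝ) := by positivity
  have hh1 : 1 / (l : ℝ) ≤ 1 := by rw [div_le_one (by positivity)]; exact hl'
  have hae := fun T hT => Aeros.reconstruction_ae_eq k hl0
    (Aeros.cellAverages (1 / l) (Aeros.chi Ω)) S (T := T) hT
  generalize hhdef : 1 / (l : ℝ) = h at *
  set r := min s (2 * (k : ℝ) + 1) with hr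
  have hNC : 0 ≤ N * C := mul_nonneg hN hC
  refine ⟨fun T hT hsing => (hcell h hh T (S T) hsing (hS T hT hsing)).trans
    (ENNReal.ofReal_le_ofReal ?_), ?_⟩
  · gcongr
    linarith
  set u := fun z => Aeros.chi Ω z -
    Aeros.reconstruction k l (Aeros.cellAverages h (Aeros.chi Ω)) S z with hu
  have hlocal : ∀ T ∈ Aeros.mesh l, ∫⁻ z in Aeros.cell h T, ‖u z‖ₑ
      ≤ if Aeros.IsSingular h Ω T then ENNReal.ofReal (C * h ^ (r + 1)) else 0 := by
    intro T hT
    obtain ⟨h1, h2⟩ := Aeros.isSingular_or_chi_ae_eq hh hm T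
    by_cases hav : 0 < Aeros.cellAverages h (Aeros.chi Ω) T ∧
        Aeros.cellAverages h (Aeros.chi Ω) T < 1
    · rw [if_pos (h1 hav)]
      refine le_trans (le_of_eq ?_) (hcell h hh T (S T) (h1 hav) (hS T hT (h1 hav)))
      rw [eLpNorm_one_eq_lintegral_enorm]
      refine lintegral_congr_ae ?_
      filter_upwards [hae T hT] with z hz
      rw [hu]
      simp only
      rw [hz, Aeros.cellReconstruction, if_pos hav]
    · refine le_trans (le_of_eq ?_) zero_le
      rw [lintegral_eq_zero_iff' ?_]
      · filter_upwards [hae T hT, h2 hav] with z hz hz'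
        rw [hu]
        simp only
        rw [hz, Aeros.cellReconstruction, if_neg hav, hz', sub_self]
        simp
      -- Measurability on this cell follows from the integrand being almost everywhere zero.
      · refine AEMeasurable.congr (f := fun _ => 0) aemeasurable_const ?_
        filter_upwards [hae T hT, h2 hav] with z hz hz'
        rw [hu]
        simp only
        rw [hz, Aeros.cellReconstruction, if_neg hav, hz', sub_self]
        simp
  rw [eLpNorm_one_eq_lintegral_enorm]
  have hcov := Aeros.unitSquare_subset_iUnion_cell hl0
  rw [hhdef] at hcov
  calc ∫⁻ z in Aeros.unitSquare, ‖u z‖ₑ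
      -- Subadditivity over the closed cells is enough; their overlaps are harmless.
      ≤ ∫⁻ z in ⋃ T : Aeros.mesh l, Aeros.cell h T, ‖u z‖ₑ := lintegral_mono_set hcov
    _ ≤ ∑' T : Aeros.mesh l, ∫⁻ z in Aeros.cell h T, ‖u z‖ₑ := lintegral_iUnion_le _ _
    _ = ∑ T ∈ Aeros.mesh l, ∫⁻ z in Aeros.cell h T, ‖u z‖ₑ := by
        rw [tsum_fintype]
        exact Finset.sum_coe_sort (Aeros.mesh l) fun T => ∫⁻ z in Aeros.cell h T, ‖u z‖ₑ
    _ ≤ ∑ T ∈ Aeros.mesh l,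
          if Aeros.IsSingular h Ω T then ENNReal.ofReal (C * h ^ (r + 1)) else 0 :=
        Finset.sum_le_sum hlocal
    _ = ((Aeros.mesh l).filter (Aeros.IsSingular h Ω)).card * ENNReal.ofReal (C * h ^ (r + 1)) := by
        rw [← Finset.sum_filter, Finset.sum_const, nsmul_eq_mul]
    _ ≤ ENNReal.ofReal (N / h) * ENNReal.ofReal (C * h ^ (r + 1)) := by
        gcongr
        rw [← ENNReal.ofReal_natCast]
        exact ENNReal.ofReal_le_ofReal
          (hcard h hh hh1 _ fun T hT => (Finset.mem_filter.1 hT).2)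
    _ = ENNReal.ofReal (N * C * h ^ r) := by
        rw [← ENNReal.ofReal_mul (by positivity), Real.rpow_add_one hh.ne']
        congr 1
        field_simp
    _ ≤ _ := by
        refine ENNReal.ofReal_le_ofReal ?_
        gcongr
        linarith
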